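/- Let $Y_1$ and $Y_2$ be closed connected 3-manifolds, that is, non-empty compact connected Hausdorff spaces locally homeomorphic to $\mathbb{R}^3$ (oriented manifolds are included, but orientability is not needed). For a space $X$ all cohomology is singular cohomology with $\mathbb{Z}_2$ coefficients, and products are cup products. Put $$k(X)=\dim_{\mathbb{Z}_2}\{a\in H^1(X;\mathbb{Z}_2) : a^2=0\},$$ and for $x\in H^2(X;\mathbb{Z}_2)$ put $$v_X(x)=\left|\left\{\{a,b,c\}\subset H^1(X;\mathbb{Z}_2) \;:\; a+b+c=0,\ ab+bc+ac=x\right\}\right|.$$ Let $Y_1\# Y_2$ be a connected sum: given open embeddings $\varphi_i:\mathbb{R}^3\to Y_i$, remove the images of the open unit ball and identify $\varphi_1(u)$ with $\varphi_2(u)$ for every unit vector $u$. The embeddings are arbitrary; when $Y_1,Y_2$ are oriented, this includes the orientation-compatible gluings, i.e. the oriented connected sum. For $x_i\in H^2(Y_i;\mathbb{Z}_2)$ write $x_1+x_2=q_1^*x_1+q_2^*x_2\in H^2(Y_1\# Y_2;\mathbb{Z}_2)$, where $q_i:Y_1\# Y_2\to Y_i$ is the collapse map, which is the identity on $Y_i$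 minus the ball and maps the other side into the closed ball $\varphi_i(\{\|u\|\le 1\})$. Let $x_1\in H^2(Y_1;\mathbb{Z}_2)$ and $x_2\in H^2(Y_2;\mathbb{Z}_2)$, and suppose that $x_1$ is not a cup-square, i.e. $x_1\neq a^2$ for all $a\in H^1(Y_1;\mathbb{Z}_2)$. Then $$v_{Y_1\# Y_2}(x_1+x_2)\equiv\begin{cases} v_{Y_1}(x_1) \pmod 2, & \text{if } k(Y_2)=0,\\ 0 \pmod 2, & \text{otherwise.}\end{cases}$$ -/

import Mathlib

namespace KleinFour

noncomputable section

/-! ### Singular cohomology with coefficients in `ℤ/2` -/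

/-- Singular `n`-simplices of a topological space. -/
abbrev SingSimplex (n : ℕ) (X : Type*) [TopologicalSpace X] : Type _ :=
  C(stdSimplex ℝ (Fin (n + 1)), X)

/-- Precomposition of a singular simplex with the affine map of standard simplices that is induced
by a map of vertices. -/
def SingSimplex.reindex {X : Type*} [TopologicalSpace X] {m n : ℕ} (σ : SingSimplex n X)
    (θ : Fin (m + 1) → Fin (n + 1)) : SingSimplex m X :=
  σ.comp ⟨stdSimplex.map θ, stdSimplex.continuous_map θ⟩

lemma SingSimplex.reindex_reindex {X : Type*} [TopologicalSpace X] {l m n : ℕ}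
    (σ : SingSimplex n X) (θ : Fin (m + 1) → Fin (n + 1)) (η : Fin (l + 1) → Fin (m + 1)) :
    (σ.reindex θ).reindex η = σ.reindex (θ ∘ η) := by
  ext s
  simp [SingSimplex.reindex, stdSimplex.map_comp_apply]

/-- The `i`-th face of a singular simplex (opposite to the `i`-th vertex). -/
def SingSimplex.face {X : Type*} [TopologicalSpace X] {n : ℕ} (σ : SingSimplex (n + 1) X)
    (i : Fin (n + 2)) : SingSimplex n X :=
  σ.reindex i.succAbove

/-- Singular `n`-cochains with values in `ℤ/2`. -/
abbrev Cochain (n : ℕ) (X : Type*) [TopologicalSpace X] : Type _ :=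
  SingSimplex n X → ZMod 2

/-- The singular coboundary operator (no signs are needed modulo 2). -/
def coboundary (n : ℕ) (X : Type*) [TopologicalSpace X] :
    Cochain n X →ₗ[ZMod 2] Cochain (n + 1) X where
  toFun f := fun σ => ∑ i : Fin (n + 2), f (σ.face i)
  map_add' f g := by
    funext σ
    simp [Finset.sum_add_distrib]
  map_smul' c f := by
    funext σ
    simp [Finset.mul_sum]

/-- Singular cocycles. -/
def cocycles (n : ℕ) (X : Type*) [TopologicalSpace X] : Submodule (ZMod 2) (Cochain n X) :=
  LinearMap.ker (coboundary n X)

/-- Singular coboundaries. -/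
def coboundaries : (n : ℕ) → (X : Type*) → [TopologicalSpace X] →
    Submodule (ZMod 2) (Cochain n X)
  | 0, _, _ => ⊥
  | n + 1, X, _ => LinearMap.range (coboundary n X)

/-- Every coboundary is a cocycle. -/
lemma coboundaries_le_cocycles (n : ℕ) (X : Type*) [TopologicalSpace X] :
    coboundaries n X ≤ cocycles n X := by
  cases n with
  | zero => exact bot_le
  | succ n =>
    rintro _ ⟨f, rfl⟩
    change coboundary (n + 1) X (coboundary n X f) = 0
    funext σ
    change ∑ i : Fin (n + 3), ∑ j : Fin (n + 2), f ((σ.face i).face j) = 0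
    rw [← Finset.sum_product' Finset.univ Finset.univ
      (fun (i : Fin (n + 3)) (j : Fin (n + 2)) => f ((σ.face i).face j))]
    have key : ∀ (i : Fin (n + 3)) (j : Fin (n + 2)),
        (σ.face i).face j = (σ.face (i.succAbove j)).face (j.predAbove i) := by
      intro i j
      simp only [SingSimplex.face, SingSimplex.reindex_reindex]
      congr 1
      funext k
      exact (Fin.succAbove_succAbove_succAbove_predAbove i j k).symm
    refine Finset.sum_involution
      (fun p _ => (p.1.succAbove p.2, p.2.predAbove p.1)) ?_ ?_ ?_ ?_
    · rintro ⟨i, j⟩ _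
      dsimp only
      rw [← key i j]
      exact CharTwo.add_self_eq_zero _
    · rintro ⟨i, j⟩ _ _ h
      exact Fin.succAbove_ne i j (congrArg Prod.fst h)
    · intro _ _
      exact Finset.mem_univ _
    · rintro ⟨i, j⟩ _
      exact Prod.ext (Fin.succAbove_succAbove_predAbove i j)
        (Fin.predAbove_predAbove_succAbove i j)

/-- The singular cohomology `Hⁿ(X; ℤ/2)`: cocycles modulo coboundaries. -/
abbrev Cohomology (n : ℕ) (X : Type*) [TopologicalSpace X] : Type _ :=
  cocycles n X ⧸ (coboundaries n X).submoduleOf (cocycles n X)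

/-! ### Functoriality -/

/-- Pullback of cochains along a continuous map. -/
def cochainPullback (n : ℕ) {X Y : Type*} [TopologicalSpace X] [TopologicalSpace Y]
    (F : C(X, Y)) : Cochain n Y →ₗ[ZMod 2] Cochain n X where
  toFun f := fun σ => f (F.comp σ)
  map_add' _ _ := rfl
  map_smul' _ _ := rfl

lemma coboundary_cochainPullback (n : ℕ) {X Y : Type*} [TopologicalSpace X] [TopologicalSpace Y]
    (F : C(X, Y)) (f : Cochain n Y) :
    coboundary n X (cochainPullback n F f) = cochainPullback (n + 1) F (coboundary n Y f) :=
  rfl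

lemma cochainPullback_mem_cocycles (n : ℕ) {X Y : Type*} [TopologicalSpace X]
    [TopologicalSpace Y] (F : C(X, Y)) :
    ∀ f ∈ cocycles n Y, cochainPullback n F f ∈ cocycles n X := by
  intro f hf
  have hf' : coboundary n Y f = 0 := hf
  change coboundary n X (cochainPullback n F f) = 0
  rw [coboundary_cochainPullback, hf', map_zero]

/-- The map `F^* : Hⁿ(Y; ℤ/2) → Hⁿ(X; ℤ/2)` induced by a continuous map `F : X → Y`. -/
def pullback (n : ℕ) {X Y : Type*} [TopologicalSpace X] [TopologicalSpace Y] (F : C(X, Y)) :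
    Cohomology n Y →ₗ[ZMod 2] Cohomology n X :=
  Submodule.mapQ _ _
    ((cochainPullback n F).restrict (cochainPullback_mem_cocycles n F)) (by
      rintro ⟨f, hf⟩ h
      rw [Submodule.mem_comap, Submodule.submoduleOf, Submodule.mem_comap]
      rw [Submodule.submoduleOf, Submodule.mem_comap] at h
      cases n with
      | zero =>
        have h0 : f = 0 := h
        subst h0
        exact map_zero (cochainPullback 0 F)
      | succ n =>
        obtain ⟨g, hg⟩ := h
        exact ⟨cochainPullback n F g, by
          rw [coboundary_cochainPullback, hg]; rfl⟩)

/-! ### The cup product `H¹ × H¹ → H²` -/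

/-- The Alexander–Whitney cup product of two 1-cochains: evaluate the first factor on the front
edge `[0, 1]` and the second one on the back edge `[1, 2]`. -/
def cochainCup (X : Type*) [TopologicalSpace X] :
    Cochain 1 X →ₗ[ZMod 2] Cochain 1 X →ₗ[ZMod 2] Cochain 2 X :=
  LinearMap.mk₂ (ZMod 2)
    (fun f g => fun σ => f (σ.reindex ![0, 1]) * g (σ.reindex ![1, 2]))
    (by intro f f' g; funext σ; simp [add_mul])
    (by intro c f g; funext σ; simp [mul_assoc])
    (by intro f g g'; funext σ; simp [mul_add])
    (by intro c f g; funext σ; simp [mul_left_comm])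

lemma coboundary_one_apply {X : Type*} [TopologicalSpace X] (f : Cochain 1 X)
    (σ : SingSimplex 2 X) :
    coboundary 1 X f σ =
      f (σ.reindex ![1, 2]) + f (σ.reindex ![0, 2]) + f (σ.reindex ![0, 1]) := by
  have h0 : (Fin.succAbove (0 : Fin 3)) = ![1, 2] := by decide
  have h1 : (Fin.succAbove (1 : Fin 3)) = ![0, 2] := by decide
  have h2 : (Fin.succAbove (2 : Fin 3)) = ![0, 1] := by decide
  change ∑ i : Fin 3, f (σ.reindex i.succAbove) = _
  rw [Fin.sum_univ_three, h0, h1, h2]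

lemma cocycle_one_apply {X : Type*} [TopologicalSpace X] {f : Cochain 1 X}
    (hf : f ∈ cocycles 1 X) (σ : SingSimplex 2 X) :
    f (σ.reindex ![0, 2]) = f (σ.reindex ![0, 1]) + f (σ.reindex ![1, 2]) := by
  have h := congrFun (show coboundary 1 X f = 0 from hf) σ
  rw [coboundary_one_apply, Pi.zero_apply] at h
  generalize f (σ.reindex ![0, 2]) = a at *
  generalize f (σ.reindex ![0, 1]) = b at *
  generalize f (σ.reindex ![1, 2]) = c at *
  revert a b c
  decide

lemma cochainCup_mem_cocycles {X : Type*} [TopologicalSpace X] {f g : Cochain 1 X}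
    (hf : f ∈ cocycles 1 X) (hg : g ∈ cocycles 1 X) :
    cochainCup X f g ∈ cocycles 2 X := by
  change coboundary 2 X (cochainCup X f g) = 0
  funext σ
  have h0 : (Fin.succAbove (0 : Fin 4)) = ![1, 2, 3] := by decide
  have h1 : (Fin.succAbove (1 : Fin 4)) = ![0, 2, 3] := by decide
  have h2 : (Fin.succAbove (2 : Fin 4)) = ![0, 1, 3] := by decide
  have h3 : (Fin.succAbove (3 : Fin 4)) = ![0, 1, 2] := by decide
  have f1 := cocycle_one_apply hf (σ.reindex ![0, 1, 2])
  have g1 := cocycle_one_apply hg (σ.reindex ![1, 2, 3])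
  change ∑ i : Fin 4, f ((σ.reindex i.succAbove).reindex ![0, 1]) *
    g ((σ.reindex i.succAbove).reindex ![1, 2]) = 0
  rw [Fin.sum_univ_four, h0, h1, h2, h3]
  simp only [SingSimplex.reindex_reindex] at f1 g1 ⊢
  have e1 : (![0, 1, 2] : Fin 3 → Fin 4) ∘ (![0, 2] : Fin 2 → Fin 3) = ![0, 2] := by decide
  have e2 : (![0, 1, 2] : Fin 3 → Fin 4) ∘ (![0, 1] : Fin 2 → Fin 3) = ![0, 1] := by decide
  have e3 : (![0, 1, 2] : Fin 3 → Fin 4) ∘ (![1, 2] : Fin 2 → Fin 3) = ![1, 2] := by decide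
  have e4 : (![1, 2, 3] : Fin 3 → Fin 4) ∘ (![0, 2] : Fin 2 → Fin 3) = ![1, 3] := by decide
  have e5 : (![1, 2, 3] : Fin 3 → Fin 4) ∘ (![0, 1] : Fin 2 → Fin 3) = ![1, 2] := by decide
  have e6 : (![1, 2, 3] : Fin 3 → Fin 4) ∘ (![1, 2] : Fin 2 → Fin 3) = ![2, 3] := by decide
  have e7 : (![0, 2, 3] : Fin 3 → Fin 4) ∘ (![0, 1] : Fin 2 → Fin 3) = ![0, 2] := by decide
  have e8 : (![0, 2, 3] : Fin 3 → Fin 4) ∘ (![1, 2] : Fin 2 → Fin 3) = ![2, 3] := by decide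
  have e9 : (![0, 1, 3] : Fin 3 → Fin 4) ∘ (![0, 1] : Fin 2 → Fin 3) = ![0, 1] := by decide
  have e10 : (![0, 1, 3] : Fin 3 → Fin 4) ∘ (![1, 2] : Fin 2 → Fin 3) = ![1, 3] := by decide
  rw [e1, e2, e3] at f1
  rw [e4, e5, e6] at g1
  rw [e2, e3, e5, e6, e7, e8, e9, e10, f1, g1]
  have two : (2 : ZMod 2) = 0 := rfl
  linear_combination (f (σ.reindex ![1, 2]) * g (σ.reindex ![2, 3])
    + f (σ.reindex ![0, 1]) * g (σ.reindex ![2, 3])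
    + f (σ.reindex ![0, 1]) * g (σ.reindex ![1, 2])) * two

lemma cochainCup_coboundary_left {X : Type*} [TopologicalSpace X] (h : Cochain 0 X)
    {g : Cochain 1 X} (hg : g ∈ cocycles 1 X) :
    cochainCup X (coboundary 0 X h) g ∈ coboundaries 2 X := by
  refine ⟨fun τ => h (τ.reindex ![0]) * g τ, ?_⟩
  funext σ
  rw [coboundary_one_apply, cocycle_one_apply hg]
  have h0 : (Fin.succAbove (0 : Fin 2)) = ![1] := by decide
  have h1 : (Fin.succAbove (1 : Fin 2)) = ![0] := by decide
  change _ = (∑ i : Fin 2, h ((σ.reindex ![0, 1]).reindex i.succAbove)) * g (σ.reindex ![1, 2])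
  rw [Fin.sum_univ_two, h0, h1]
  simp only [SingSimplex.reindex_reindex]
  have e1 : (![0, 1] : Fin 2 → Fin 3) ∘ (![0] : Fin 1 → Fin 2) = ![0] := by decide
  have e2 : (![0, 1] : Fin 2 → Fin 3) ∘ (![1] : Fin 1 → Fin 2) = ![1] := by decide
  have e3 : (![1, 2] : Fin 2 → Fin 3) ∘ (![0] : Fin 1 → Fin 2) = ![1] := by decide
  have e4 : (![0, 2] : Fin 2 → Fin 3) ∘ (![0] : Fin 1 → Fin 2) = ![0] := by decide
  rw [e1, e2, e3, e4]
  have two : (2 : ZMod 2) = 0 := rfl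
  linear_combination (h (σ.reindex ![0]) * g (σ.reindex ![0, 1])) * two

lemma cochainCup_add_swap {X : Type*} [TopologicalSpace X] {f g : Cochain 1 X}
    (hf : f ∈ cocycles 1 X) (hg : g ∈ cocycles 1 X) :
    cochainCup X f g + cochainCup X g f ∈ coboundaries 2 X := by
  refine ⟨fun τ => f τ * g τ, ?_⟩
  funext σ
  rw [coboundary_one_apply, cocycle_one_apply hf, cocycle_one_apply hg]
  change _ = f (σ.reindex ![0, 1]) * g (σ.reindex ![1, 2])
    + g (σ.reindex ![0, 1]) * f (σ.reindex ![1, 2])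
  have two : (2 : ZMod 2) = 0 := rfl
  linear_combination (f (σ.reindex ![0, 1]) * g (σ.reindex ![0, 1])
    + f (σ.reindex ![1, 2]) * g (σ.reindex ![1, 2])) * two

lemma cochainCup_coboundary_right {X : Type*} [TopologicalSpace X] {f : Cochain 1 X}
    (hf : f ∈ cocycles 1 X) (h : Cochain 0 X) :
    cochainCup X f (coboundary 0 X h) ∈ coboundaries 2 X := by
  have hh : coboundary 0 X h ∈ cocycles 1 X := coboundaries_le_cocycles 1 X ⟨h, rfl⟩
  have h1 := cochainCup_add_swap hf hh
  have h2 := cochainCup_coboundary_left h hf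
  simpa using Submodule.sub_mem _ h1 h2

/-- The cup product of two 1-cocycles, as a class in `H²`. -/
def cocycleCup (X : Type*) [TopologicalSpace X] :
    cocycles 1 X →ₗ[ZMod 2] cocycles 1 X →ₗ[ZMod 2] Cohomology 2 X :=
  LinearMap.mk₂ (ZMod 2)
    (fun f g => Submodule.Quotient.mk
      ⟨cochainCup X f.1 g.1, cochainCup_mem_cocycles f.2 g.2⟩)
    (by
      intro f f' g
      rw [← Submodule.Quotient.mk_add]
      congr 1
      exact Subtype.ext (LinearMap.map_add₂ (cochainCup X) f.1 f'.1 g.1))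
    (by
      intro c f g
      rw [← Submodule.Quotient.mk_smul]
      congr 1
      exact Subtype.ext (LinearMap.map_smul₂ (cochainCup X) c f.1 g.1))
    (by
      intro f g g'
      rw [← Submodule.Quotient.mk_add]
      congr 1
      exact Subtype.ext ((cochainCup X f.1).map_add g.1 g'.1))
    (by
      intro c f g
      rw [← Submodule.Quotient.mk_smul]
      congr 1
      exact Subtype.ext ((cochainCup X f.1).map_smul c g.1))

/-- The cup product `H¹(X; ℤ/2) × H¹(X; ℤ/2) → H²(X; ℤ/2)`. -/
def cup (X : Type*) [TopologicalSpace X] :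
    Cohomology 1 X →ₗ[ZMod 2] Cohomology 1 X →ₗ[ZMod 2] Cohomology 2 X :=
  Submodule.liftQ _
    (LinearMap.flip (Submodule.liftQ _ (LinearMap.flip (cocycleCup X)) (by
      rintro ⟨g, hg⟩ ⟨h, rfl⟩
      rw [LinearMap.mem_ker]
      ext f
      exact (Submodule.Quotient.mk_eq_zero _).2 (cochainCup_coboundary_right f.2 h))))
    (by
      rintro ⟨f, hf⟩ ⟨h, rfl⟩
      rw [LinearMap.mem_ker]
      ext g
      exact (Submodule.Quotient.mk_eq_zero _).2 (cochainCup_coboundary_left h g.2))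

/-- The value of the cup product on classes of cocycles. -/
lemma cup_mk_mk (X : Type*) [TopologicalSpace X] (f g : cocycles 1 X) :
    cup X (Submodule.Quotient.mk f) (Submodule.Quotient.mk g) =
      Submodule.Quotient.mk ⟨cochainCup X f.1 g.1, cochainCup_mem_cocycles f.2 g.2⟩ :=
  rfl

/-- The cup product on `H¹(X; ℤ/2)` is commutative. -/
lemma cup_comm {X : Type*} [TopologicalSpace X] (a b : Cohomology 1 X) :
    cup X a b = cup X b a := by
  induction a using Submodule.Quotient.induction_on with
  | _ f =>
    induction b using Submodule.Quotient.induction_on with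
    | _ g =>
      rw [cup_mk_mk, cup_mk_mk]
      refine (Submodule.Quotient.eq _).2 ?_
      have h := cochainCup_add_swap f.2 g.2
      rw [← sub_neg_eq_add, ZModModule.neg_eq_self] at h
      exact h

/-- The squaring map `a ↦ a²` from `H¹(X; ℤ/2)` to `H²(X; ℤ/2)`, which is linear. -/
def cupSquare (X : Type*) [TopologicalSpace X] : Cohomology 1 X →ₗ[ZMod 2] Cohomology 2 X where
  toFun a := cup X a a
  map_add' a b := by
    rw [LinearMap.map_add₂, map_add, map_add, cup_comm b a,
      add_assoc, ← add_assoc (cup X a b), ZModModule.add_self, zero_add]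
  map_smul' c a := by
    have hc : c * c = c := by
      revert c
      decide
    rw [LinearMap.map_smul₂, map_smul, smul_smul, hc, RingHom.id_apply]

/-! ### The two invariants -/

/-- `k(X)`: the dimension over `ℤ/2` of `{a ∈ H¹(X; ℤ/2) : a² = 0}`. -/
def k (X : Type*) [TopologicalSpace X] : ℕ :=
  Module.finrank (ZMod 2) (LinearMap.ker (cupSquare X))

/-- The sets `{a, b, c} ⊂ H¹(X; ℤ/2)` with `a + b + c = 0` and `ab + bc + ac = x`.
(As `a + b + c = 0`, such a set determines `a`, `b`, `c` with multiplicity, up to order.) -/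
def kleinTriples {X : Type*} [TopologicalSpace X] (x : Cohomology 2 X) :
    Set (Set (Cohomology 1 X)) :=
  {T | ∃ a b c : Cohomology 1 X, T = {a, b, c} ∧ a + b + c = 0 ∧
    cup X a b + cup X b c + cup X a c = x}

/-- `v_X(x)`: the number of the sets in `kleinTriples x`. -/
def v {X : Type*} [TopologicalSpace X] (x : Cohomology 2 X) : ℕ :=
  (kleinTriples x).ncard

/-! ### Connected sums -/

/-- Euclidean 3-space. -/
abbrev E3 : Type := EuclideanSpace ℝ (Fin 3)

/-- An open embedding of `ℝ³` into `Y`. The image of the closed unit ball is a (tamely) embedded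
closed 3-ball in `Y`. -/
structure BallChart (Y : Type*) [TopologicalSpace Y] where
  toFun : E3 → Y
  isOpenEmbedding : Topology.IsOpenEmbedding toFun

/-- The space obtained from `Y` by removing the image of the open unit ball. -/
abbrev BallChart.Punctured {Y : Type*} [TopologicalSpace Y] (φ : BallChart Y) : Type _ :=
  {p : Y // p ∉ φ.toFun '' Metric.ball 0 1}

/-- The identification `φ₁(u) ∼ φ₂(u)`, for `u` in the unit sphere, of the boundary spheres. -/
inductive GlueRel {Y₁ Y₂ : Type*} [TopologicalSpace Y₁] [TopologicalSpace Y₂]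
    (φ₁ : BallChart Y₁) (φ₂ : BallChart Y₂) :
    φ₁.Punctured ⊕ φ₂.Punctured → φ₁.Punctured ⊕ φ₂.Punctured → Prop
  | glue (p : φ₁.Punctured) (q : φ₂.Punctured) (u : E3) (hu : u ∈ Metric.sphere (0 : E3) 1)
      (hp : p.1 = φ₁.toFun u) (hq : q.1 = φ₂.toFun u) : GlueRel φ₁ φ₂ (Sum.inl p) (Sum.inr q)

/-- The connected sum `Y₁ # Y₂`: remove the two open balls and glue the boundary spheres. -/
def ConnSum {Y₁ Y₂ : Type*} [TopologicalSpace Y₁] [TopologicalSpace Y₂]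
    (φ₁ : BallChart Y₁) (φ₂ : BallChart Y₂) : Type _ :=
  Quot (GlueRel φ₁ φ₂)

instance {Y₁ Y₂ : Type*} [TopologicalSpace Y₁] [TopologicalSpace Y₂]
    (φ₁ : BallChart Y₁) (φ₂ : BallChart Y₂) : TopologicalSpace (ConnSum φ₁ φ₂) :=
  inferInstanceAs (TopologicalSpace (Quot (GlueRel φ₁ φ₂)))

/-- The radial map `u ↦ max(0, 2 - ‖u‖) u`. It is the identity on the unit sphere, maps the shell
`1 ≤ ‖u‖ < 2` homeomorphically onto the punctured closed unit ball, and vanishes for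
`‖u‖ ≥ 2`. -/
def radial (u : E3) : E3 := max 0 (2 - ‖u‖) • u

lemma continuous_radial : Continuous radial := by
  unfold radial
  fun_prop

lemma radial_of_norm_eq_one {u : E3} (hu : ‖u‖ = 1) : radial u = u := by
  norm_num [radial, hu]

lemma radial_of_two_le {u : E3} (hu : 2 ≤ ‖u‖) : radial u = 0 := by
  rw [radial, max_eq_left (by linarith), zero_smul]

/-- The radial map in the coordinates of a ball chart, extended by `0` to all of `Y`. Restricted to
the complement of the open unit ball it collapses that complement onto the closed unit ball,
relative to the unit sphere. -/
def BallChart.squash {Y : Type*} [TopologicalSpace Y] [T2Space Y] (φ : BallChart Y) :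
    C(Y, E3) where
  toFun := Function.extend φ.toFun radial 0
  continuous_toFun := by
    rw [continuous_iff_continuousAt]
    intro y
    by_cases hy : y ∈ Set.range φ.toFun
    · obtain ⟨u, rfl⟩ := hy
      rw [← φ.isOpenEmbedding.continuousAt_iff,
        Function.extend_comp φ.isOpenEmbedding.injective]
      exact continuous_radial.continuousAt
    · have hK : IsClosed (φ.toFun '' Metric.closedBall 0 2) :=
        ((isCompact_closedBall (0 : E3) 2).image φ.isOpenEmbedding.continuous).isClosed
      have hmem : (φ.toFun '' Metric.closedBall 0 2)ᶜ ∈ nhds y :=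
        hK.isOpen_compl.mem_nhds fun h => hy (Set.image_subset_range _ _ h)
      refine (continuousAt_const (y := (0 : E3))).congr ?_
      filter_upwards [hmem] with z hz
      by_cases hz' : z ∈ Set.range φ.toFun
      · obtain ⟨u, rfl⟩ := hz'
        rw [φ.isOpenEmbedding.injective.extend_apply, radial_of_two_le]
        by_contra hlt
        exact hz ⟨u, by simpa using (not_le.1 hlt).le, rfl⟩
      · rw [Function.extend_apply' _ _ _ hz', Pi.zero_apply]

lemma BallChart.squash_apply {Y : Type*} [TopologicalSpace Y] [T2Space Y] (φ : BallChart Y)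
    (u : E3) : φ.squash (φ.toFun u) = radial u :=
  φ.isOpenEmbedding.injective.extend_apply _ _ _

lemma BallChart.squash_apply_of_norm_eq_one {Y : Type*} [TopologicalSpace Y] [T2Space Y]
    (φ : BallChart Y) {u : E3} (hu : ‖u‖ = 1) : φ.squash (φ.toFun u) = u := by
  rw [φ.squash_apply, radial_of_norm_eq_one hu]

/-- The collapse `Y₁ # Y₂ → Y₁`: the identity on `Y₁` minus the ball, while the rest of `Y₂` is
collapsed onto the ball of `Y₁`. -/
def collapseLeft {Y₁ Y₂ : Type*} [TopologicalSpace Y₁] [TopologicalSpace Y₂] [T2Space Y₂]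
    (φ₁ : BallChart Y₁) (φ₂ : BallChart Y₂) : C(ConnSum φ₁ φ₂, Y₁) where
  toFun := Quot.lift (Sum.elim (fun p => p.1) (fun q => φ₁.toFun (φ₂.squash q.1))) (by
    rintro _ _ ⟨p, q, u, hu, hp, hq⟩
    simp only [Sum.elim_inl, Sum.elim_inr]
    rw [hp, hq, φ₂.squash_apply_of_norm_eq_one (by simpa using hu)])
  continuous_toFun := continuous_quot_lift _ (continuous_sumElim.2
    ⟨continuous_subtype_val, φ₁.isOpenEmbedding.continuous.comp
      (φ₂.squash.continuous.comp continuous_subtype_val)⟩)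

/-- The collapse `Y₁ # Y₂ → Y₂`. -/
def collapseRight {Y₁ Y₂ : Type*} [TopologicalSpace Y₁] [TopologicalSpace Y₂] [T2Space Y₁]
    (φ₁ : BallChart Y₁) (φ₂ : BallChart Y₂) : C(ConnSum φ₁ φ₂, Y₂) where
  toFun := Quot.lift (Sum.elim (fun p => φ₂.toFun (φ₁.squash p.1)) (fun q => q.1)) (by
    rintro _ _ ⟨p, q, u, hu, hp, hq⟩
    simp only [Sum.elim_inl, Sum.elim_inr]
    rw [hp, hq, φ₁.squash_apply_of_norm_eq_one (by simpa using hu)])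
  continuous_toFun := continuous_quot_lift _ (continuous_sumElim.2
    ⟨φ₂.isOpenEmbedding.continuous.comp
      (φ₁.squash.continuous.comp continuous_subtype_val), continuous_subtype_val⟩)

/-- The class `x₁ + x₂ ∈ Hⁿ(Y₁ # Y₂; ℤ/2)` of a pair of classes `xᵢ ∈ Hⁿ(Yᵢ; ℤ/2)`, formed by
means of the maps `Hⁿ(Yᵢ) → Hⁿ(Y₁ # Y₂)` induced by the two collapses. -/
def sumClass (n : ℕ) {Y₁ Y₂ : Type*} [TopologicalSpace Y₁] [TopologicalSpace Y₂]
    [T2Space Y₁] [T2Space Y₂] (φ₁ : BallChart Y₁) (φ₂ : BallChart Y₂)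
    (x₁ : Cohomology n Y₁) (x₂ : Cohomology n Y₂) : Cohomology n (ConnSum φ₁ φ₂) :=
  pullback n (collapseLeft φ₁ φ₂) x₁ + pullback n (collapseRight φ₁ φ₂) x₂

end

end KleinFour

/-!
Write `Q(a, b) = a² + ab + b²`. If `a + b + c = 0` then `ab + bc + ac = Q(a, b)`, and if `x` is not a
square, then every triple counted by `v(x)` consists of three distinct classes and so arises from six
pairs: the number `N(x)` of pairs with `Q(a, b) = x` is `6 v(x)` (`card_pairs`).

For a connected sum `S` of `Y₁` and `Y₂`, the collapses induce an isomorphism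
`H¹(Y₁) ⊕ H¹(Y₂) → H¹(S)` and an injection `H²(Y₁) ⊕ H²(Y₂) → H²(S)`, and products of a class
of `Y₁` with a class of `Y₂` vanish. Hence `Q` splits, `N(x₁ + x₂) = N(x₁) N(x₂)`, and `x₁ + x₂` is
not a square, so that `v(x₁ + x₂) = v(x₁) N(x₂)` (`v_sumClass`). Modulo `2`, the involution
`(a, b) ↦ (b, a)` reduces `N(x₂)` to the number of square roots of `x₂` (`card_pairs_modEq`). If
`k(Y₂) ≠ 0`, translation by a nonzero class of square zero shows that this number is even. If
`k(Y₂) = 0`, squaring is an injective linear map `H¹(Y₂) → H²(Y₂)`; by Poincaré duality it is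
bijective, and the number is `1`.

The splitting is a Mayer–Vietoris argument for the cover of `S` by the two open sets on which one of
the collapses is a homeomorphism onto the complement of the center of the ball; these sets meet in
an open shell. It uses that the punctured Euclidean space is connected and has no first cohomology.

Of Poincaré duality only two parts are needed: `H¹` is finite (`finite_cohomology_one`), and `H²` has
at most as many elements as `H¹` (`card_cohomology_two_le`). For the latter, let `z` be a `2`-cycle.
Over small balls the equation `∂w = z` has solutions, and two of them differ over a point `y` by an
element of `H_3(Y, Y \ y) = ℤ/2`. The monodromy of the solutions is a class in `H¹`. If it vanishes,
then local solutions can be chosen that agree at all points, and they glue to a global one, as the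
homology of `Y` modulo the complement of a compact set is zero above degree `3` and is detected at
points in degree `3` (`good_of_isCompact`). So `z ↦` monodromy embeds `H_2` into `H¹`, and `H²` is dual
to `H_2`. The theorem on small chains, homotopy invariance and the relative Mayer–Vietoris
sequence for singular chains are established first, by barycentric subdivision and prism operators.
-/

namespace KleinFour

noncomputable section

open Topology

/-! ### Free chains and tuple chains modulo 2 -/

/-- The boundary map between free `ℤ/2`-modules that sends a generator to the sum of its faces. -/
def freeBd {A B : Type*} {n : ℕ} (d : Fin n → A → B) : (A →₀ ZMod 2) →ₗ[ZMod 2] (B →₀ ZMod 2) :=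
  Finsupp.linearCombination (ZMod 2) fun a => ∑ i, Finsupp.single (d i a) 1

lemma freeBd_single {A B : Type*} {n : ℕ} (d : Fin n → A → B) (a : A) :
    freeBd d (Finsupp.single a 1) = ∑ i, Finsupp.single (d i a) 1 := by
  simp [freeBd]

lemma free_ext {A M : Type*} [AddCommGroup M] [Module (ZMod 2) M]
    {f g : (A →₀ ZMod 2) →ₗ[ZMod 2] M}
    (h : ∀ a, f (Finsupp.single a 1) = g (Finsupp.single a 1)) : f = g :=
  Finsupp.lhom_ext' fun a => LinearMap.ext_ring (h a)

lemma freeBd_freeBd {A B C : Type*} {n : ℕ} (d : Fin (n + 2) → A → B) (d' : Fin (n + 1) → B → C)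
    (key : ∀ a i j, d' j (d i a) = d' (j.predAbove i) (d (i.succAbove j) a)) (c : A →₀ ZMod 2) :
    freeBd d' (freeBd d c) = 0 := by
  suffices h : freeBd d' ∘ₗ freeBd d = 0 from LinearMap.congr_fun h c
  refine free_ext fun a => ?_
  rw [LinearMap.comp_apply, freeBd_single, map_sum]
  simp_rw [freeBd_single]
  rw [← Finset.sum_product' Finset.univ Finset.univ
    (fun (i : Fin (n + 2)) (j : Fin (n + 1)) => Finsupp.single (d' j (d i a)) (1 : ZMod 2))]
  refine Finset.sum_involution
    (fun p _ => (p.1.succAbove p.2, p.2.predAbove p.1)) ?_ ?_ ?_ ?_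
  · rintro ⟨i, j⟩ _
    dsimp only
    rw [← key a i j]
    exact ZModModule.add_self _
  · rintro ⟨i, j⟩ _ _ h
    exact Fin.succAbove_ne i j (congrArg Prod.fst h)
  · intro _ _
    exact Finset.mem_univ _
  · rintro ⟨i, j⟩ _
    exact Prod.ext (Fin.succAbove_succAbove_predAbove i j)
      (Fin.predAbove_predAbove_succAbove i j)

/-- A linear map out of a free module respects submodules spanned by generators as soon as it does
so on generators. -/
lemma map_mem_of_supported {A M : Type*} [AddCommGroup M] [Module (ZMod 2) M]
    (f : (A →₀ ZMod 2) →ₗ[ZMod 2] M) {P : Set A} {N : Submodule (ZMod 2) M}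
    (h : ∀ a ∈ P, f (Finsupp.single a 1) ∈ N) {c : A →₀ ZMod 2}
    (hc : c ∈ Finsupp.supported (ZMod 2) (ZMod 2) P) : f c ∈ N := by
  rw [Finsupp.supported_eq_span_single] at hc
  have : Submodule.span (ZMod 2) ((fun i => Finsupp.single i (1 : ZMod 2)) '' P) ≤ N.comap f := by
    rw [Submodule.span_le]
    rintro _ ⟨a, ha, rfl⟩
    exact h a ha
  exact this hc

/-- Chains on ordered `n`-tuples of elements of `V`. The empty tuple is included, so that these form
an augmented complex. -/
abbrev Tup (n : ℕ) (V : Type*) : Type _ := (Fin n → V) →₀ ZMod 2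

/-- The boundary of a chain of tuples. -/
def tbd (n : ℕ) (V : Type*) : Tup (n + 1) V →ₗ[ZMod 2] Tup n V :=
  freeBd fun i w => w ∘ i.succAbove

/-- The chain consisting of a single tuple. -/
abbrev tup {n : ℕ} {V : Type*} (w : Fin n → V) : Tup n V := Finsupp.single w 1

lemma tbd_tup {n : ℕ} {V : Type*} (w : Fin (n + 1) → V) :
    tbd n V (tup w) = ∑ i : Fin (n + 1), tup (w ∘ i.succAbove) :=
  freeBd_single _ _

lemma tbd_tbd {n : ℕ} {V : Type*} (c : Tup (n + 2) V) : tbd n V (tbd (n + 1) V c) = 0 := by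
  refine freeBd_freeBd _ _ (fun w i j => ?_) c
  funext k
  exact congrArg w (Fin.succAbove_succAbove_succAbove_predAbove i j k).symm

/-- The cone with apex `b`. -/
def cone {n : ℕ} {V : Type*} (b : V) : Tup n V →ₗ[ZMod 2] Tup (n + 1) V :=
  Finsupp.linearCombination (ZMod 2) fun w => tup (Fin.cons b w)

lemma cone_tup {n : ℕ} {V : Type*} (b : V) (w : Fin n → V) :
    cone b (tup w) = tup (Fin.cons b w : Fin (n + 1) → V) := by
  simp [cone]

lemma tbd_cone_zero {V : Type*} (b : V) (c : Tup 0 V) : tbd 0 V (cone b c) = c := by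
  suffices h : tbd 0 V ∘ₗ cone b = LinearMap.id from LinearMap.congr_fun h c
  refine free_ext fun w => ?_
  rw [LinearMap.comp_apply, cone_tup, tbd_tup, Fin.sum_univ_one]
  exact congrArg tup (Subsingleton.elim _ _)

lemma tbd_cone {n : ℕ} {V : Type*} (b : V) (c : Tup (n + 1) V) :
    tbd (n + 1) V (cone b c) = c + cone b (tbd n V c) := by
  suffices h : tbd (n + 1) V ∘ₗ cone b = LinearMap.id + cone b ∘ₗ tbd n V from
    LinearMap.congr_fun h c
  refine free_ext fun w => ?_
  rw [LinearMap.comp_apply, cone_tup, tbd_tup, Fin.sum_univ_succ]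
  simp only [LinearMap.add_apply, LinearMap.id_apply, LinearMap.comp_apply, tbd_tup, map_sum,
    cone_tup]
  congr 1
  refine Finset.sum_congr rfl fun i _ => congrArg tup ?_
  funext k
  refine Fin.cases ?_ (fun k => ?_) k
  · simp
  · simp

/-- The map of tuple chains induced by a map of vertices. -/
def tmap {n : ℕ} {V U : Type*} (f : V → U) : Tup n V →ₗ[ZMod 2] Tup n U :=
  Finsupp.linearCombination (ZMod 2) fun w => tup (f ∘ w)

lemma tmap_tup {n : ℕ} {V U : Type*} (f : V → U) (w : Fin n → V) :
    tmap f (tup w) = tup (f ∘ w) := by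
  simp [tmap]

lemma tbd_tmap {n : ℕ} {V U : Type*} (f : V → U) (c : Tup (n + 1) V) :
    tbd n U (tmap f c) = tmap f (tbd n V c) := by
  suffices h : tbd n U ∘ₗ tmap f = tmap f ∘ₗ tbd n V from LinearMap.congr_fun h c
  refine free_ext fun w => ?_
  simp only [LinearMap.comp_apply, tmap_tup, tbd_tup, map_sum]
  rfl

lemma tmap_cone {n : ℕ} {V U : Type*} (f : V → U) (b : V) (c : Tup n V) :
    tmap f (cone b c) = cone (f b) (tmap f c) := by
  suffices h : tmap f ∘ₗ cone b = cone (f b) ∘ₗ tmap f from LinearMap.congr_fun h c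
  refine free_ext fun w => ?_
  simp only [LinearMap.comp_apply, tmap_tup, cone_tup]
  exact congrArg tup (Fin.comp_cons _ _ _)

/-- The chain homotopy between two chain maps `α` and `β` that agree on the empty tuple, built
recursively by coning off the error from an apex chosen for each tuple. -/
def coneHomotopy {V U : Type*} (α β : ∀ n, Tup n V →ₗ[ZMod 2] Tup n U)
    (b : ∀ n, (Fin (n + 1) → V) → U) : ∀ n, Tup n V →ₗ[ZMod 2] Tup (n + 1) U
  | 0 => 0
  | n + 1 => Finsupp.linearCombination (ZMod 2) fun w =>
      cone (b n w) (α (n + 1) (tup w) + β (n + 1) (tup w) +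
        coneHomotopy α β b n (tbd n V (tup w)))

lemma coneHomotopy_succ {V U : Type*} (α β : ∀ n, Tup n V →ₗ[ZMod 2] Tup n U)
    (b : ∀ n, (Fin (n + 1) → V) → U) (n : ℕ) (w : Fin (n + 1) → V) :
    coneHomotopy α β b (n + 1) (tup w) = cone (b n w) (α (n + 1) (tup w) + β (n + 1) (tup w) +
        coneHomotopy α β b n (tbd n V (tup w))) := by
  rw [coneHomotopy, Finsupp.linearCombination_single, one_smul]

lemma tbd_coneHomotopy {V U : Type*} (α β : ∀ n, Tup n V →ₗ[ZMod 2] Tup n U)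
    (b : ∀ n, (Fin (n + 1) → V) → U) (h0 : α 0 = β 0)
    (hα : ∀ n c, tbd n U (α (n + 1) c) = α n (tbd n V c))
    (hβ : ∀ n c, tbd n U (β (n + 1) c) = β n (tbd n V c)) (n : ℕ) (c : Tup (n + 1) V) :
    tbd (n + 1) U (coneHomotopy α β b (n + 1) c) =
      α (n + 1) c + β (n + 1) c + coneHomotopy α β b n (tbd n V c) := by
  have key : ∀ n (w : Fin (n + 1) → V),
      tbd n U (α (n + 1) (tup w) + β (n + 1) (tup w) +
        coneHomotopy α β b n (tbd n V (tup w))) = 0 →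
      tbd (n + 1) U (coneHomotopy α β b (n + 1) (tup w)) =
        α (n + 1) (tup w) + β (n + 1) (tup w) + coneHomotopy α β b n (tbd n V (tup w)) := by
    intro n w h
    rw [coneHomotopy_succ, tbd_cone, h, map_zero, add_zero]
  have ext : ∀ n, (∀ w : Fin (n + 1) → V,
      tbd (n + 1) U (coneHomotopy α β b (n + 1) (tup w)) =
        α (n + 1) (tup w) + β (n + 1) (tup w) + coneHomotopy α β b n (tbd n V (tup w))) →
      ∀ c, tbd (n + 1) U (coneHomotopy α β b (n + 1) c) =
      α (n + 1) c + β (n + 1) c + coneHomotopy α β b n (tbd n V c) := by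
    intro n h c
    have : tbd (n + 1) U ∘ₗ coneHomotopy α β b (n + 1) =
        α (n + 1) + β (n + 1) + coneHomotopy α β b n ∘ₗ tbd n V := free_ext h
    exact LinearMap.congr_fun this c
  induction n with
  | zero =>
    refine ext 0 (fun w => key 0 w ?_) c
    simp only [coneHomotopy, LinearMap.zero_apply, add_zero, map_add, hα, hβ, h0]
    exact ZModModule.add_self _
  | succ n ih =>
    refine ext (n + 1) (fun w => key (n + 1) w ?_) c
    rw [map_add, map_add, hα, hβ, ih, tbd_tbd, map_zero, add_zero]
    exact ZModModule.add_self _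

lemma tmap_coneHomotopy {V U V' U' : Type*} {α β : ∀ n, Tup n V →ₗ[ZMod 2] Tup n U}
    {b : ∀ n, (Fin (n + 1) → V) → U} {α' β' : ∀ n, Tup n V' →ₗ[ZMod 2] Tup n U'}
    {b' : ∀ n, (Fin (n + 1) → V') → U'} (f : V → V') (g : U → U')
    (hα : ∀ n c, tmap g (α n c) = α' n (tmap f c)) (hβ : ∀ n c, tmap g (β n c) = β' n (tmap f c))
    (hb : ∀ n w, g (b n w) = b' n (f ∘ w)) (n : ℕ) (c : Tup n V) :
    tmap g (coneHomotopy α β b n c) = coneHomotopy α' β' b' n (tmap f c) := by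
  induction n with
  | zero => simp [coneHomotopy]
  | succ n ih =>
    suffices h : tmap g ∘ₗ coneHomotopy α β b (n + 1) = coneHomotopy α' β' b' (n + 1) ∘ₗ tmap f from
      LinearMap.congr_fun h c
    refine free_ext fun w => ?_
    rw [LinearMap.comp_apply, LinearMap.comp_apply, tmap_tup, coneHomotopy_succ, coneHomotopy_succ,
      tmap_cone, map_add (tmap g), map_add (tmap g), hα, hβ, ih, hb, ← tbd_tmap, tmap_tup]

/-! ### Convex combinations -/

/-- A topological space with a continuous operation of convex combination of finitely many points,
which is compatible with relabelling and sends the vertices of the simplex to the given points.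
Subdivision and prism operators are built in `V` and transported to singular chains by `push`. -/
class ConvexSpc (V : Type) [TopologicalSpace V] where
  comb : ∀ {n : ℕ}, (Fin n → V) → C(stdSimplex ℝ (Fin n), V)
  comb_map : ∀ {m n : ℕ} (θ : Fin m → Fin n) (w : Fin n → V) (t : stdSimplex ℝ (Fin m)),
    comb w (stdSimplex.map θ t) = comb (w ∘ θ) t
  comb_vertex : ∀ {n : ℕ} (w : Fin n → V) (i : Fin n), comb w (stdSimplex.vertex i) = w i

open ConvexSpc

/-- A map that preserves convex combinations. -/
def IsConvexMap {V U : Type} [TopologicalSpace V] [TopologicalSpace U] [ConvexSpc V] [ConvexSpc U]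
    (f : V → U) : Prop :=
  ∀ (n : ℕ) (w : Fin n → V) (t : stdSimplex ℝ (Fin n)), f (comb w t) = comb (f ∘ w) t

instance (m : ℕ) : ConvexSpc (stdSimplex ℝ (Fin m)) where
  comb {n} w := {
    toFun := fun t => ⟨fun j => ∑ i, t i * w i j, fun j =>
      Finset.sum_nonneg fun i _ => mul_nonneg (stdSimplex.zero_le t i) (stdSimplex.zero_le (w i) j),
      by
        rw [Finset.sum_comm]
        simp [← Finset.mul_sum]⟩
    continuous_toFun := by
      refine Continuous.subtype_mk (continuous_pi fun j => continuous_finsetSum _ fun i _ => ?_) _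
      exact ((continuous_apply i).comp continuous_subtype_val).mul continuous_const }
  comb_map {m' n'} θ w t := by
    ext j
    change ∑ i, (FunOnFinite.linearMap ℝ ℝ θ t) i * w i j = ∑ i, t i * w (θ i) j
    simp only [FunOnFinite.linearMap_apply_apply, Finset.sum_mul]
    rw [← Finset.sum_fiberwise Finset.univ θ (fun i => t i * w (θ i) j)]
    refine Finset.sum_congr rfl fun k _ => Finset.sum_congr rfl fun i hi => ?_
    rw [(Finset.mem_filter.1 hi).2]
  comb_vertex {n} w i := by
    ext j
    change ∑ k, (Pi.single i 1 : Fin n → ℝ) k * w k j = w i j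
    rw [Finset.sum_eq_single i (fun k _ hk => by rw [Pi.single_eq_of_ne hk, zero_mul])
      (fun h => absurd (Finset.mem_univ i) h), Pi.single_eq_same, one_mul]

lemma comb_stdSimplex_apply {m n : ℕ} (w : Fin n → stdSimplex ℝ (Fin m))
    (t : stdSimplex ℝ (Fin n)) (j : Fin m) : comb w t j = ∑ i, t i * w i j := rfl

instance {V U : Type} [TopologicalSpace V] [TopologicalSpace U] [ConvexSpc V] [ConvexSpc U] :
    ConvexSpc (V × U) where
  comb w := (comb (Prod.fst ∘ w)).prodMk (comb (Prod.snd ∘ w))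
  comb_map θ w t := Prod.ext (comb_map θ (Prod.fst ∘ w) t) (comb_map θ (Prod.snd ∘ w) t)
  comb_vertex w i := Prod.ext (comb_vertex (Prod.fst ∘ w) i) (comb_vertex (Prod.snd ∘ w) i)

/-- A space in which the combination map of every tuple preserves convex combinations. -/
class AssocConvexSpc (V : Type) [TopologicalSpace V] extends ConvexSpc V where
  comb_comb : ∀ {n : ℕ} (w : Fin n → V), IsConvexMap (comb w)

lemma isConvexMap_comb {V : Type} [TopologicalSpace V] [AssocConvexSpc V] {n : ℕ} (w : Fin n → V) :
    IsConvexMap (comb w) :=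
  AssocConvexSpc.comb_comb w

instance (m : ℕ) : AssocConvexSpc (stdSimplex ℝ (Fin m)) where
  comb_comb {n} w k u t := by
    ext j
    rw [comb_stdSimplex_apply, comb_stdSimplex_apply]
    simp only [comb_stdSimplex_apply, Function.comp_apply, Finset.sum_mul, Finset.mul_sum]
    rw [Finset.sum_comm]
    simp only [mul_assoc]

lemma comb_const {m n : ℕ} (x : stdSimplex ℝ (Fin m)) (t : stdSimplex ℝ (Fin n)) :
    comb (fun _ => x) t = x := by
  ext j
  rw [comb_stdSimplex_apply, ← Finset.sum_mul, stdSimplex.sum_eq_one, one_mul]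

/-! ### Singular chains -/

/-- Singular `p`-chains with coefficients in `ℤ/2`. -/
abbrev Chain (p : ℕ) (X : Type*) [TopologicalSpace X] : Type _ := SingSimplex p X →₀ ZMod 2

/-- The boundary of singular chains. -/
def bd (p : ℕ) (X : Type*) [TopologicalSpace X] : Chain (p + 1) X →ₗ[ZMod 2] Chain p X :=
  freeBd fun i σ => σ.face i

lemma bd_single {p : ℕ} {X : Type*} [TopologicalSpace X] (σ : SingSimplex (p + 1) X) :
    bd p X (Finsupp.single σ 1) = ∑ i : Fin (p + 2), Finsupp.single (σ.face i) 1 :=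
  freeBd_single _ _

lemma bd_bd {p : ℕ} {X : Type*} [TopologicalSpace X] (c : Chain (p + 2) X) :
    bd p X (bd (p + 1) X c) = 0 := by
  refine freeBd_freeBd _ _ (fun σ i j => ?_) c
  simp only [SingSimplex.face, SingSimplex.reindex_reindex]
  congr 1
  funext k
  exact (Fin.succAbove_succAbove_succAbove_predAbove i j k).symm

/-- The map of singular chains induced by a continuous map. -/
def chainMap (p : ℕ) {X Y : Type*} [TopologicalSpace X] [TopologicalSpace Y] (f : C(X, Y)) :
    Chain p X →ₗ[ZMod 2] Chain p Y :=
  Finsupp.linearCombination (ZMod 2) fun σ => Finsupp.single (f.comp σ) 1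

lemma chainMap_single {p : ℕ} {X Y : Type*} [TopologicalSpace X] [TopologicalSpace Y] (f : C(X, Y))
    (σ : SingSimplex p X) :
    chainMap p f (Finsupp.single σ 1) = Finsupp.single (f.comp σ) 1 := by
  simp [chainMap]

lemma bd_chainMap {p : ℕ} {X Y : Type*} [TopologicalSpace X] [TopologicalSpace Y] (f : C(X, Y))
    (c : Chain (p + 1) X) : bd p Y (chainMap (p + 1) f c) = chainMap p f (bd p X c) := by
  suffices h : bd p Y ∘ₗ chainMap (p + 1) f = chainMap p f ∘ₗ bd p X from LinearMap.congr_fun h c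
  refine free_ext fun σ => ?_
  simp only [LinearMap.comp_apply, chainMap_single, bd_single, map_sum]
  rfl

/-- The singular chain in `X` obtained from a chain of tuples in a convex space `V`, by spanning
affine simplices and composing with a map `V → X`. -/
def push {V : Type} [TopologicalSpace V] [ConvexSpc V] {X : Type*} [TopologicalSpace X]
    {q : ℕ} (g : C(V, X)) : Tup (q + 1) V →ₗ[ZMod 2] Chain q X :=
  Finsupp.linearCombination (ZMod 2) fun w => Finsupp.single (g.comp (comb w)) 1

section Push

variable {V U : Type} [TopologicalSpace V] [TopologicalSpace U]
  {X : Type*} [TopologicalSpace X] {q : ℕ}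

lemma push_tup [ConvexSpc V] (g : C(V, X)) (w : Fin (q + 1) → V) :
    push g (tup w) = Finsupp.single (g.comp (comb w)) 1 := by
  simp [push]

lemma bd_push [ConvexSpc V] (g : C(V, X)) (c : Tup (q + 2) V) :
    bd q X (push g c) = push g (tbd (q + 1) V c) := by
  suffices h : bd q X ∘ₗ push g = push g ∘ₗ tbd (q + 1) V from LinearMap.congr_fun h c
  refine free_ext fun w => ?_
  simp only [LinearMap.comp_apply, push_tup, bd_single, tbd_tup, map_sum]
  refine Finset.sum_congr rfl fun i _ => congrArg (fun s => Finsupp.single s 1) ?_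
  ext t
  exact congrArg g (comb_map _ _ _)

lemma push_tmap [ConvexSpc V] [ConvexSpc U] (g : C(U, X)) (f : C(V, U)) (hf : IsConvexMap f)
    (c : Tup (q + 1) V) : push g (tmap f c) = push (g.comp f) c := by
  suffices h : push g ∘ₗ tmap f = push (g.comp f) from LinearMap.congr_fun h c
  refine free_ext fun w => ?_
  rw [LinearMap.comp_apply, tmap_tup, push_tup, push_tup]
  congr 1
  ext t
  exact congrArg g (hf _ w t).symm

end Push

/-- The vertices of the standard simplex. -/
abbrev vtx (p : ℕ) : Fin (p + 1) → stdSimplex ℝ (Fin (p + 1)) := fun i => stdSimplex.vertex i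

lemma comb_vtx (p : ℕ) (t : stdSimplex ℝ (Fin (p + 1))) : comb (vtx p) t = t := by
  ext j
  rw [comb_stdSimplex_apply]
  simp [Pi.single_apply]

lemma push_vtx {X : Type*} [TopologicalSpace X] {p : ℕ} (σ : SingSimplex p X) :
    push σ (tup (vtx p)) = Finsupp.single σ 1 := by
  rw [push_tup]
  congr 1
  ext t
  exact congrArg σ (comb_vtx p t)

lemma comb_comp_vtx {V : Type} [TopologicalSpace V] [ConvexSpc V] {p : ℕ} (w : Fin (p + 1) → V) :
    comb w ∘ vtx p = w :=
  funext fun i => comb_vertex w i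

/-! ### Barycentric subdivision -/

/-- The barycenter of a nonempty tuple of points. -/
def bary {V : Type} [TopologicalSpace V] [ConvexSpc V] {n : ℕ} (w : Fin (n + 1) → V) : V :=
  comb w stdSimplex.barycenter

/-- Barycentric subdivision of tuple chains. -/
def sdT (V : Type) [TopologicalSpace V] [ConvexSpc V] : ∀ n, Tup n V →ₗ[ZMod 2] Tup n V
  | 0 => LinearMap.id
  | n + 1 => Finsupp.linearCombination (ZMod 2) fun w => cone (bary w) (sdT V n (tbd n V (tup w)))

lemma sdT_succ {V : Type} [TopologicalSpace V] [ConvexSpc V] {n : ℕ} (w : Fin (n + 1) → V) :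
    sdT V (n + 1) (tup w) = cone (bary w) (sdT V n (tbd n V (tup w))) := by
  rw [sdT, Finsupp.linearCombination_single, one_smul]

lemma tbd_sdT {V : Type} [TopologicalSpace V] [ConvexSpc V] (n : ℕ) (c : Tup (n + 1) V) :
    tbd n V (sdT V (n + 1) c) = sdT V n (tbd n V c) := by
  induction n with
  | zero =>
    suffices h : tbd 0 V ∘ₗ sdT V 1 = sdT V 0 ∘ₗ tbd 0 V from LinearMap.congr_fun h c
    refine free_ext fun w => ?_
    rw [LinearMap.comp_apply, sdT_succ, tbd_cone_zero]
    rfl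
  | succ n ih =>
    suffices h : tbd (n + 1) V ∘ₗ sdT V (n + 2) = sdT V (n + 1) ∘ₗ tbd (n + 1) V from
      LinearMap.congr_fun h c
    refine free_ext fun w => ?_
    rw [LinearMap.comp_apply, sdT_succ, tbd_cone, ih, tbd_tbd, map_zero, map_zero, add_zero]
    rfl

lemma tmap_sdT {V U : Type} [TopologicalSpace V] [ConvexSpc V] [TopologicalSpace U] [ConvexSpc U]
    {f : V → U} (hf : IsConvexMap f) (n : ℕ) (c : Tup n V) :
    tmap f (sdT V n c) = sdT U n (tmap f c) := by
  induction n with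
  | zero => rfl
  | succ n ih =>
    suffices h : tmap f ∘ₗ sdT V (n + 1) = sdT U (n + 1) ∘ₗ tmap f from LinearMap.congr_fun h c
    refine free_ext fun w => ?_
    rw [LinearMap.comp_apply, LinearMap.comp_apply, sdT_succ, tmap_cone, ih, ← tbd_tmap, tmap_tup,
      sdT_succ, bary, hf]
    rfl

/-- The chain homotopy between barycentric subdivision and the identity. -/
def sdHomT (V : Type) [TopologicalSpace V] [ConvexSpc V] (n : ℕ) :
    Tup n V →ₗ[ZMod 2] Tup (n + 1) V :=
  coneHomotopy (fun _ => LinearMap.id) (sdT V) (fun _ => bary) n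

lemma tmap_sdHomT {V U : Type} [TopologicalSpace V] [ConvexSpc V] [TopologicalSpace U]
    [ConvexSpc U] {f : V → U} (hf : IsConvexMap f) (n : ℕ) (c : Tup n V) :
    tmap f (sdHomT V n c) = sdHomT U n (tmap f c) :=
  tmap_coneHomotopy f f (fun _ _ => rfl) (fun n c => tmap_sdT hf n c) (fun _ w => hf _ w _) n c

lemma tbd_sdHomT {V : Type} [TopologicalSpace V] [ConvexSpc V] (n : ℕ) (c : Tup (n + 1) V) :
    tbd (n + 1) V (sdHomT V (n + 1) c) =
      c + sdT V (n + 1) c + sdHomT V n (tbd n V c) :=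
  tbd_coneHomotopy (fun _ => LinearMap.id) (sdT V) (fun _ => bary) rfl (fun _ _ => rfl) tbd_sdT n c

/-- Barycentric subdivision of singular chains. -/
def sd (p : ℕ) (X : Type*) [TopologicalSpace X] : Chain p X →ₗ[ZMod 2] Chain p X :=
  Finsupp.linearCombination (ZMod 2) fun σ => push σ (sdT _ (p + 1) (tup (vtx p)))

lemma sd_single {p : ℕ} {X : Type*} [TopologicalSpace X] (σ : SingSimplex p X) :
    sd p X (Finsupp.single σ 1) = push σ (sdT _ (p + 1) (tup (vtx p))) := by
  simp [sd]

/-- The chain homotopy between barycentric subdivision of singular chains and the identity. -/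
def sdHom (p : ℕ) (X : Type*) [TopologicalSpace X] : Chain p X →ₗ[ZMod 2] Chain (p + 1) X :=
  Finsupp.linearCombination (ZMod 2) fun σ => push σ (sdHomT _ (p + 1) (tup (vtx p)))

lemma sdHom_single {p : ℕ} {X : Type*} [TopologicalSpace X] (σ : SingSimplex p X) :
    sdHom p X (Finsupp.single σ 1) = push σ (sdHomT _ (p + 1) (tup (vtx p))) := by
  simp [sdHom]

section

variable {V : Type} [TopologicalSpace V] [AssocConvexSpc V] {X : Type*} [TopologicalSpace X]
  {p : ℕ}

lemma sd_push (g : C(V, X)) (c : Tup (p + 1) V) : sd p X (push g c) = push g (sdT V (p + 1) c) := by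
  suffices h : sd p X ∘ₗ push g = push g ∘ₗ sdT V (p + 1) from LinearMap.congr_fun h c
  refine free_ext fun w => ?_
  rw [LinearMap.comp_apply, LinearMap.comp_apply, push_tup, sd_single,
    ← push_tmap g (comb w) (isConvexMap_comb w), tmap_sdT (isConvexMap_comb w), tmap_tup,
    comb_comp_vtx]

lemma sdHom_push (g : C(V, X)) (c : Tup (p + 1) V) :
    sdHom p X (push g c) = push g (sdHomT V (p + 1) c) := by
  suffices h : sdHom p X ∘ₗ push g = push g ∘ₗ sdHomT V (p + 1) from LinearMap.congr_fun h c
  refine free_ext fun w => ?_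
  rw [LinearMap.comp_apply, LinearMap.comp_apply, push_tup, sdHom_single,
    ← push_tmap g (comb w) (isConvexMap_comb w), tmap_sdHomT (isConvexMap_comb w), tmap_tup,
    comb_comp_vtx]

lemma bd_sd (c : Chain (p + 1) X) : bd p X (sd (p + 1) X c) = sd p X (bd p X c) := by
  suffices h : bd p X ∘ₗ sd (p + 1) X = sd p X ∘ₗ bd p X from LinearMap.congr_fun h c
  refine free_ext fun σ => ?_
  rw [LinearMap.comp_apply, LinearMap.comp_apply, sd_single, bd_push, tbd_sdT, ← sd_push,
    ← bd_push, push_vtx]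

lemma bd_sdHom_zero (c : Chain 0 X) : bd 0 X (sdHom 0 X c) = c + sd 0 X c := by
  suffices h : bd 0 X ∘ₗ sdHom 0 X = LinearMap.id + sd 0 X from LinearMap.congr_fun h c
  refine free_ext fun σ => ?_
  rw [LinearMap.comp_apply, LinearMap.add_apply, LinearMap.id_apply, sdHom_single, sd_single,
    bd_push, tbd_sdHomT, map_add, map_add, push_vtx, sdHomT, coneHomotopy, LinearMap.zero_apply,
    map_zero, add_zero]

lemma bd_sdHom (c : Chain (p + 1) X) :
    bd (p + 1) X (sdHom (p + 1) X c) = c + sd (p + 1) X c + sdHom p X (bd p X c) := by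
  suffices h : bd (p + 1) X ∘ₗ sdHom (p + 1) X = LinearMap.id + sd (p + 1) X + sdHom p X ∘ₗ bd p X
    from LinearMap.congr_fun h c
  refine free_ext fun σ => ?_
  rw [LinearMap.comp_apply, LinearMap.add_apply, LinearMap.add_apply, LinearMap.id_apply,
    LinearMap.comp_apply, sdHom_single, sd_single,
    bd_push, tbd_sdHomT, map_add, map_add, push_vtx, ← sdHom_push, ← bd_push, push_vtx]

end

/-! ### Diameters of subdivided simplices -/

lemma dist_comb_le {m n : ℕ} (w : Fin n → stdSimplex ℝ (Fin m)) (t : stdSimplex ℝ (Fin n))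
    (y : stdSimplex ℝ (Fin m)) {e : ℝ} (h : ∀ i, dist (w i) y ≤ e) : dist (comb w t) y ≤ e := by
  have he : 0 ≤ e := by
    rcases Nat.eq_zero_or_pos n with rfl | hn
    · exact absurd (stdSimplex.sum_eq_one t) (by simp)
    · exact dist_nonneg.trans (h ⟨0, hn⟩)
  rw [Subtype.dist_eq, dist_pi_le_iff he]
  intro j
  have hw : ∀ i, |w i j - y j| ≤ e := fun i =>
    ((dist_pi_le_iff he).1 ((Subtype.dist_eq _ _).symm.le.trans (h i)) j)
  change |comb w t j - y j| ≤ e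
  have : comb w t j - y j = ∑ i, t i * (w i j - y j) := by
    simp only [mul_sub, Finset.sum_sub_distrib, ← Finset.sum_mul, stdSimplex.sum_eq_one, one_mul]
    rfl
  rw [this]
  calc |∑ i, t i * (w i j - y j)| ≤ ∑ i, |t i * (w i j - y j)| := Finset.abs_sum_le_sum_abs _ _
    _ ≤ ∑ i, t i * e := Finset.sum_le_sum fun i _ => by
        rw [abs_mul, abs_of_nonneg (stdSimplex.zero_le t i)]
        exact mul_le_mul_of_nonneg_left (hw i) (stdSimplex.zero_le t i)
    _ = e := by rw [← Finset.sum_mul, stdSimplex.sum_eq_one, one_mul]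

/-- The barycenter of `n + 1` points with mutual distances at most `d` has distance at most
`n / (n + 1) * d` from each of them. -/
lemma dist_bary_le {m n : ℕ} (w : Fin (n + 1) → stdSimplex ℝ (Fin m)) {d : ℝ}
    (h : ∀ i j, dist (w i) (w j) ≤ d) (k : Fin (n + 1)) :
    dist (w k) (bary w) ≤ n / (n + 1) * d := by
  have hd : 0 ≤ d := dist_nonneg.trans (h k k)
  have he : 0 ≤ n / (n + 1) * d := by positivity
  rw [Subtype.dist_eq, dist_pi_le_iff he]
  intro j
  have hw : ∀ i, |w k j - w i j| ≤ d := fun i =>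
    ((dist_pi_le_iff hd).1 ((Subtype.dist_eq _ _).symm.le.trans (h k i)) j)
  change |w k j - bary w j| ≤ _
  have hb : bary w j = ∑ i, ((n : ℝ) + 1)⁻¹ * w i j := by
    rw [bary, comb_stdSimplex_apply]
    refine Finset.sum_congr rfl fun i _ => ?_
    congr 1
    change ((Fintype.card (Fin (n + 1)) : ℝ))⁻¹ = _
    simp
  have hn : ((n : ℝ) + 1) ≠ 0 := by positivity
  have : w k j - bary w j = ((n : ℝ) + 1)⁻¹ * ∑ i, (w k j - w i j) := by
    rw [hb, ← Finset.mul_sum, Finset.sum_sub_distrib]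
    simp only [Finset.sum_const, Finset.card_univ, Fintype.card_fin, nsmul_eq_mul]
    push_cast
    field_simp
  rw [this, abs_mul, abs_of_pos (by positivity : (0 : ℝ) < ((n : ℝ) + 1)⁻¹), div_eq_inv_mul,
    mul_assoc]
  refine mul_le_mul_of_nonneg_left ?_ (by positivity)
  calc |∑ i, (w k j - w i j)| ≤ ∑ i, |w k j - w i j| := Finset.abs_sum_le_sum_abs _ _
    _ = ∑ i ∈ Finset.univ.erase k, |w k j - w i j| := by
        rw [← Finset.add_sum_erase _ _ (Finset.mem_univ k), sub_self, abs_zero, zero_add]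
    _ ≤ ∑ i ∈ Finset.univ.erase k, d := Finset.sum_le_sum fun i _ => hw i
    _ = n * d := by
        rw [Finset.sum_const, Finset.card_erase_of_mem (Finset.mem_univ k)]
        simp

/-- The tuples of points of a simplex with pairwise distances at most `d`. -/
def closeTup (n m : ℕ) (d : ℝ) : Set (Fin n → stdSimplex ℝ (Fin m)) :=
  {u | ∀ i j, dist (u i) (u j) ≤ d}

/-- The tuples of points that lie in every ball containing all the points of `w`. This is the
only property of the convex hull that the estimate of diameters uses. -/
def hullTup {k : ℕ} (n : ℕ) {m : ℕ} (w : Fin k → stdSimplex ℝ (Fin m)) :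
    Set (Fin n → stdSimplex ℝ (Fin m)) :=
  {u | ∀ i y e, (∀ j, dist (w j) y ≤ e) → dist (u i) y ≤ e}

/-- Subdivision shrinks the diameter of a simplex on at most `N + 1` vertices by the factor
`N / (N + 1)`. -/
lemma sdT_close {m N : ℕ} (n : ℕ) (hn : n ≤ N + 1) (w : Fin n → stdSimplex ℝ (Fin m)) {d : ℝ}
    (hd : 0 ≤ d) (hw : w ∈ closeTup n m d) :
    sdT _ n (tup w) ∈ Finsupp.supported (ZMod 2) (ZMod 2)
      (closeTup n m (N / (N + 1) * d) ∩ hullTup n w) := by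
  induction n with
  | zero =>
    refine Finsupp.single_mem_supported _ _ ⟨fun i => i.elim0, fun i => i.elim0⟩
  | succ n ih =>
    rw [sdT_succ, tbd_tup, map_sum, map_sum]
    refine Submodule.sum_mem _ fun i _ => ?_
    have hi : w ∘ i.succAbove ∈ closeTup n m d := fun a b => hw _ _
    refine map_mem_of_supported _ ?_ (ih (by omega) (w ∘ i.succAbove) hi)
    rintro u ⟨hu1, hu2⟩
    rw [cone_tup]
    have hfac : (n : ℝ) / (n + 1) ≤ N / (N + 1) := by
      rw [div_le_div_iff₀ (by positivity) (by positivity)]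
      have : (n : ℝ) ≤ N := by exact_mod_cast (by omega : n ≤ N)
      nlinarith
    have hb : ∀ k, dist (w k) (bary w) ≤ N / (N + 1) * d := fun k =>
      (dist_bary_le w hw k).trans (mul_le_mul_of_nonneg_right hfac hd)
    have hub : ∀ k, dist (u k) (bary w) ≤ N / (N + 1) * d := fun k =>
      hu2 k _ _ fun j => hb _
    refine Finsupp.single_mem_supported _ _ ⟨fun a b => ?_, fun a y e h => ?_⟩
    · refine Fin.cases ?_ (fun a => ?_) a
      · refine Fin.cases ?_ (fun b => ?_) b
        · rw [dist_self]
          positivity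
        · simpa [dist_comm] using hub b
      · refine Fin.cases ?_ (fun b => ?_) b
        · simpa using hub a
        · simpa using hu1 a b
    · refine Fin.cases ?_ (fun a => ?_) a
      · exact dist_comb_le _ _ _ h
      · simpa using hu2 a y e fun j => h _

/-! ### Chains in subspaces and small chains -/

section Small

variable {X : Type*} [TopologicalSpace X]

/-- The singular `p`-simplices of `X` that lie in `S`. -/
def simplicesIn (p : ℕ) (S : Set X) : Set (SingSimplex p X) :=
  {σ | ∀ t, σ t ∈ S}

/-- The singular `p`-chains of `X` that lie in `S`. -/
def chainsIn (p : ℕ) (S : Set X) : Submodule (ZMod 2) (Chain p X) :=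
  Finsupp.supported (ZMod 2) (ZMod 2) (simplicesIn p S)

/-- The singular `p`-simplices of `X` that lie in some member of `𝒰`. -/
def smallSimplices (𝒰 : Set (Set X)) (p : ℕ) : Set (SingSimplex p X) :=
  {σ | ∃ U ∈ 𝒰, σ ∈ simplicesIn p U}

/-- The singular `p`-chains of `X` composed of simplices each of which lies in some member
of `𝒰`. -/
def smallChains (𝒰 : Set (Set X)) (p : ℕ) : Submodule (ZMod 2) (Chain p X) :=
  Finsupp.supported (ZMod 2) (ZMod 2) (smallSimplices 𝒰 p)

/-- `c` is a cycle relative to the subcomplex `A`. In degree `0` every chain is one. -/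
def IsRelCycle (A : ∀ p, Submodule (ZMod 2) (Chain p X)) : ∀ p, Chain p X → Prop
  | 0, _ => True
  | p + 1, c => bd p X c ∈ A p

lemma IsRelCycle.mono {A B : ∀ p, Submodule (ZMod 2) (Chain p X)} (h : ∀ p, A p ≤ B p) {p : ℕ}
    {c : Chain p X} (hc : IsRelCycle A p c) : IsRelCycle B p c := by
  cases p with
  | zero => trivial
  | succ p => exact h p hc

lemma isRelCycle_bd (A : ∀ p, Submodule (ZMod 2) (Chain p X)) {p : ℕ} (c : Chain (p + 1) X) :
    IsRelCycle A p (bd p X c) := by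
  cases p with
  | zero => trivial
  | succ p =>
    change bd p X (bd (p + 1) X c) ∈ A p
    rw [bd_bd]
    exact zero_mem _

lemma IsRelCycle.sub {A : ∀ p, Submodule (ZMod 2) (Chain p X)} {p : ℕ} {c d : Chain p X}
    (hc : IsRelCycle A p c) (hd : IsRelCycle A p d) : IsRelCycle A p (c - d) := by
  cases p with
  | zero => trivial
  | succ p =>
    change bd p X (c - d) ∈ A p
    rw [map_sub]
    exact sub_mem hc hd

lemma chainsIn_mono {S T : Set X} (h : S ⊆ T) (p : ℕ) : chainsIn p S ≤ chainsIn p T :=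
  Finsupp.supported_mono fun _ hσ t => h (hσ t)

lemma chainsIn_inter (p : ℕ) (S T : Set X) :
    chainsIn p (S ∩ T) = chainsIn p S ⊓ chainsIn p T := by
  rw [chainsIn, chainsIn, chainsIn, ← Finsupp.supported_inter]
  congr 1
  ext σ
  exact forall_and

lemma mem_chainsIn_inter {p : ℕ} {S T : Set X} {c : Chain p X} :
    c ∈ chainsIn p (S ∩ T) ↔ c ∈ chainsIn p S ∧ c ∈ chainsIn p T := by
  rw [chainsIn_inter, Submodule.mem_inf]

lemma smallChains_pair (p : ℕ) (S T : Set X) :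
    smallChains {S, T} p = chainsIn p S ⊔ chainsIn p T := by
  rw [smallChains, chainsIn, chainsIn, ← Finsupp.supported_union]
  congr 1
  ext σ
  constructor
  · rintro ⟨U, rfl | rfl, h⟩
    exacts [Or.inl h, Or.inr h]
  · rintro (h | h)
    exacts [⟨S, Or.inl rfl, h⟩, ⟨T, Or.inr rfl, h⟩]

lemma chainsIn_univ (p : ℕ) : chainsIn p (Set.univ : Set X) = ⊤ := by
  rw [eq_top_iff, ← Finsupp.supported_univ]
  exact Finsupp.supported_mono fun _ _ _ => Set.mem_univ _

lemma face_mem_simplicesIn {p : ℕ} {S : Set X} {σ : SingSimplex (p + 1) X}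
    (hσ : σ ∈ simplicesIn (p + 1) S) (i : Fin (p + 2)) : σ.face i ∈ simplicesIn p S :=
  fun _ => hσ _

lemma bd_mem_smallChains {𝒰 : Set (Set X)} {p : ℕ} {c : Chain (p + 1) X}
    (hc : c ∈ smallChains 𝒰 (p + 1)) : bd p X c ∈ smallChains 𝒰 p := by
  refine map_mem_of_supported _ ?_ hc
  rintro σ ⟨U, hU, hσ⟩
  rw [bd_single]
  exact Submodule.sum_mem _ fun i _ =>
    Finsupp.single_mem_supported _ _ ⟨U, hU, face_mem_simplicesIn hσ i⟩

lemma smallChains_singleton (S : Set X) (p : ℕ) : smallChains {S} p = chainsIn p S := by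
  rw [smallChains, chainsIn]
  congr 1
  ext σ
  exact ⟨fun ⟨U, hU, h⟩ => hU ▸ h, fun h => ⟨S, rfl, h⟩⟩

lemma bd_mem_chainsIn {S : Set X} {p : ℕ} {c : Chain (p + 1) X}
    (hc : c ∈ chainsIn (p + 1) S) : bd p X c ∈ chainsIn p S := by
  rw [← smallChains_singleton] at hc ⊢
  exact bd_mem_smallChains hc

lemma simplicesIn_subset_smallSimplices {𝒰 : Set (Set X)} {U : Set X} (hU : U ∈ 𝒰) (p : ℕ) :
    simplicesIn p U ⊆ smallSimplices 𝒰 p :=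
  fun _ h => ⟨U, hU, h⟩

lemma push_mem {V : Type} [TopologicalSpace V] [ConvexSpc V] {q : ℕ} {g : C(V, X)} {S : Set X}
    (hg : ∀ x, g x ∈ S) (c : Tup (q + 1) V) : push g c ∈ chainsIn q S := by
  refine map_mem_of_supported (P := Set.univ) _ (fun w _ => ?_) (by simp)
  rw [push_tup]
  exact Finsupp.single_mem_supported _ _ fun t => hg _

lemma sd_mem_smallChains {𝒰 : Set (Set X)} {p : ℕ} {c : Chain p X}
    (hc : c ∈ smallChains 𝒰 p) : sd p X c ∈ smallChains 𝒰 p := by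
  refine map_mem_of_supported _ ?_ hc
  rintro σ ⟨U, hU, hσ⟩
  rw [sd_single]
  exact Finsupp.supported_mono (simplicesIn_subset_smallSimplices hU _) (push_mem hσ _)

lemma sdHom_mem_smallChains {𝒰 : Set (Set X)} {p : ℕ} {c : Chain p X}
    (hc : c ∈ smallChains 𝒰 p) : sdHom p X c ∈ smallChains 𝒰 (p + 1) := by
  refine map_mem_of_supported _ ?_ hc
  rintro σ ⟨U, hU, hσ⟩
  rw [sdHom_single]
  exact Finsupp.supported_mono (simplicesIn_subset_smallSimplices hU _) (push_mem hσ _)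

lemma sdT_iterate_close (p k : ℕ) :
    (sdT (stdSimplex ℝ (Fin (p + 1))) (p + 1))^[k] (tup (vtx p)) ∈
      Finsupp.supported (ZMod 2) (ZMod 2)
        (closeTup (p + 1) (p + 1) (((p : ℝ) / (p + 1)) ^ k)) := by
  induction k with
  | zero =>
    refine Finsupp.single_mem_supported _ _ fun i j => ?_
    rw [pow_zero, Subtype.dist_eq]
    exact (Metric.dist_le_diam_of_mem (bounded_stdSimplex _) (Subtype.mem _) (Subtype.mem _)).trans
      diam_stdSimplex_le
  | succ k ih =>
    rw [Function.iterate_succ_apply']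
    refine map_mem_of_supported _ (fun w hw => ?_) ih
    refine Finsupp.supported_mono ?_ (sdT_close (N := p) (p + 1) le_rfl w (by positivity) hw)
    rw [pow_succ']
    exact Set.inter_subset_left

/-- Every singular simplex becomes small after sufficiently many subdivisions. -/
lemma exists_sd_iterate_single_small {𝒰 : Set (Set X)} (hU : ∀ U ∈ 𝒰, IsOpen U) {p : ℕ}
    {σ : SingSimplex p X} (hσ : σ ∈ simplicesIn p (⋃₀ 𝒰)) :
    ∃ k, (sd p X)^[k] (Finsupp.single σ 1) ∈ smallChains 𝒰 p := by
  obtain ⟨δ, hδ, hball⟩ := lebesgue_number_lemma_of_metric_sUnion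
    (s := (Set.univ : Set (stdSimplex ℝ (Fin (p + 1))))) (c := (fun U => σ ⁻¹' U) '' 𝒰) isCompact_univ
    (by
      rintro _ ⟨U, hU', rfl⟩
      exact (hU U hU').preimage σ.continuous)
    (by
      intro t _
      obtain ⟨U, hU', ht⟩ := hσ t
      exact ⟨_, ⟨U, hU', rfl⟩, ht⟩)
  have hr : (p : ℝ) / (p + 1) < 1 := by
    rw [div_lt_one (by positivity)]
    exact lt_add_one _
  obtain ⟨k, hk⟩ := exists_pow_lt_of_lt_one hδ hr
  refine ⟨k, ?_⟩
  have hit : ∀ k, (sd p X)^[k] (Finsupp.single σ 1) =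
      push σ ((sdT _ (p + 1))^[k] (tup (vtx p))) := by
    intro k
    induction k with
    | zero => exact (push_vtx σ).symm
    | succ k ih => rw [Function.iterate_succ_apply', Function.iterate_succ_apply', ih, sd_push]
  rw [hit]
  refine map_mem_of_supported _ (fun w hw => ?_) (sdT_iterate_close p k)
  obtain ⟨_, ⟨U, hU', rfl⟩, hsub⟩ := hball (w 0) (Set.mem_univ _)
  rw [push_tup]
  refine Finsupp.single_mem_supported _ _ ⟨U, hU', fun t => hsub ?_⟩
  exact (dist_comb_le w t (w 0) fun i => hw i 0).trans_lt hk

lemma sd_iterate_small_of_le {𝒰 : Set (Set X)} {p k l : ℕ} (hkl : k ≤ l) {c : Chain p X}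
    (hc : (sd p X)^[k] c ∈ smallChains 𝒰 p) : (sd p X)^[l] c ∈ smallChains 𝒰 p := by
  induction l, hkl using Nat.le_induction with
  | base => exact hc
  | succ l _ ih =>
    rw [Function.iterate_succ_apply']
    exact sd_mem_smallChains ih

lemma exists_sd_iterate_small {𝒰 : Set (Set X)} (hU : ∀ U ∈ 𝒰, IsOpen U) {p : ℕ}
    {c : Chain p X} (hc : c ∈ chainsIn p (⋃₀ 𝒰)) : ∃ k, (sd p X)^[k] c ∈ smallChains 𝒰 p := by
  rw [chainsIn, Finsupp.supported_eq_span_single] at hc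
  simp only [← Module.End.pow_apply] at *
  induction hc using Submodule.span_induction with
  | mem x hx =>
    obtain ⟨σ, hσ, rfl⟩ := hx
    obtain ⟨k, hk⟩ := exists_sd_iterate_single_small hU hσ
    exact ⟨k, by rwa [Module.End.pow_apply]⟩
  | zero => exact ⟨0, by simp⟩
  | add x y _ _ hx hy =>
    obtain ⟨k, hk⟩ := hx
    obtain ⟨l, hl⟩ := hy
    refine ⟨max k l, ?_⟩
    rw [map_add]
    rw [Module.End.pow_apply] at hk hl
    exact add_mem (by
      rw [Module.End.pow_apply]
      exact sd_iterate_small_of_le (le_max_left _ _) hk) (by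
      rw [Module.End.pow_apply]
      exact sd_iterate_small_of_le (le_max_right _ _) hl)
  | smul a x _ hx =>
    obtain ⟨k, hk⟩ := hx
    exact ⟨k, by rw [map_smul]; exact Submodule.smul_mem _ _ hk⟩

/-- The theorem on small chains: a chain in a union of open sets, the boundary of which is small, is
homologous to a small chain. -/
theorem exists_small_of_isRelCycle {𝒰 : Set (Set X)} (hU : ∀ U ∈ 𝒰, IsOpen U) {p : ℕ}
    {c : Chain p X} (hc : c ∈ chainsIn p (⋃₀ 𝒰)) (hcyc : IsRelCycle (smallChains 𝒰) p c) :
    ∃ d ∈ chainsIn (p + 1) (⋃₀ 𝒰), c - bd p X d ∈ smallChains 𝒰 p := by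
  obtain ⟨k, hk⟩ := exists_sd_iterate_small hU hc
  induction k generalizing c with
  | zero => exact ⟨0, zero_mem _, by simpa using hk⟩
  | succ k ih =>
    have hsd : sd p X c ∈ chainsIn p (⋃₀ 𝒰) := by
      rw [← smallChains_singleton] at hc ⊢
      exact sd_mem_smallChains hc
    have hhom : sdHom p X c ∈ chainsIn (p + 1) (⋃₀ 𝒰) := by
      rw [← smallChains_singleton] at hc ⊢
      exact sdHom_mem_smallChains hc
    have hsdcyc : IsRelCycle (smallChains 𝒰) p (sd p X c) := by
      cases p with
      | zero => trivial
      | succ p =>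
        change bd p X (sd (p + 1) X c) ∈ _
        rw [bd_sd]
        exact sd_mem_smallChains hcyc
    obtain ⟨d, hd, hd'⟩ := ih hsd hsdcyc (by rwa [Function.iterate_succ_apply] at hk)
    have hdiff : c - bd p X (sdHom p X c) + sd p X c ∈ smallChains 𝒰 p := by
      cases p with
      | zero =>
        rw [bd_sdHom_zero, ← sub_sub, sub_self, zero_sub, neg_add_cancel]
        exact zero_mem _
      | succ p =>
        rw [bd_sdHom]
        have := neg_mem (sdHom_mem_smallChains hcyc)
        convert this using 1
        abel
    refine ⟨sdHom p X c + d, add_mem hhom hd, ?_⟩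
    rw [← ZModModule.sub_eq_add] at hdiff
    rw [map_add]
    convert add_mem hdiff hd' using 1
    abel

end Small

/-! ### Homotopies -/

/-- The standard 1-simplex, as the parameter space of homotopies. -/
abbrev Seg : Type := stdSimplex ℝ (Fin 2)

/-- The initial point of the standard 1-simplex. -/
abbrev seg0 : Seg := stdSimplex.vertex 0

/-- The final point of the standard 1-simplex. -/
abbrev seg1 : Seg := stdSimplex.vertex 1

/-- The prism operator on tuple chains. -/
def prismT (V : Type) [TopologicalSpace V] [ConvexSpc V] (n : ℕ) :
    Tup n V →ₗ[ZMod 2] Tup (n + 1) (V × Seg) :=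
  coneHomotopy (fun _ => tmap fun x => (x, seg0)) (fun _ => tmap fun x => (x, seg1))
    (fun _ w => (bary w, seg0)) n

lemma tbd_prismT {V : Type} [TopologicalSpace V] [ConvexSpc V] (n : ℕ) (c : Tup (n + 1) V) :
    tbd (n + 1) _ (prismT V (n + 1) c) =
      tmap (fun x => (x, seg0)) c + tmap (fun x => (x, seg1)) c + prismT V n (tbd n V c) :=
  tbd_coneHomotopy (fun _ => tmap fun x => (x, seg0)) (fun _ => tmap fun x => (x, seg1))
    (fun _ w => (bary w, seg0))
    (free_ext fun w => by
      rw [tmap_tup, tmap_tup]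
      exact congrArg tup (Subsingleton.elim _ _))
    (fun n c => tbd_tmap _ c) (fun n c => tbd_tmap _ c) n c

lemma tmap_tmap {n : ℕ} {V U W : Type*} (f : V → U) (g : U → W) (c : Tup n V) :
    tmap g (tmap f c) = tmap (g ∘ f) c := by
  suffices h : tmap g ∘ₗ tmap f = tmap (g ∘ f) from LinearMap.congr_fun h c
  refine free_ext fun w => ?_
  rw [LinearMap.comp_apply, tmap_tup, tmap_tup, tmap_tup]
  rfl

lemma tmap_prismT {V U : Type} [TopologicalSpace V] [ConvexSpc V] [TopologicalSpace U]
    [ConvexSpc U] {f : V → U} (hf : IsConvexMap f) (n : ℕ) (c : Tup n V) :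
    tmap (Prod.map f id) (prismT V n c) = prismT U n (tmap f c) :=
  tmap_coneHomotopy (b := fun _ w => (bary w, seg0)) (b' := fun _ w => (bary w, seg0))
    f (Prod.map f id)
    (fun _ c => by rw [tmap_tmap, tmap_tmap]; rfl) (fun _ c => by rw [tmap_tmap, tmap_tmap]; rfl)
    (fun n w => Prod.ext (hf (n + 1) w stdSimplex.barycenter) rfl) n c

section Prism

variable {X Y : Type*} [TopologicalSpace X] [TopologicalSpace Y]

/-- The map `(v, t) ↦ F (g v, t)` obtained from a homotopy `F` and a map `g`. -/
def homComp {V : Type*} [TopologicalSpace V] (F : C(X × Seg, Y)) (g : C(V, X)) : C(V × Seg, Y) :=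
  F.comp (g.prodMap (ContinuousMap.id Seg))

/-- The map at a given time of a homotopy. -/
def homAt (F : C(X × Seg, Y)) (t : Seg) : C(X, Y) :=
  F.comp ((ContinuousMap.id X).prodMk (ContinuousMap.const X t))

/-- The prism operator of a homotopy. -/
def prism (p : ℕ) (F : C(X × Seg, Y)) : Chain p X →ₗ[ZMod 2] Chain (p + 1) Y :=
  Finsupp.linearCombination (ZMod 2) fun σ =>
    push (homComp F σ) (prismT _ (p + 1) (tup (vtx p)))

lemma prism_single {p : ℕ} (F : C(X × Seg, Y)) (σ : SingSimplex p X) :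
    prism p F (Finsupp.single σ 1) = push (homComp F σ) (prismT _ (p + 1) (tup (vtx p))) := by
  simp [prism]

lemma prism_push {V : Type} [TopologicalSpace V] [AssocConvexSpc V] {p : ℕ} (F : C(X × Seg, Y))
    (g : C(V, X)) (c : Tup (p + 1) V) :
    prism p F (push g c) = push (homComp F g) (prismT V (p + 1) c) := by
  suffices h : prism p F ∘ₗ push g = push (homComp F g) ∘ₗ prismT V (p + 1) from
    LinearMap.congr_fun h c
  refine free_ext fun w => ?_
  have hconv : IsConvexMap ((comb w).prodMap (ContinuousMap.id Seg)) := fun n u t =>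
    Prod.ext (isConvexMap_comb w n _ t) rfl
  have h1 := tmap_prismT (isConvexMap_comb w) (p + 1) (tup (vtx p))
  rw [tmap_tup, comb_comp_vtx] at h1
  rw [LinearMap.comp_apply, LinearMap.comp_apply, push_tup, prism_single, ← h1]
  exact (push_tmap (homComp F g) _ hconv _).symm

lemma push_homComp_vtx {p : ℕ} (F : C(X × Seg, Y)) (σ : SingSimplex p X) (s : Seg) :
    push (homComp F σ) (tmap (fun x => (x, s)) (tup (vtx p))) =
      Finsupp.single ((homAt F s).comp σ) 1 := by
  rw [tmap_tup, push_tup]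
  congr 1
  ext t
  change F (σ (comb (vtx p) t), comb (fun _ => s) t) = F (σ t, s)
  rw [comb_vtx, comb_const]

lemma bd_prism_zero (F : C(X × Seg, Y)) (c : Chain 0 X) :
    bd 0 Y (prism 0 F c) = chainMap 0 (homAt F seg0) c + chainMap 0 (homAt F seg1) c := by
  suffices h : bd 0 Y ∘ₗ prism 0 F = chainMap 0 (homAt F seg0) + chainMap 0 (homAt F seg1) from
    LinearMap.congr_fun h c
  refine free_ext fun σ => ?_
  rw [LinearMap.comp_apply, LinearMap.add_apply, prism_single, bd_push, tbd_prismT, map_add,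
    map_add, push_homComp_vtx, push_homComp_vtx, prismT, coneHomotopy, LinearMap.zero_apply,
    map_zero, add_zero, chainMap_single, chainMap_single]

lemma bd_prism {p : ℕ} (F : C(X × Seg, Y)) (c : Chain (p + 1) X) :
    bd (p + 1) Y (prism (p + 1) F c) =
      chainMap (p + 1) (homAt F seg0) c + chainMap (p + 1) (homAt F seg1) c +
        prism p F (bd p X c) := by
  suffices h : bd (p + 1) Y ∘ₗ prism (p + 1) F = chainMap (p + 1) (homAt F seg0) +
      chainMap (p + 1) (homAt F seg1) + prism p F ∘ₗ bd p X from LinearMap.congr_fun h c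
  refine free_ext fun σ => ?_
  rw [LinearMap.comp_apply, LinearMap.add_apply, LinearMap.add_apply, LinearMap.comp_apply,
    prism_single, bd_push, tbd_prismT, map_add,
    map_add, push_homComp_vtx, push_homComp_vtx, chainMap_single, chainMap_single]
  congr 1
  rw [← push_vtx σ, bd_push, prism_push]

lemma prism_mem {p : ℕ} {F : C(X × Seg, Y)} {S : Set X} {T : Set Y}
    (h : ∀ x ∈ S, ∀ t, F (x, t) ∈ T) {c : Chain p X} (hc : c ∈ chainsIn p S) :
    prism p F c ∈ chainsIn (p + 1) T := by
  refine map_mem_of_supported _ (fun σ hσ => ?_) hc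
  rw [prism_single]
  exact push_mem (fun x => h _ (hσ _) _) _

lemma chainMap_mem {p : ℕ} {f : C(X, Y)} {S : Set X} {T : Set Y} (h : ∀ x ∈ S, f x ∈ T)
    {c : Chain p X} (hc : c ∈ chainsIn p S) : chainMap p f c ∈ chainsIn p T := by
  refine map_mem_of_supported _ (fun σ hσ => ?_) hc
  rw [chainMap_single]
  exact Finsupp.single_mem_supported _ _ fun t => h _ (hσ t)

lemma chainMap_id {p : ℕ} {f : C(X, X)} (hf : ∀ x, f x = x) (c : Chain p X) :
    chainMap p f c = c := by
  suffices h : chainMap p f = LinearMap.id from LinearMap.congr_fun h c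
  refine free_ext fun σ => ?_
  rw [chainMap_single, LinearMap.id_apply]
  congr 1
  ext t
  exact hf _

end Prism

/-! ### Relative homology -/

section Relative

variable {X : Type*} [TopologicalSpace X]

/-- `c` is a relative cycle of the pair `(X, S)`. -/
def RelCyc (S : Set X) (p : ℕ) (c : Chain p X) : Prop := IsRelCycle (fun q => chainsIn q S) p c

/-- `c` is a relative boundary of the pair `(X, S)`. -/
def RelBd (S : Set X) (p : ℕ) (c : Chain p X) : Prop := ∃ d, c - bd p X d ∈ chainsIn p S

/-- The relative homology of `(X, S)` vanishes in degree `p`. -/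
def Acyc (S : Set X) (p : ℕ) : Prop := ∀ c, RelCyc S p c → RelBd S p c

lemma RelCyc.mono {S T : Set X} (h : S ⊆ T) {p : ℕ} {c : Chain p X} (hc : RelCyc S p c) :
    RelCyc T p c :=
  IsRelCycle.mono (chainsIn_mono h) hc

lemma RelBd.mono {S T : Set X} (h : S ⊆ T) {p : ℕ} {c : Chain p X} (hc : RelBd S p c) :
    RelBd T p c :=
  let ⟨d, hd⟩ := hc
  ⟨d, chainsIn_mono h p hd⟩

lemma RelBd.add {S : Set X} {p : ℕ} {c c' : Chain p X} (hc : RelBd S p c) (hc' : RelBd S p c') :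
    RelBd S p (c + c') := by
  obtain ⟨d, hd⟩ := hc
  obtain ⟨d', hd'⟩ := hc'
  refine ⟨d + d', ?_⟩
  rw [map_add]
  convert add_mem hd hd' using 1
  abel

lemma RelBd.neg {S : Set X} {p : ℕ} {c : Chain p X} (hc : RelBd S p c) : RelBd S p (-c) := by
  rwa [ZModModule.neg_eq_self]

lemma RelBd.sub {S : Set X} {p : ℕ} {c c' : Chain p X} (hc : RelBd S p c) (hc' : RelBd S p c') :
    RelBd S p (c - c') := by
  rw [sub_eq_add_neg]
  exact hc.add hc'.neg

lemma relBd_of_mem {S : Set X} {p : ℕ} {c : Chain p X} (hc : c ∈ chainsIn p S) : RelBd S p c :=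
  ⟨0, by rwa [map_zero, sub_zero]⟩

lemma relBd_bd (S : Set X) {p : ℕ} (d : Chain (p + 1) X) : RelBd S p (bd p X d) :=
  ⟨d, by rw [sub_self]; exact zero_mem _⟩

lemma pair_open {S T : Set X} (hS : IsOpen S) (hT : IsOpen T) :
    ∀ U ∈ ({S, T} : Set (Set X)), IsOpen U := by
  rintro U (rfl | rfl)
  exacts [hS, hT]

/-- Excision for two open sets: a chain in `S ∪ T` the boundary of which is the sum of a chain in
`S` and a chain in `T` is homologous in `S ∪ T` to such a sum. -/
lemma exists_split {S T : Set X} (hS : IsOpen S) (hT : IsOpen T) {p : ℕ} {c : Chain p X}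
    (hc : c ∈ chainsIn p (S ∪ T)) (hcyc : IsRelCycle (fun q => chainsIn q S ⊔ chainsIn q T) p c) :
    ∃ d ∈ chainsIn (p + 1) (S ∪ T), ∃ a ∈ chainsIn p S, ∃ b ∈ chainsIn p T,
      c = bd p X d + a + b := by
  obtain ⟨d, hd, h⟩ := exists_small_of_isRelCycle (pair_open hS hT) (c := c)
    (by rwa [Set.sUnion_pair]) (hcyc.mono fun q => (smallChains_pair q S T).ge)
  rw [smallChains_pair] at h
  obtain ⟨a, ha, b, hb, hab⟩ := Submodule.mem_sup.1 h
  refine ⟨d, by rwa [Set.sUnion_pair] at hd, a, ha, b, hb, ?_⟩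
  rw [add_assoc, hab]
  abel

/-- The injectivity part of the relative Mayer–Vietoris sequence. -/
lemma RelBd.inter {S T : Set X} (hS : IsOpen S) (hT : IsOpen T) {p : ℕ} {c : Chain p X}
    (hac : Acyc (S ∪ T) (p + 1)) (hcS : RelBd S p c) (hcT : RelBd T p c) :
    RelBd (S ∩ T) p c := by
  obtain ⟨d, hd⟩ := hcS
  obtain ⟨e, he⟩ := hcT
  have hbd : bd p X (d - e) = (c - bd p X e) - (c - bd p X d) := by
    rw [map_sub]
    abel
  obtain ⟨f, hf⟩ := hac (d - e) (by
    change bd p X (d - e) ∈ _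
    rw [hbd]
    exact sub_mem (chainsIn_mono Set.subset_union_right _ he)
      (chainsIn_mono Set.subset_union_left _ hd))
  have hbd2 : bd p X (d - e - bd (p + 1) X f) = (c - bd p X e) - (c - bd p X d) := by
    rw [map_sub, bd_bd, sub_zero, hbd]
  obtain ⟨h, hh, a, ha, b, hb, hab⟩ := exists_split hS hT hf (by
    change bd p X _ ∈ _
    rw [hbd2]
    exact sub_mem (Submodule.mem_sup_right he) (Submodule.mem_sup_left hd))
  rw [hab, map_add, map_add, bd_bd, zero_add] at hbd2
  refine ⟨d - a, ?_⟩
  rw [mem_chainsIn_inter, map_sub]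
  constructor
  · convert add_mem hd (bd_mem_chainsIn ha) using 1
    abel
  · convert sub_mem he (bd_mem_chainsIn hb) using 1
    rw [← sub_eq_zero] at hbd2 ⊢
    rw [← hbd2]
    abel

lemma Acyc.inter {S T : Set X} (hS : IsOpen S) (hT : IsOpen T) {p : ℕ}
    (hac : Acyc (S ∪ T) (p + 1)) (h1 : Acyc S p) (h2 : Acyc T p) : Acyc (S ∩ T) p :=
  fun c hc => RelBd.inter hS hT hac (h1 c (hc.mono Set.inter_subset_left))
    (h2 c (hc.mono Set.inter_subset_right))

/-- The graph of the connecting map `H_{p+1}(X, S ∪ T) → H_p(X, S ∩ T)` of the relative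
Mayer–Vietoris sequence, as a relation between representing chains. -/
def MVRel (S T : Set X) (p : ℕ) (w : Chain (p + 1) X) (s : Chain p X) : Prop :=
  ∃ a b, RelBd (S ∪ T) (p + 1) (w - (a - b)) ∧ s - bd p X a ∈ chainsIn p S ∧
    s - bd p X b ∈ chainsIn p T

lemma MVRel.mono {S T S' T' : Set X} (hS : S ⊆ S') (hT : T ⊆ T') {p : ℕ} {w : Chain (p + 1) X}
    {s : Chain p X} (h : MVRel S T p w s) : MVRel S' T' p w s :=
  let ⟨a, b, h1, h2, h3⟩ := h
  ⟨a, b, h1.mono (Set.union_subset_union hS hT), chainsIn_mono hS p h2, chainsIn_mono hT p h3⟩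

lemma MVRel.add {S T : Set X} {p : ℕ} {w w' : Chain (p + 1) X}
    {s s' : Chain p X} (h : MVRel S T p w s) (h' : MVRel S T p w' s') :
    MVRel S T p (w + w') (s + s') := by
  obtain ⟨a, b, h1, h2, h3⟩ := h
  obtain ⟨a', b', h1', h2', h3'⟩ := h'
  refine ⟨a + a', b + b', ?_, ?_, ?_⟩
  · convert h1.add h1' using 1
    abel
  · rw [map_add]
    convert add_mem h2 h2' using 1
    abel
  · rw [map_add]
    convert add_mem h3 h3' using 1
    abel

/-- The connecting map of the relative Mayer–Vietoris sequence is defined everywhere, by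
excision. -/
lemma exists_mvRel_right {S T : Set X} (hS : IsOpen S) (hT : IsOpen T) {p : ℕ}
    {w : Chain (p + 1) X} (hw : RelCyc (S ∪ T) (p + 1) w) :
    ∃ s, RelCyc (S ∩ T) p s ∧ MVRel S T p w s := by
  obtain ⟨e, he, a, ha, b, hb, hab⟩ := exists_split hS hT hw (isRelCycle_bd _ w)
  refine ⟨b, ?_, w - e, 0, ?_, ?_, ?_⟩
  · cases p with
    | zero => trivial
    | succ p =>
      change bd p X b ∈ _
      refine mem_chainsIn_inter.2 ⟨?_, bd_mem_chainsIn hb⟩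
      have h0 := congrArg (bd p X) hab
      rw [bd_bd, map_add, map_add, bd_bd, zero_add] at h0
      rw [eq_neg_of_add_eq_zero_right h0.symm]
      exact neg_mem (bd_mem_chainsIn ha)
  · rw [sub_zero, sub_sub_cancel]
    exact relBd_of_mem he
  · rw [map_sub, hab]
    convert neg_mem ha using 1
    abel
  · rwa [map_zero, sub_zero]

/-- The connecting map is surjective if the relative homology of `S` and `T` vanishes. -/
lemma exists_mvRel_left {S T : Set X} {p : ℕ} (h1 : Acyc S p) (h2 : Acyc T p)
    {s : Chain p X} (hs : RelCyc (S ∩ T) p s) :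
    ∃ w, RelCyc (S ∪ T) (p + 1) w ∧ MVRel S T p w s := by
  obtain ⟨a, ha⟩ := h1 s (hs.mono Set.inter_subset_left)
  obtain ⟨b, hb⟩ := h2 s (hs.mono Set.inter_subset_right)
  refine ⟨a - b, ?_, a, b, ?_, ha, hb⟩
  · change bd p X (a - b) ∈ _
    convert sub_mem (chainsIn_mono (Set.subset_union_right (s := S)) p hb)
      (chainsIn_mono (Set.subset_union_left (t := T)) p ha) using 1
    rw [map_sub]
    abel
  · rw [sub_self]
    exact relBd_of_mem (zero_mem _)

/-- The connecting map is well defined on homology classes. -/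
lemma MVRel.relBd_right {S T : Set X} (hS : IsOpen S) (hT : IsOpen T) {p : ℕ}
    {w : Chain (p + 1) X} {s : Chain p X} (h : MVRel S T p w s) (hw : RelBd (S ∪ T) (p + 1) w) :
    RelBd (S ∩ T) p s := by
  obtain ⟨a, b, h1, h2, h3⟩ := h
  obtain ⟨f, hf⟩ := hw.sub h1
  rw [sub_sub_cancel] at hf
  have hbd : bd p X (a - b - bd (p + 1) X f) = (s - bd p X b) - (s - bd p X a) := by
    rw [map_sub, bd_bd, sub_zero, map_sub]
    abel
  obtain ⟨h, hh, a', ha', b', hb', hab⟩ := exists_split hS hT hf (by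
    change bd p X _ ∈ _
    rw [hbd]
    exact sub_mem (Submodule.mem_sup_right h3) (Submodule.mem_sup_left h2))
  rw [hab, map_add, map_add, bd_bd, zero_add] at hbd
  refine ⟨a - a', ?_⟩
  rw [mem_chainsIn_inter, map_sub]
  constructor
  · convert add_mem h2 (bd_mem_chainsIn ha') using 1
    abel
  · convert sub_mem h3 (bd_mem_chainsIn hb') using 1
    rw [← sub_eq_zero] at hbd ⊢
    rw [← hbd]
    abel

/-- The connecting map is injective if the relative homology of `S` and `T` vanishes. -/
lemma MVRel.relBd_left {S T : Set X} {p : ℕ} (hS : Acyc S (p + 1)) (hT : Acyc T (p + 1))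
    {w : Chain (p + 1) X} {s : Chain p X} (h : MVRel S T p w s) (hs : RelBd (S ∩ T) p s) :
    RelBd (S ∪ T) (p + 1) w := by
  obtain ⟨a, b, h1, h2, h3⟩ := h
  obtain ⟨d, hd⟩ := hs
  rw [mem_chainsIn_inter] at hd
  have ha := hS (a - d) (by
    change bd p X (a - d) ∈ _
    convert sub_mem hd.1 h2 using 1
    rw [map_sub]
    abel)
  have hb := hT (b - d) (by
    change bd p X (b - d) ∈ _
    convert sub_mem hd.2 h3 using 1
    rw [map_sub]
    abel)
  convert h1.add ((ha.mono Set.subset_union_left).sub (hb.mono Set.subset_union_right)) using 1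
  abel

lemma Acyc.union {S T : Set X} (hS : IsOpen S) (hT : IsOpen T) {p : ℕ} (h1 : Acyc S (p + 1))
    (h2 : Acyc T (p + 1)) (h : Acyc (S ∩ T) p) : Acyc (S ∪ T) (p + 1) := by
  intro w hw
  obtain ⟨s, hs, hws⟩ := exists_mvRel_right hS hT hw
  exact hws.relBd_left h1 h2 (h s hs)

/-- The relative homology of `(X, S)` in degree `p` has exactly two elements. -/
def TwoEl (S : Set X) (p : ℕ) : Prop :=
  (∃ w, RelCyc S p w ∧ ¬ RelBd S p w) ∧
    ∀ w w', RelCyc S p w → RelCyc S p w' → ¬ RelBd S p w → ¬ RelBd S p w' → RelBd S p (w + w')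

lemma TwoEl.union {S T : Set X} (hS : IsOpen S) (hT : IsOpen T) {p : ℕ} (h1 : ∀ q, Acyc S q)
    (h2 : ∀ q, Acyc T q) (h : TwoEl (S ∩ T) p) : TwoEl (S ∪ T) (p + 1) := by
  refine ⟨?_, fun w w' hw hw' hn hn' => ?_⟩
  · obtain ⟨s, hs, hn⟩ := h.1
    obtain ⟨w, hw, hws⟩ := exists_mvRel_left (h1 p) (h2 p) hs
    exact ⟨w, hw, fun hb => hn (hws.relBd_right hS hT hb)⟩
  · obtain ⟨s, hs, hws⟩ := exists_mvRel_right hS hT hw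
    obtain ⟨s', hs', hws'⟩ := exists_mvRel_right hS hT hw'
    exact (hws.add hws').relBd_left (h1 _) (h2 _) (h.2 s s' hs hs'
      (fun hb => hn (hws.relBd_left (h1 _) (h2 _) hb))
      (fun hb => hn' (hws'.relBd_left (h1 _) (h2 _) hb)))

/-- The map `H_p(X, S) → H_p(X, S')` is injective, for `S ⊆ S'`. -/
def InjRel (S S' : Set X) (p : ℕ) : Prop := ∀ w, RelCyc S p w → RelBd S' p w → RelBd S p w

lemma InjRel.union {S T S' T' : Set X} (hS : IsOpen S) (hT : IsOpen T) (hS' : IsOpen S')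
    (hT' : IsOpen T') (hSS : S ⊆ S') (hTT : T ⊆ T') {p : ℕ} (h1 : Acyc S (p + 1))
    (h2 : Acyc T (p + 1)) (h : InjRel (S ∩ T) (S' ∩ T') p) : InjRel (S ∪ T) (S' ∪ T') (p + 1) := by
  intro w hw hb
  obtain ⟨s, hs, hws⟩ := exists_mvRel_right hS hT hw
  exact hws.relBd_left h1 h2 (h s hs ((hws.mono hSS hTT).relBd_right hS' hT' hb))

/-- The union of the images of the simplices of a chain. -/
def carrier {p : ℕ} (c : Chain p X) : Set X := ⋃ σ ∈ c.support, Set.range σ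

lemma isCompact_carrier {p : ℕ} (c : Chain p X) : IsCompact (carrier c) :=
  c.support.isCompact_biUnion fun σ _ => isCompact_range σ.continuous

lemma mem_chainsIn_iff {p : ℕ} {c : Chain p X} {S : Set X} :
    c ∈ chainsIn p S ↔ carrier c ⊆ S := by
  rw [carrier, Set.iUnion₂_subset_iff]
  exact ⟨fun h σ hσ => Set.range_subset_iff.2 (h hσ), fun h σ hσ => Set.range_subset_iff.1 (h σ hσ)⟩

/-- If every compact set can be moved into `S` by a deformation of `X` that preserves `S`, then the
relative homology of `(X, S)` vanishes. -/
lemma acyc_of_deformation {S : Set X}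
    (h : ∀ K : Set X, IsCompact K → ∃ F : C(X × Seg, X), (∀ x, F (x, seg0) = x) ∧
      (∀ x ∈ S, ∀ t, F (x, t) ∈ S) ∧ ∀ x ∈ K, F (x, seg1) ∈ S) (p : ℕ) : Acyc S p := by
  intro c hc
  obtain ⟨F, h0, hS, h1⟩ := h _ (isCompact_carrier c)
  have hF1 : chainMap p (homAt F seg1) c ∈ chainsIn p S :=
    chainMap_mem h1 (mem_chainsIn_iff.2 subset_rfl)
  refine ⟨prism p F c, ?_⟩
  cases p with
  | zero =>
    rw [bd_prism_zero, chainMap_id h0, ← sub_sub, sub_self, zero_sub]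
    exact neg_mem hF1
  | succ p =>
    rw [bd_prism, chainMap_id h0]
    convert neg_mem (add_mem hF1 (prism_mem hS hc)) using 1
    abel

end Relative

/-! ### Contractible spaces -/

section Contractible

variable {X : Type*} [TopologicalSpace X]

lemma mem_chainsIn_empty {p : ℕ} {c : Chain p X} : c ∈ chainsIn p (∅ : Set X) ↔ c = 0 := by
  refine ⟨fun h => ?_, fun h => h ▸ zero_mem _⟩
  rw [← Finsupp.support_eq_empty, Finset.eq_empty_iff_forall_notMem]
  exact fun σ hσ => h hσ (Classical.arbitrary _)

/-- The map from singular chains to the tuple chains of a point. -/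
def toPoint (p : ℕ) (X : Type*) [TopologicalSpace X] :
    Chain p X →ₗ[ZMod 2] Tup (p + 1) (stdSimplex ℝ (Fin 1)) :=
  Finsupp.linearCombination (ZMod 2) fun _ => tup fun _ => default

lemma toPoint_single {p : ℕ} (σ : SingSimplex p X) :
    toPoint p X (Finsupp.single σ 1) = tup fun _ => default := by
  simp [toPoint]

lemma tbd_toPoint {p : ℕ} (c : Chain (p + 1) X) :
    tbd (p + 1) _ (toPoint (p + 1) X c) = toPoint p X (bd p X c) := by
  suffices h : tbd (p + 1) _ ∘ₗ toPoint (p + 1) X = toPoint p X ∘ₗ bd p X from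
    LinearMap.congr_fun h c
  refine free_ext fun σ => ?_
  simp only [LinearMap.comp_apply, toPoint_single, bd_single, map_sum, tbd_tup]
  rfl

lemma chainMap_const {p : ℕ} {f : C(X, X)} {x₀ : X} (hf : ∀ x, f x = x₀) (c : Chain p X) :
    chainMap p f c = push (ContinuousMap.const (stdSimplex ℝ (Fin 1)) x₀) (toPoint p X c) := by
  suffices h : chainMap p f = push (ContinuousMap.const (stdSimplex ℝ (Fin 1)) x₀) ∘ₗ toPoint p X
    from LinearMap.congr_fun h c
  refine free_ext fun σ => ?_
  rw [chainMap_single, LinearMap.comp_apply, toPoint_single, push_tup]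
  congr 1
  ext t
  exact hf _

variable {F : C(X × Seg, X)} {x₀ : X} (h0 : ∀ x, F (x, seg0) = x) (h1 : ∀ x, F (x, seg1) = x₀)

include h0 h1 in
/-- In a contractible space every cycle of positive degree bounds: by the prism operator it is
homologous to a chain of constant simplices, and these are dealt with by a cone in a point. -/
lemma exists_bd_eq_of_contraction {p : ℕ} {c : Chain (p + 1) X} (hc : bd p X c = 0) :
    ∃ d, bd (p + 1) X d = c := by
  have h := bd_prism F c
  rw [hc, map_zero, add_zero, chainMap_id h0, chainMap_const (x₀ := x₀) (fun x => h1 x)] at h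
  have hk : toPoint (p + 1) X c = tbd (p + 2) _ (cone default (toPoint (p + 1) X c)) := by
    rw [tbd_cone, tbd_toPoint, hc, map_zero, map_zero, add_zero]
  rw [hk, ← bd_push] at h
  refine ⟨prism (p + 1) F c - push (ContinuousMap.const _ x₀) (cone default (toPoint _ X c)), ?_⟩
  rw [map_sub, h, add_sub_cancel_right]

include h0 h1 in
lemma exists_bd_eq_of_contraction_zero {c : Chain 0 X} (hc : tbd 0 _ (toPoint 0 X c) = 0) :
    ∃ d, bd 0 X d = c := by
  have h := bd_prism_zero F c
  rw [chainMap_id h0, chainMap_const (x₀ := x₀) (fun x => h1 x)] at h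
  have hk : toPoint 0 X c = tbd 1 _ (cone default (toPoint 0 X c)) := by
    rw [tbd_cone, hc, map_zero, add_zero]
  rw [hk, ← bd_push] at h
  refine ⟨prism 0 F c - push (ContinuousMap.const _ x₀) (cone default (toPoint _ X c)), ?_⟩
  rw [map_sub, h, add_sub_cancel_right]

include h0 h1 in
lemma acyc_empty (p : ℕ) : Acyc (∅ : Set X) (p + 1) := by
  intro c hc
  obtain ⟨d, hd⟩ := exists_bd_eq_of_contraction h0 h1 (mem_chainsIn_empty.1 hc)
  exact ⟨d, by rw [hd, sub_self]; exact zero_mem _⟩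

include h0 h1 in
lemma relBd_empty_zero_iff {c : Chain 0 X} :
    RelBd (∅ : Set X) 0 c ↔ tbd 0 _ (toPoint 0 X c) = 0 := by
  constructor
  · rintro ⟨d, hd⟩
    rw [sub_eq_zero.1 (mem_chainsIn_empty.1 hd), ← tbd_toPoint, tbd_tbd]
  · intro h
    obtain ⟨d, hd⟩ := exists_bd_eq_of_contraction_zero h0 h1 h
    exact ⟨d, by rw [hd, sub_self]; exact zero_mem _⟩

lemma tup_zero_add_eq_zero {V : Type*} {x y : Tup 0 V} (hx : x ≠ 0) (hy : y ≠ 0) : x + y = 0 := by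
  have key : ∀ z : Tup 0 V, z ≠ 0 → z default = 1 := by
    intro z hz
    by_contra h
    refine hz (Finsupp.ext fun w => ?_)
    rw [Subsingleton.elim w default, Finsupp.zero_apply]
    generalize z default = e at *
    revert e
    decide
  refine Finsupp.ext fun w => ?_
  rw [Subsingleton.elim w default, Finsupp.add_apply, key x hx, key y hy]
  rfl

include h0 h1 in
lemma twoEl_empty_zero : TwoEl (∅ : Set X) 0 := by
  refine ⟨⟨Finsupp.single (ContinuousMap.const _ x₀) 1, trivial, ?_⟩, fun w w' _ _ h h' => ?_⟩
  · rw [relBd_empty_zero_iff h0 h1, toPoint_single, tbd_tup, Fin.sum_univ_one]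
    exact Finsupp.single_ne_zero.2 one_ne_zero
  · rw [relBd_empty_zero_iff h0 h1] at h h' ⊢
    rw [map_add, map_add]
    exact tup_zero_add_eq_zero h h'

end Contractible

/-! ### Complements of boxes in Euclidean space -/

/-- The straight contraction of `E3` to the origin. -/
def contractE3 : C(E3 × Seg, E3) where
  toFun q := (1 - q.2 1) • q.1
  continuous_toFun := by
    have : Continuous fun q : E3 × Seg => q.2 1 :=
      (continuous_apply 1).comp (continuous_subtype_val.comp continuous_snd)
    fun_prop

lemma contractE3_zero (x : E3) : contractE3 (x, seg0) = x := by
  change (1 - (Pi.single 0 1 : Fin 2 → ℝ) 1) • x = x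
  simp

lemma contractE3_one (x : E3) : contractE3 (x, seg1) = 0 := by
  change (1 - (Pi.single 1 1 : Fin 2 → ℝ) 1) • x = 0
  simp

/-- The homotopy that translates by multiples of `u`. -/
def translateE3 (u : E3) : C(E3 × Seg, E3) where
  toFun q := q.1 + q.2 1 • u
  continuous_toFun := by
    have : Continuous fun q : E3 × Seg => q.2 1 :=
      (continuous_apply 1).comp (continuous_subtype_val.comp continuous_snd)
    fun_prop

/-- The relative homology of `(ℝ³, S)` vanishes if translation along a ray preserves `S` and
eventually moves every compact set into `S`. -/
lemma acyc_of_translate {S : Set E3} (u : E3) (hS : ∀ x ∈ S, ∀ r : ℝ, 0 ≤ r → x + r • u ∈ S)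
    (habs : ∀ K : Set E3, IsCompact K → ∃ r : ℝ, 0 ≤ r ∧ ∀ x ∈ K, x + r • u ∈ S) (p : ℕ) :
    Acyc S p := by
  refine acyc_of_deformation (fun K hK => ?_) p
  obtain ⟨r, hr, h⟩ := habs K hK
  refine ⟨translateE3 (r • u), fun x => ?_, fun x hx t => ?_, fun x hx => ?_⟩
  · change x + (Pi.single 0 1 : Fin 2 → ℝ) 1 • (r • u) = x
    simp
  · change x + t 1 • (r • u) ∈ S
    rw [smul_smul]
    exact hS x hx _ (mul_nonneg (stdSimplex.zero_le t 1) hr)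
  · change x + (Pi.single 1 1 : Fin 2 → ℝ) 1 • (r • u) ∈ S
    simpa using h x hx

/-- The set of points the first `j` coordinates of which lie between the corresponding coordinates
of `a` and `b`. -/
def slab (a b : Fin 3 → ℝ) (j : ℕ) : Set E3 :=
  {x | ∀ i : Fin 3, i.val < j → a i ≤ x i ∧ x i ≤ b i}

lemma continuous_coord (i : Fin 3) : Continuous fun x : E3 => x i := by fun_prop

lemma isClosed_slab (a b : Fin 3 → ℝ) (j : ℕ) : IsClosed (slab a b j) := by
  have : slab a b j = ⋂ i : Fin 3, ⋂ _ : i.val < j, {x : E3 | a i ≤ x i} ∩ {x | x i ≤ b i} := by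
    ext x
    simp [slab]
  rw [this]
  exact isClosed_iInter fun i => isClosed_iInter fun _ =>
    (isClosed_le continuous_const (continuous_coord i)).inter
      (isClosed_le (continuous_coord i) continuous_const)

/-- The part of a slab in a closed upper half-space. -/
def slabGe (a b : Fin 3 → ℝ) (i : Fin 3) : Set E3 := slab a b i.val ∩ {x | a i ≤ x i}

/-- The part of a slab in a closed lower half-space. -/
def slabLe (a b : Fin 3 → ℝ) (i : Fin 3) : Set E3 := slab a b i.val ∩ {x | x i ≤ b i}

lemma isOpen_slabGe_compl (a b : Fin 3 → ℝ) (i : Fin 3) : IsOpen (slabGe a b i)ᶜ :=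
  ((isClosed_slab a b _).inter (isClosed_le continuous_const (continuous_coord i))).isOpen_compl

lemma isOpen_slabLe_compl (a b : Fin 3 → ℝ) (i : Fin 3) : IsOpen (slabLe a b i)ᶜ :=
  ((isClosed_slab a b _).inter (isClosed_le (continuous_coord i) continuous_const)).isOpen_compl

lemma slab_compl_union (a b : Fin 3 → ℝ) (i : Fin 3) :
    (slabGe a b i)ᶜ ∪ (slabLe a b i)ᶜ = (slab a b (i.val + 1))ᶜ := by
  rw [← Set.compl_inter]
  congr 1
  ext x
  simp only [slabGe, slabLe, slab, Set.mem_inter_iff, Set.mem_ofPred_eq]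
  constructor
  · rintro ⟨⟨h, h1⟩, -, h2⟩ k hk
    rcases Nat.lt_succ_iff_lt_or_eq.1 hk with hk | hk
    · exact h k hk
    · obtain rfl : k = i := Fin.ext hk
      exact ⟨h1, h2⟩
  · intro h
    exact ⟨⟨fun k hk => h k (by omega), (h i (by omega)).1⟩, fun k hk => h k (by omega),
      (h i (by omega)).2⟩

lemma slab_compl_inter {a b : Fin 3 → ℝ} {i : Fin 3} (hab : a i ≤ b i) :
    (slabGe a b i)ᶜ ∩ (slabLe a b i)ᶜ = (slab a b i.val)ᶜ := by
  rw [← Set.compl_union]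
  congr 1
  ext x
  simp only [slabGe, slabLe, Set.mem_union, Set.mem_inter_iff, Set.mem_ofPred_eq]
  constructor
  · rintro (h | h)
    exacts [h.1, h.1]
  · intro h
    rcases le_total (a i) (x i) with h1 | h1
    exacts [Or.inl ⟨h, h1⟩, Or.inr ⟨h, h1.trans hab⟩]

lemma mem_slab_add_single {a b : Fin 3 → ℝ} {i : Fin 3} {x : E3} {r : ℝ} :
    x + r • EuclideanSpace.single i (1 : ℝ) ∈ slab a b i.val ↔ x ∈ slab a b i.val := by
  simp only [slab, Set.mem_ofPred_eq]
  refine forall_congr' fun k => imp_congr_right fun hk => ?_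
  have : k ≠ i := fun h => by simp [h] at hk
  simp [this]

lemma exists_abs_coord_le {K : Set E3} (hK : IsCompact K) (i : Fin 3) :
    ∃ M : ℝ, ∀ x ∈ K, |x i| ≤ M := by
  obtain ⟨M, hM⟩ := hK.exists_bound_of_continuousOn (continuous_coord i).continuousOn
  exact ⟨M, fun x hx => hM x hx⟩

lemma acyc_slabGe_compl (a b : Fin 3 → ℝ) (i : Fin 3) (p : ℕ) : Acyc (slabGe a b i)ᶜ p := by
  have hco : ∀ (x : E3) (r : ℝ),
      (x + r • -EuclideanSpace.single i (1 : ℝ)) i = x i - r := by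
    intro x r
    simp [sub_eq_add_neg]
  refine acyc_of_translate (S := (slabGe a b i)ᶜ) (-EuclideanSpace.single i 1) (fun x hx r hr h => hx ?_)
    (fun K hK => ?_) p
  · obtain ⟨h1, h2⟩ := h
    rw [Set.mem_ofPred_eq, hco] at h2
    rw [smul_neg, ← neg_smul, mem_slab_add_single] at h1
    exact ⟨h1, show a i ≤ x i by linarith⟩
  · obtain ⟨M, hM⟩ := exists_abs_coord_le hK i
    refine ⟨max 0 (M - a i + 1), le_max_left _ _, fun x hx h => ?_⟩
    have h2 := h.2
    rw [Set.mem_ofPred_eq, hco] at h2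
    linarith [le_max_right 0 (M - a i + 1), (abs_le.1 (hM x hx)).2]

lemma acyc_slabLe_compl (a b : Fin 3 → ℝ) (i : Fin 3) (p : ℕ) : Acyc (slabLe a b i)ᶜ p := by
  have hco : ∀ (x : E3) (r : ℝ),
      (x + r • EuclideanSpace.single i (1 : ℝ)) i = x i + r := by
    intro x r
    simp
  refine acyc_of_translate (S := (slabLe a b i)ᶜ) (EuclideanSpace.single i 1) (fun x hx r hr h => hx ?_)
    (fun K hK => ?_) p
  · obtain ⟨h1, h2⟩ := h
    rw [Set.mem_ofPred_eq, hco] at h2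
    rw [mem_slab_add_single] at h1
    exact ⟨h1, show x i ≤ b i by linarith⟩
  · obtain ⟨M, hM⟩ := exists_abs_coord_le hK i
    refine ⟨max 0 (M + b i + 1), le_max_left _ _, fun x hx h => ?_⟩
    have h2 := h.2
    rw [Set.mem_ofPred_eq, hco] at h2
    linarith [le_max_right 0 (M + b i + 1), (abs_le.1 (hM x hx)).1]

lemma slab_zero_compl (a b : Fin 3 → ℝ) : (slab a b 0)ᶜ = ∅ := by
  rw [Set.compl_empty_iff, Set.eq_univ_iff_forall]
  exact fun x i hi => absurd hi (Nat.not_lt_zero _)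

section

variable {a b : Fin 3 → ℝ} (hab : ∀ i, a i ≤ b i)

include hab in
/-- A slab is the intersection of two half-slabs, the union of which is the slab with one condition
less. So the relative homology of `ℝ³` modulo the complement of a box
is found by descending to the empty set in three Mayer–Vietoris steps. -/
lemma acyc_slab_compl_succ {j : ℕ} (hj : j < 3) {p : ℕ} (h : Acyc (slab a b j)ᶜ p) :
    Acyc (slab a b (j + 1))ᶜ (p + 1) := by
  have := Acyc.union (isOpen_slabGe_compl a b ⟨j, hj⟩) (isOpen_slabLe_compl a b ⟨j, hj⟩)
    (p := p) (acyc_slabGe_compl a b _ _) (acyc_slabLe_compl a b _ _)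
    (by rwa [slab_compl_inter (hab _)])
  rwa [slab_compl_union] at this

/-- The closed box with opposite vertices `a` and `b`. -/
abbrev box (a b : Fin 3 → ℝ) : Set E3 := slab a b 3

include hab in
lemma acyc_box_compl (p : ℕ) : Acyc (box a b)ᶜ (p + 4) := by
  have h0 : Acyc (slab a b 0)ᶜ (p + 1) := by
    rw [slab_zero_compl]
    exact acyc_empty contractE3_zero contractE3_one p
  exact acyc_slab_compl_succ hab (by norm_num) (acyc_slab_compl_succ hab (by norm_num)
    (acyc_slab_compl_succ hab (by norm_num) h0))

include hab in
lemma acyc_box_compl_two : Acyc (box a b)ᶜ 2 := by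
  have h0 : Acyc (slab a b 1)ᶜ 0 := by
    have := slab_compl_union a b 0
    intro c _
    exact (acyc_slabGe_compl a b 0 0 c trivial).mono (this ▸ Set.subset_union_left)
  exact acyc_slab_compl_succ hab (by norm_num) (acyc_slab_compl_succ hab (by norm_num) h0)

include hab in
lemma twoEl_box_compl : TwoEl (box a b)ᶜ 3 := by
  have h0 : TwoEl (slab a b 0)ᶜ 0 := by
    rw [slab_zero_compl]
    exact twoEl_empty_zero contractE3_zero contractE3_one
  have step : ∀ j (_ : j < 3) p, TwoEl (slab a b j)ᶜ p → TwoEl (slab a b (j + 1))ᶜ (p + 1) := by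
    intro j hj p h
    have := TwoEl.union (isOpen_slabGe_compl a b ⟨j, hj⟩) (isOpen_slabLe_compl a b ⟨j, hj⟩)
      (p := p) (acyc_slabGe_compl a b _) (acyc_slabLe_compl a b _)
      (by rwa [slab_compl_inter (hab _)])
    rwa [slab_compl_union] at this
  exact step 2 (by norm_num) 2 (step 1 (by norm_num) 1 (step 0 (by norm_num) 0 h0))

lemma slab_mono {a' b' : Fin 3 → ℝ} (ha : ∀ i, a i ≤ a' i) (hb : ∀ i, b' i ≤ b i) (j : ℕ) :
    slab a' b' j ⊆ slab a b j :=
  fun _ hx i hi => ⟨(ha i).trans (hx i hi).1, (hx i hi).2.trans (hb i)⟩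

include hab in
lemma injRel_box_compl {a' b' : Fin 3 → ℝ} (hab' : ∀ i, a' i ≤ b' i) (ha : ∀ i, a i ≤ a' i)
    (hb : ∀ i, b' i ≤ b i) : InjRel (box a b)ᶜ (box a' b')ᶜ 3 := by
  have h0 : InjRel (slab a b 0)ᶜ (slab a' b' 0)ᶜ 0 := by
    rw [slab_zero_compl, slab_zero_compl]
    exact fun _ _ h => h
  have step : ∀ j (_ : j < 3) p, InjRel (slab a b j)ᶜ (slab a' b' j)ᶜ p →
      InjRel (slab a b (j + 1))ᶜ (slab a' b' (j + 1))ᶜ (p + 1) := by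
    intro j hj p h
    have := InjRel.union (isOpen_slabGe_compl a b ⟨j, hj⟩) (isOpen_slabLe_compl a b ⟨j, hj⟩)
      (isOpen_slabGe_compl a' b' ⟨j, hj⟩) (isOpen_slabLe_compl a' b' ⟨j, hj⟩)
      (Set.compl_subset_compl.2 fun x hx => ⟨slab_mono ha hb _ hx.1, (ha _).trans hx.2⟩)
      (Set.compl_subset_compl.2 fun x hx => ⟨slab_mono ha hb _ hx.1, le_trans hx.2 (hb _)⟩)
      (p := p) (acyc_slabGe_compl a b _ _) (acyc_slabLe_compl a b _ _)
      (by rwa [slab_compl_inter (hab _), slab_compl_inter (hab' _)])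
    rwa [slab_compl_union, slab_compl_union] at this
  exact step 2 (by norm_num) 2 (step 1 (by norm_num) 1 (step 0 (by norm_num) 0 h0))

end

/-! ### Compact subsets of Euclidean space -/

/-- The relative homology of the complement of `K` vanishes above degree `3`, and in degree `3` it
is detected by restriction to the points of `K`. -/
def Good {X : Type*} [TopologicalSpace X] (K : Set X) : Prop :=
  (∀ p, Acyc Kᶜ (p + 4)) ∧
    ∀ c, RelCyc Kᶜ 3 c → (∀ x ∈ K, RelBd ({x}ᶜ : Set X) 3 c) → RelBd Kᶜ 3 c

lemma good_empty {X : Type*} [TopologicalSpace X] : Good (∅ : Set X) := by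
  have h : ∀ p (c : Chain p X), RelBd (∅ : Set X)ᶜ p c := fun p c =>
    relBd_of_mem (by rw [Set.compl_empty, chainsIn_univ]; exact Submodule.mem_top)
  exact ⟨fun p c _ => h _ c, fun c _ _ => h _ c⟩

lemma Good.union {X : Type*} [TopologicalSpace X] {A B : Set X} (hA : IsClosed A) (hB : IsClosed B)
    (h1 : Good A) (h2 : Good B) (h : Good (A ∩ B)) : Good (A ∪ B) := by
  have e1 : (A ∪ B)ᶜ = Aᶜ ∩ Bᶜ := Set.compl_union A B
  have e2 : (A ∩ B)ᶜ = Aᶜ ∪ Bᶜ := Set.compl_inter A B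
  refine ⟨fun p => ?_, fun c hc hx => ?_⟩
  · rw [e1]
    exact Acyc.inter hA.isOpen_compl hB.isOpen_compl (e2 ▸ h.1 (p + 1)) (h1.1 p) (h2.1 p)
  · rw [e1] at hc ⊢
    exact RelBd.inter hA.isOpen_compl hB.isOpen_compl (e2 ▸ h.1 0)
      (h1.2 c (hc.mono Set.inter_subset_left) fun x hxA => hx x (Or.inl hxA))
      (h2.2 c (hc.mono Set.inter_subset_right) fun x hxB => hx x (Or.inr hxB))

lemma box_self (x : E3) : box (fun i => x i) (fun i => x i) = {x} := by
  ext y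
  simp only [slab, Set.mem_ofPred_eq, Set.mem_singleton_iff]
  constructor
  · intro h
    ext i
    exact le_antisymm (h i i.2).2 (h i i.2).1
  · rintro rfl i _
    exact ⟨le_rfl, le_rfl⟩

lemma injRel_box_compl_singleton {a b : Fin 3 → ℝ} {x : E3} (hx : x ∈ box a b) :
    InjRel (box a b)ᶜ {x}ᶜ 3 := by
  have hab : ∀ i, a i ≤ b i := fun i => (hx i i.2).1.trans (hx i i.2).2
  have := injRel_box_compl hab (a' := fun i => x i) (b' := fun i => x i) (fun _ => le_rfl)
    (fun i => (hx i i.2).1) (fun i => (hx i i.2).2)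
  rwa [box_self] at this

lemma good_box (a b : Fin 3 → ℝ) : Good (box a b) := by
  rcases (box a b).eq_empty_or_nonempty with h | ⟨x, hx⟩
  · rw [h]
    exact good_empty
  · exact ⟨acyc_box_compl fun i => (hx i i.2).1.trans (hx i i.2).2,
      fun c hc hx' => injRel_box_compl_singleton hx c hc (hx' x hx)⟩

/-- The union of a finite list of boxes, each given by a pair of opposite vertices. -/
def unionBoxes (l : List ((Fin 3 → ℝ) × (Fin 3 → ℝ))) : Set E3 := {x | ∃ q ∈ l, x ∈ box q.1 q.2}

lemma unionBoxes_cons (q : (Fin 3 → ℝ) × (Fin 3 → ℝ)) (l : List ((Fin 3 → ℝ) × (Fin 3 → ℝ))) :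
    unionBoxes (q :: l) = box q.1 q.2 ∪ unionBoxes l := by
  ext x
  simp [unionBoxes]

lemma isClosed_unionBoxes (l : List ((Fin 3 → ℝ) × (Fin 3 → ℝ))) : IsClosed (unionBoxes l) := by
  induction l with
  | nil => simp [unionBoxes]
  | cons q l ih =>
    rw [unionBoxes_cons]
    exact (isClosed_slab _ _ _).union ih

lemma box_inter_unionBoxes (q : (Fin 3 → ℝ) × (Fin 3 → ℝ))
    (l : List ((Fin 3 → ℝ) × (Fin 3 → ℝ))) :
    box q.1 q.2 ∩ unionBoxes l = unionBoxes (l.map fun r => (q.1 ⊔ r.1, q.2 ⊓ r.2)) := by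
  ext x
  simp only [unionBoxes, slab, Set.mem_inter_iff, Set.mem_ofPred_eq, List.mem_map,
    exists_exists_and_eq_and, Pi.sup_apply, Pi.inf_apply, sup_le_iff, le_inf_iff]
  constructor
  · rintro ⟨h, r, hr, h'⟩
    exact ⟨r, hr, fun i hi => ⟨⟨(h i hi).1, (h' i hi).1⟩, (h i hi).2, (h' i hi).2⟩⟩
  · rintro ⟨r, hr, h⟩
    exact ⟨fun i hi => ⟨(h i hi).1.1, (h i hi).2.1⟩, r, hr,
      fun i hi => ⟨(h i hi).1.2, (h i hi).2.2⟩⟩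

/-- Boxes are closed under intersection, so that the Mayer–Vietoris sequence extends `good_box` to
finite unions by induction. -/
lemma good_unionBoxes (n : ℕ) (l : List ((Fin 3 → ℝ) × (Fin 3 → ℝ))) (hl : l.length = n) :
    Good (unionBoxes l) := by
  induction n generalizing l with
  | zero =>
    rw [List.length_eq_zero_iff.1 hl]
    convert good_empty (X := E3) using 1
    simp [unionBoxes]
  | succ n ih =>
    obtain ⟨q, l, rfl⟩ := List.exists_cons_of_length_eq_add_one hl
    have hl' : l.length = n := by simpa using hl
    rw [unionBoxes_cons]
    refine Good.union (isClosed_slab _ _ _) (isClosed_unionBoxes l) (good_box _ _) (ih l hl') ?_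
    rw [box_inter_unionBoxes]
    exact ih _ (by rw [List.length_map, hl'])

lemma hasBasis_nhds_box (x : E3) :
    (𝓝 x).HasBasis (fun ε : ℝ => 0 < ε) fun ε => box (fun i => x i - ε) (fun i => x i + ε) := by
  have h := (Metric.nhds_basis_closedBall (x := EuclideanSpace.equiv (Fin 3) ℝ x)).comap
    (EuclideanSpace.equiv (Fin 3) ℝ)
  have hind : Topology.IsInducing (EuclideanSpace.equiv (Fin 3) ℝ) :=
    (EuclideanSpace.equiv (Fin 3) ℝ).toHomeomorph.isInducing
  rw [← hind.nhds_eq_comap] at h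
  refine h.congr (fun _ => Iff.rfl) fun ε hε => ?_
  ext y
  rw [Set.mem_preimage, Metric.mem_closedBall, dist_pi_le_iff hε.le]
  refine forall_congr' fun i => ?_
  change |y i - x i| ≤ ε ↔ _
  rw [abs_le]
  constructor
  · rintro ⟨h1, h2⟩ -
    exact ⟨show x i - ε ≤ y i by linarith, show y i ≤ x i + ε by linarith⟩
  · intro h
    obtain ⟨h1, h2⟩ := h i.2
    exact ⟨by linarith, by linarith⟩

lemma isCompact_box (y : E3) (ε : ℝ) :
    IsCompact (box (fun i => y i - ε) (fun i => y i + ε)) := by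
  refine Metric.isCompact_of_isClosed_isBounded (isClosed_slab _ _ _) ?_
  have h : IsCompact ((EuclideanSpace.equiv (Fin 3) ℝ).symm ''
      Metric.closedBall (EuclideanSpace.equiv (Fin 3) ℝ y) |ε|) :=
    (isCompact_closedBall _ _).image (EuclideanSpace.equiv (Fin 3) ℝ).symm.continuous
  refine h.isBounded.subset fun x hx => ⟨EuclideanSpace.equiv (Fin 3) ℝ x, ?_, by simp⟩
  rw [Metric.mem_closedBall, dist_pi_le_iff (abs_nonneg _)]
  intro i
  change |x i - y i| ≤ |ε|
  obtain ⟨h1, h2⟩ := hx i i.2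
  rw [abs_le]
  constructor <;> linarith [le_abs_self ε]

lemma exists_unionBoxes {K N : Set E3} (hK : IsCompact K) (hN : IsOpen N) (hKN : K ⊆ N) :
    ∃ l, K ⊆ unionBoxes l ∧ ∀ q ∈ l, box q.1 q.2 ⊆ N ∧ ∃ x ∈ K, x ∈ box q.1 q.2 := by
  have h : ∀ x ∈ K, ∃ ε : ℝ, 0 < ε ∧ box (fun i => x i - ε) (fun i => x i + ε) ⊆ N := fun x hx =>
    (hasBasis_nhds_box x).mem_iff.1 (hN.mem_nhds (hKN hx))
  choose! ε hε hsub using h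
  obtain ⟨t, ht, hcov⟩ := hK.elim_nhds_subcover
    (fun x => box (fun i => x i - ε x) (fun i => x i + ε x))
    (fun x hx => (hasBasis_nhds_box x).mem_of_mem (hε x hx))
  refine ⟨t.toList.map fun x => ((fun i => x i - ε x), (fun i => x i + ε x)), fun x hx => ?_,
    fun q hq => ?_⟩
  · obtain ⟨y, hy, hxy⟩ := Set.mem_iUnion₂.1 (hcov hx)
    exact ⟨_, List.mem_map.2 ⟨y, Finset.mem_toList.2 hy, rfl⟩, hxy⟩
  · obtain ⟨y, hy, rfl⟩ := List.mem_map.1 hq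
    rw [Finset.mem_toList] at hy
    exact ⟨hsub y (ht y hy), y, ht y hy,
      mem_of_mem_nhds ((hasBasis_nhds_box y).mem_of_mem (hε y (ht y hy)))⟩

/-- A relative cycle modulo the complement of a compact set `K` is one modulo the complement of a
union of boxes that contains `K`, as its boundary has a compact carrier. -/
lemma good_of_isCompact_E3 {K : Set E3} (hK : IsCompact K) : Good K := by
  have key : ∀ p (c : Chain (p + 1) E3), RelCyc Kᶜ (p + 1) c → ∃ l, K ⊆ unionBoxes l ∧
      ∀ q ∈ l, RelCyc (box q.1 q.2)ᶜ (p + 1) c ∧ RelCyc (unionBoxes l)ᶜ (p + 1) c ∧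
        ∃ x ∈ K, x ∈ box q.1 q.2 := by
    intro p c hc
    have hc' : carrier (bd p E3 c) ⊆ Kᶜ := mem_chainsIn_iff.1 hc
    obtain ⟨l, hl, h⟩ := exists_unionBoxes hK (isCompact_carrier (bd p E3 c)).isClosed.isOpen_compl
      (Set.subset_compl_comm.1 hc')
    refine ⟨l, hl, fun q hq => ⟨mem_chainsIn_iff.2 (Set.subset_compl_comm.1 (h q hq).1),
      mem_chainsIn_iff.2 (Set.subset_compl_comm.1 ?_), (h q hq).2⟩⟩
    rintro x ⟨r, hr, hx⟩
    exact (h r hr).1 hx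
  have hempty : ∀ p (c : Chain p E3) l, K ⊆ unionBoxes l → l = [] → RelBd Kᶜ p c := by
    rintro p c _ hl rfl
    have : K = ∅ := Set.subset_empty_iff.1 fun x hx => by simpa [unionBoxes] using hl hx
    refine relBd_of_mem ?_
    rw [this, Set.compl_empty, chainsIn_univ]
    exact Submodule.mem_top
  refine ⟨fun p c hc => ?_, fun c hc hx => ?_⟩
  · obtain ⟨l, hl, h⟩ := key _ c hc
    rcases l.eq_nil_or_concat with rfl | ⟨l', q, rfl⟩
    · exact hempty _ c _ hl rfl
    · exact ((good_unionBoxes _ _ rfl).1 p c (h q (by simp)).2.1).mono (Set.compl_subset_compl.2 hl)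
  · obtain ⟨l, hl, h⟩ := key _ c hc
    rcases l.eq_nil_or_concat with rfl | ⟨l', q, rfl⟩
    · exact hempty _ c _ hl rfl
    · refine ((good_unionBoxes _ _ rfl).2 c (h q (by simp)).2.1 ?_).mono
        (Set.compl_subset_compl.2 hl)
      rintro y ⟨r, hr, hy⟩
      obtain ⟨hr1, -, x, hxK, hxr⟩ := h r hr
      exact (injRel_box_compl_singleton hxr c hr1 (hx x hxK)).mono
        (Set.compl_subset_compl.2 (Set.singleton_subset_iff.2 hy))

/-! ### Excision into a chart -/

section Excision

variable {X Y : Type*} [TopologicalSpace X] [TopologicalSpace Y]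

lemma chainMap_mem_iff {p : ℕ} {f : C(X, Y)} (hf : Function.Injective f) {T : Set Y}
    {c : Chain p X} : chainMap p f c ∈ chainsIn p T ↔ c ∈ chainsIn p (f ⁻¹' T) := by
  classical
  refine ⟨fun h => ?_, fun h => chainMap_mem (fun x hx => hx) h⟩
  have hinj : Function.Injective fun σ : SingSimplex p X => f.comp σ := fun σ τ hστ => by
    ext t
    exact hf (DFunLike.congr_fun hστ t)
  have he : chainMap p f c = Finsupp.mapDomain (fun σ : SingSimplex p X => f.comp σ) c := by
    suffices h' : chainMap p f = Finsupp.lmapDomain (ZMod 2) (ZMod 2)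
        (fun σ : SingSimplex p X => f.comp σ) from LinearMap.congr_fun h' c
    refine free_ext fun σ => ?_
    rw [chainMap_single, Finsupp.lmapDomain_apply, Finsupp.mapDomain_single]
  intro σ hσ t
  rw [he] at h
  refine h (a := f.comp σ) ?_ t
  rw [Finsupp.mapDomain_support_of_injective hinj]
  exact Finset.mem_coe.2 (Finset.mem_image_of_mem _ hσ)

lemma exists_comp_eq {f : C(X, Y)} (hf : Topology.IsEmbedding f)
    {p : ℕ} {σ : SingSimplex p Y} (hσ : σ ∈ simplicesIn p (Set.range f)) :
    ∃ τ : SingSimplex p X, f.comp τ = σ := by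
  choose g hg using hσ
  have hcont : Continuous g := by
    rw [hf.continuous_iff]
    exact σ.continuous.congr fun t => (hg t).symm
  exact ⟨⟨g, hcont⟩, ContinuousMap.ext hg⟩

lemma exists_chainMap_eq {p : ℕ} {f : C(X, Y)} (hf : Topology.IsEmbedding f) {c : Chain p Y}
    (hc : c ∈ chainsIn p (Set.range f)) : ∃ c', chainMap p f c' = c := by
  suffices h : chainsIn p (Set.range f) ≤ LinearMap.range (chainMap p f) from h hc
  intro c hc
  refine map_mem_of_supported LinearMap.id (fun σ hσ => ?_) hc
  obtain ⟨τ, rfl⟩ := exists_comp_eq hf hσ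
  exact ⟨Finsupp.single τ 1, chainMap_single f τ⟩

end Excision

/-- The chart map as a continuous map. -/
def BallChart.map {X : Type*} [TopologicalSpace X] (φ : BallChart X) : C(E3, X) :=
  ⟨φ.toFun, φ.isOpenEmbedding.continuous⟩

section Chart

variable {X : Type*} [TopologicalSpace X] [T2Space X] (φ : BallChart X) {K : Set E3}

lemma BallChart.isClosed_image (hK : IsCompact K) : IsClosed (φ.toFun '' K) :=
  (hK.image φ.isOpenEmbedding.continuous).isClosed

omit [T2Space X] in
lemma BallChart.range_union (K : Set E3) : Set.range φ.map ∪ (φ.toFun '' K)ᶜ = Set.univ := by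
  rw [Set.eq_univ_iff_forall]
  intro x
  by_cases hx : x ∈ φ.toFun '' K
  · exact Or.inl (Set.image_subset_range _ _ hx)
  · exact Or.inr hx

omit [T2Space X] in
lemma BallChart.preimage_compl (K : Set E3) : φ.map ⁻¹' (φ.toFun '' K)ᶜ = Kᶜ := by
  rw [Set.preimage_compl]
  exact congrArg _ (Set.preimage_image_eq K φ.isOpenEmbedding.injective)

/-- Excision: relative cycles modulo the complement of a compact subset of a chart come from the
chart. -/
lemma BallChart.exists_excise (hK : IsCompact K) {p : ℕ} {c : Chain p X}
    (hc : RelCyc (φ.toFun '' K)ᶜ p c) :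
    ∃ c', RelCyc Kᶜ p c' ∧ RelBd (φ.toFun '' K)ᶜ p (c - chainMap p φ.map c') := by
  obtain ⟨d, -, a, ha, b, hb, hab⟩ := exists_split φ.isOpenEmbedding.isOpen_range
    (φ.isClosed_image hK).isOpen_compl (c := c)
    (by
      rw [show Set.range φ.toFun ∪ (φ.toFun '' K)ᶜ = Set.univ from φ.range_union K, chainsIn_univ]
      exact Submodule.mem_top)
    (IsRelCycle.mono (fun q => le_sup_right) hc)
  obtain ⟨a', rfl⟩ := exists_chainMap_eq (f := φ.map) φ.isOpenEmbedding.isEmbedding ha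
  refine ⟨a', ?_, ?_⟩
  · cases p with
    | zero => trivial
    | succ p =>
      change bd p E3 a' ∈ chainsIn p Kᶜ
      rw [← φ.preimage_compl, ← chainMap_mem_iff φ.isOpenEmbedding.injective, ← bd_chainMap]
      have h0 := congrArg (bd p X) hab
      rw [map_add, map_add, bd_bd, zero_add] at h0
      rw [eq_sub_of_add_eq h0.symm]
      exact sub_mem hc (bd_mem_chainsIn hb)
  · refine ⟨d, ?_⟩
    rw [hab]
    convert hb using 1
    abel

lemma BallChart.relBd_iff (hK : IsCompact K) {p : ℕ} {c : Chain p E3} :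
    RelBd (φ.toFun '' K)ᶜ p (chainMap p φ.map c) ↔ RelBd Kᶜ p c := by
  constructor
  · rintro ⟨e, he⟩
    obtain ⟨d, -, a, ha, b, hb, hab⟩ := exists_split φ.isOpenEmbedding.isOpen_range
      (φ.isClosed_image hK).isOpen_compl (c := e)
      (by
        rw [show Set.range φ.toFun ∪ (φ.toFun '' K)ᶜ = Set.univ from φ.range_union K,
          chainsIn_univ]
        exact Submodule.mem_top)
      (by
        change bd p X e ∈ _
        rw [← sub_sub_cancel (chainMap p φ.map c) (bd p X e)]
        exact sub_mem (Submodule.mem_sup_left (chainMap_mem (S := Set.univ)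
          (fun x _ => Set.mem_range_self x) (by rw [chainsIn_univ]; exact Submodule.mem_top)))
          (Submodule.mem_sup_right he))
    obtain ⟨a', rfl⟩ := exists_chainMap_eq (f := φ.map) φ.isOpenEmbedding.isEmbedding ha
    refine ⟨a', ?_⟩
    rw [← φ.preimage_compl, ← chainMap_mem_iff φ.isOpenEmbedding.injective, map_sub, ← bd_chainMap]
    rw [hab, map_add, map_add, bd_bd, zero_add] at he
    convert add_mem he (bd_mem_chainsIn hb) using 1
    abel
  · rintro ⟨d, hd⟩
    refine ⟨chainMap (p + 1) φ.map d, ?_⟩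
    rw [bd_chainMap, ← map_sub, chainMap_mem_iff φ.isOpenEmbedding.injective, φ.preimage_compl]
    exact hd

omit [T2Space X] in
lemma BallChart.relCyc_chainMap {p : ℕ} {c : Chain p E3} (hc : RelCyc Kᶜ p c) :
    RelCyc (φ.toFun '' K)ᶜ p (chainMap p φ.map c) := by
  cases p with
  | zero => trivial
  | succ p =>
    change bd p X _ ∈ chainsIn p _
    rw [bd_chainMap, chainMap_mem_iff φ.isOpenEmbedding.injective, φ.preimage_compl]
    exact hc

lemma BallChart.acyc (hK : IsCompact K) {p : ℕ} (h : Acyc Kᶜ p) : Acyc (φ.toFun '' K)ᶜ p := by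
  intro c hc
  obtain ⟨c', hc', hb⟩ := φ.exists_excise hK hc
  simpa using hb.add ((φ.relBd_iff hK).2 (h c' hc'))

lemma BallChart.injRel (hK : IsCompact K) {L : Set E3} (hL : IsCompact L) (hLK : L ⊆ K) {p : ℕ}
    (h : InjRel Kᶜ Lᶜ p) : InjRel (φ.toFun '' K)ᶜ (φ.toFun '' L)ᶜ p := by
  intro c hc hcL
  obtain ⟨c', hc', hb⟩ := φ.exists_excise hK hc
  have hsub : (φ.toFun '' K)ᶜ ⊆ (φ.toFun '' L)ᶜ := Set.compl_subset_compl.2 (Set.image_mono hLK)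
  have h1 : RelBd (φ.toFun '' L)ᶜ p (chainMap p φ.map c') := by
    simpa using hcL.sub (hb.mono hsub)
  simpa using hb.add ((φ.relBd_iff hK).2 (h c' hc' ((φ.relBd_iff hL).1 h1)))

lemma BallChart.twoEl (hK : IsCompact K) {p : ℕ} (h : TwoEl Kᶜ p) :
    TwoEl (φ.toFun '' K)ᶜ p := by
  refine ⟨?_, fun w w' hw hw' hn hn' => ?_⟩
  · obtain ⟨c, hc, hn⟩ := h.1
    exact ⟨_, φ.relCyc_chainMap hc, fun hb => hn ((φ.relBd_iff hK).1 hb)⟩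
  · obtain ⟨c, hc, hb⟩ := φ.exists_excise hK hw
    obtain ⟨c', hc', hb'⟩ := φ.exists_excise hK hw'
    have h1 := h.2 c c' hc hc'
      (fun hcb => hn (by simpa using hb.add ((φ.relBd_iff hK).2 hcb)))
      (fun hcb => hn' (by simpa using hb'.add ((φ.relBd_iff hK).2 hcb)))
    have h2 := (hb.add hb').add ((φ.relBd_iff hK).2 h1)
    rw [map_add] at h2
    convert h2 using 1
    abel

lemma BallChart.good (hK : IsCompact K) (h : Good K) : Good (φ.toFun '' K) := by
  refine ⟨fun p => φ.acyc hK (h.1 p), fun c hc hx => ?_⟩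
  obtain ⟨c', hc', hb⟩ := φ.exists_excise hK hc
  have h1 := h.2 c' hc' fun x hxK => by
    have h2 : RelBd (φ.toFun '' {x})ᶜ 3 (chainMap 3 φ.map c') := by
      have hsub : (φ.toFun '' K)ᶜ ⊆ (φ.toFun '' {x})ᶜ :=
        Set.compl_subset_compl.2 (Set.image_mono (Set.singleton_subset_iff.2 hxK))
      have h3 := hx (φ.toFun x) ⟨x, hxK, rfl⟩
      rw [← Set.image_singleton] at h3
      simpa using h3.sub (hb.mono hsub)
    exact (φ.relBd_iff isCompact_singleton).1 h2
  simpa using hb.add ((φ.relBd_iff hK).2 h1)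

end Chart

/-! ### Compact subsets of a 3-manifold -/

section Manifold

variable {X : Type*} [TopologicalSpace X]

/-- Every point of a 3-manifold is the center of an open embedding of Euclidean space. -/
lemma exists_ballChart [ChartedSpace (EuclideanSpace ℝ (Fin 3)) X] (x : X) :
    ∃ φ : BallChart X, φ.toFun 0 = x := by
  let e := chartAt (EuclideanSpace ℝ (Fin 3)) x
  obtain ⟨r, hr, hball⟩ := Metric.isOpen_iff.1 e.open_target (e x) (mem_chart_target _ x)
  let u := OpenPartialHomeomorph.univBall (e x) r
  have hu : u.source = Set.univ := OpenPartialHomeomorph.univBall_source _ _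
  have hut : u.target = Metric.ball (e x) r := OpenPartialHomeomorph.univBall_target _ hr
  have hsrc : (u.trans e.symm).source = Set.univ := by
    rw [OpenPartialHomeomorph.trans_source, hu, Set.univ_inter, Set.eq_univ_iff_forall]
    intro y
    exact hball (hut ▸ u.map_source (hu ▸ Set.mem_univ y))
  refine ⟨⟨u.trans e.symm, (u.trans e.symm).isOpenEmbedding hsrc⟩, ?_⟩
  change e.symm (u 0) = x
  rw [OpenPartialHomeomorph.univBall_apply_zero]
  exact e.left_inv (mem_chart_source _ x)

lemma BallChart.image_mem_nhds (φ : BallChart X) {y : E3} {s : Set E3} (hs : s ∈ 𝓝 y) :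
    φ.toFun '' s ∈ 𝓝 (φ.toFun y) :=
  φ.isOpenEmbedding.isOpenMap.image_mem_nhds hs

/-- For a compact subset `K` of a 3-manifold, the relative homology modulo the complement of `K`
vanishes above degree `3`, and in degree `3` it is detected at the points of `K`. -/
theorem good_of_isCompact [T2Space X] [ChartedSpace (EuclideanSpace ℝ (Fin 3)) X] {K : Set X}
    (hK : IsCompact K) : Good K := by
  suffices h : ∃ C, IsCompact C ∧ K ⊆ C ∧ ∀ L ⊆ C, IsClosed L → Good L by
    obtain ⟨C, -, hKC, h⟩ := h
    exact h K hKC hK.isClosed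
  refine hK.induction_on (p := fun s => ∃ C, IsCompact C ∧ s ⊆ C ∧ ∀ L ⊆ C, IsClosed L → Good L)
    ?_ ?_ ?_ fun x _ => ?_
  · refine ⟨∅, isCompact_empty, subset_rfl, fun L hL _ => ?_⟩
    rw [Set.subset_empty_iff.1 hL]
    exact good_empty
  · rintro s t hst ⟨C, hC, h1, h2⟩
    exact ⟨C, hC, hst.trans h1, h2⟩
  · rintro s t ⟨C, hC, h1, h2⟩ ⟨C', hC', h1', h2'⟩
    refine ⟨C ∪ C', hC.union hC', Set.union_subset_union h1 h1', fun L hL hLc => ?_⟩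
    have := Good.union (hLc.inter hC.isClosed) (hLc.inter hC'.isClosed)
      (h2 _ Set.inter_subset_right (hLc.inter hC.isClosed))
      (h2' _ Set.inter_subset_right (hLc.inter hC'.isClosed))
      (h2 _ (Set.inter_subset_left.trans Set.inter_subset_right)
        ((hLc.inter hC.isClosed).inter (hLc.inter hC'.isClosed)))
    rwa [← Set.inter_union_distrib_left, Set.inter_eq_left.2 hL] at this
  · obtain ⟨φ, rfl⟩ := exists_ballChart x
    have hB : IsCompact (Metric.closedBall (0 : E3) 1) := isCompact_closedBall _ _
    refine ⟨_, mem_nhdsWithin_of_mem_nhds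
      (φ.image_mem_nhds (Metric.closedBall_mem_nhds 0 one_pos)),
      φ.toFun '' Metric.closedBall 0 1, hB.image φ.isOpenEmbedding.continuous, subset_rfl,
      fun L hL hLc => ?_⟩
    rw [← Set.image_preimage_eq_of_subset (hL.trans (Set.image_subset_range _ _))]
    have hcomp : IsCompact (φ.toFun ⁻¹' L) := by
      refine hB.of_isClosed_subset (hLc.preimage φ.isOpenEmbedding.continuous) ?_
      rw [← Set.preimage_image_eq (Metric.closedBall 0 1) φ.isOpenEmbedding.injective]
      exact Set.preimage_mono hL
    exact φ.good hcomp (good_of_isCompact_E3 hcomp)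

end Manifold

/-! ### Cochains on small simplices -/

section SmallCochains

variable {X : Type*} [TopologicalSpace X]

/-- The value of a cochain on chains. -/
def ev {p : ℕ} (f : Cochain p X) : Chain p X →ₗ[ZMod 2] ZMod 2 :=
  Finsupp.linearCombination (ZMod 2) f

lemma ev_single {p : ℕ} (f : Cochain p X) (σ : SingSimplex p X) :
    ev f (Finsupp.single σ 1) = f σ := by
  simp [ev]

lemma ev_coboundary {p : ℕ} (f : Cochain p X) (c : Chain (p + 1) X) :
    ev (coboundary p X f) c = ev f (bd p X c) := by
  suffices h : ev (coboundary p X f) = ev f ∘ₗ bd p X from LinearMap.congr_fun h c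
  refine free_ext fun σ => ?_
  simp only [LinearMap.comp_apply, ev_single, bd_single, map_sum]
  rfl

lemma ev_eq_zero {p : ℕ} {f : Cochain p X} {P : Set (SingSimplex p X)} (h : ∀ σ ∈ P, f σ = 0)
    {c : Chain p X} (hc : c ∈ Finsupp.supported (ZMod 2) (ZMod 2) P) : ev f c = 0 := by
  have := map_mem_of_supported (N := ⊥) (ev f) (fun σ hσ => by
    rw [ev_single, h σ hσ]
    exact zero_mem _) hc
  exact this

lemma ev_bd_of_mem_cocycles {p : ℕ} {f : Cochain p X} (hf : f ∈ cocycles p X)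
    (c : Chain (p + 1) X) : ev f (bd p X c) = 0 := by
  rw [← ev_coboundary, show coboundary p X f = 0 from hf]
  exact ev_eq_zero (P := Set.univ) (fun _ _ => rfl) (by simp)

/-- A cochain that vanishes on cycles is a coboundary, as `ℤ/2` is a field. -/
lemma mem_coboundaries_of_ev_cycles {p : ℕ} {f : Cochain (p + 1) X}
    (hf : ∀ c, bd p X c = 0 → ev f c = 0) : f ∈ coboundaries (p + 1) X := by
  have h : ev f ∈ LinearMap.range (bd p X).dualMap := by
    rw [LinearMap.range_dualMap_eq_dualAnnihilator_ker, Submodule.mem_dualAnnihilator]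
    exact hf
  obtain ⟨g, hg⟩ := h
  refine ⟨fun σ => g (Finsupp.single σ 1), ?_⟩
  funext σ
  rw [← ev_single f, ← hg, LinearMap.dualMap_apply, bd_single, map_sum]
  rfl

variable {𝒰 : Set (Set X)} (hU : ∀ U ∈ 𝒰, IsOpen U) (hcov : ⋃₀ 𝒰 = Set.univ)

include hU hcov in
lemma exists_small_of_cover {p : ℕ} {c : Chain p X} (hc : IsRelCycle (smallChains 𝒰) p c) :
    ∃ d, c - bd p X d ∈ smallChains 𝒰 p := by
  obtain ⟨d, -, hd⟩ := exists_small_of_isRelCycle hU (c := c)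
    (by rw [hcov, chainsIn_univ]; exact Submodule.mem_top) hc
  exact ⟨d, hd⟩

include hU hcov in
/-- A cocycle of positive degree that vanishes on the simplices subordinate to an open cover is a
coboundary. -/
lemma mem_coboundaries_of_small {p : ℕ} {f : Cochain (p + 1) X} (hf : f ∈ cocycles (p + 1) X)
    (h : ∀ σ ∈ smallSimplices 𝒰 (p + 1), f σ = 0) : f ∈ coboundaries (p + 1) X := by
  refine mem_coboundaries_of_ev_cycles fun c hc => ?_
  obtain ⟨d, hd⟩ := exists_small_of_cover hU hcov (c := c) (by
    change bd p X c ∈ _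
    rw [hc]
    exact zero_mem _)
  have := ev_eq_zero h hd
  rwa [map_sub, ev_bd_of_mem_cocycles hf, sub_zero] at this

omit [TopologicalSpace X] in
/-- A linear functional can be made to vanish on a subspace `R` without changing it on `S`, if it
vanishes on the intersection. -/
lemma exists_functional_eq_of_inf {K V : Type*} [Field K] [AddCommGroup V] [Module K V]
    (f : V →ₗ[K] K) (R S : Submodule K V) (h : ∀ x ∈ R, x ∈ S → f x = 0) :
    ∃ g : V →ₗ[K] K, (∀ x ∈ R, g x = 0) ∧ ∀ x ∈ S, g x = f x := by
  have h1 : f ∘ₗ S.subtype ∈ LinearMap.range (R.mkQ ∘ₗ S.subtype).dualMap := by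
    rw [LinearMap.range_dualMap_eq_dualAnnihilator_ker, Submodule.mem_dualAnnihilator]
    rintro ⟨s, hs⟩ hker
    exact h s ((Submodule.Quotient.mk_eq_zero _).1 hker) hs
  obtain ⟨g, hg⟩ := h1
  refine ⟨g ∘ₗ R.mkQ, fun x hx => ?_, fun x hx => LinearMap.congr_fun hg ⟨x, hx⟩⟩
  rw [LinearMap.comp_apply, Submodule.mkQ_apply, (Submodule.Quotient.mk_eq_zero _).2 hx, map_zero]

include hU hcov in
/-- A cochain that satisfies the cocycle condition on the simplices subordinate to an open cover
agrees on such simplices with a cocycle. -/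
lemma exists_cocycle_of_small {p : ℕ} (f : Cochain p X)
    (h : ∀ σ ∈ smallSimplices 𝒰 (p + 1), coboundary p X f σ = 0) :
    ∃ f' ∈ cocycles p X, ∀ σ ∈ smallSimplices 𝒰 p, f' σ = f σ := by
  obtain ⟨g, hg0, hg⟩ := exists_functional_eq_of_inf (ev f) (LinearMap.range (bd p X))
    (smallChains 𝒰 p) (by
      rintro _ ⟨e, rfl⟩ hs
      obtain ⟨d, hd⟩ := exists_small_of_cover hU hcov (p := p + 1) (c := e) hs
      have h2 := ev_eq_zero h hd
      rwa [ev_coboundary, map_sub, bd_bd, sub_zero] at h2)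
  refine ⟨fun σ => g (Finsupp.single σ 1), ?_, fun σ hσ => ?_⟩
  · change coboundary p X _ = 0
    funext σ
    have h3 := hg0 _ ⟨Finsupp.single σ 1, rfl⟩
    rw [bd_single, map_sum] at h3
    exact h3
  · exact (hg _ (Finsupp.single_mem_supported _ _ hσ)).trans (ev_single f σ)

end SmallCochains

/-! ### Gluing local solutions of `∂w = z` -/

section Gluing

variable {X : Type*} [TopologicalSpace X]

/-- The difference of two solutions of `∂w = z` over `A` and over `B` that agree at all points of
`A ∩ B` can be absorbed into one of the two, so that a common solution over `A ∪ B` results. -/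
lemma exists_glue {A B : Set X} (hA : IsClosed A) (hB : IsClosed B) (hAB : Good (A ∩ B))
    {z : Chain 2 X} {s : X → Chain 3 X} {a b : Chain 3 X}
    (ha : z - bd 2 X a ∈ chainsIn 2 Aᶜ) (hb : z - bd 2 X b ∈ chainsIn 2 Bᶜ)
    (has : ∀ y ∈ A, RelBd ({y}ᶜ : Set X) 3 (a - s y))
    (hbs : ∀ y ∈ B, RelBd ({y}ᶜ : Set X) 3 (b - s y)) :
    ∃ w, z - bd 2 X w ∈ chainsIn 2 (A ∪ B)ᶜ ∧
      ∀ y ∈ A ∪ B, RelBd ({y}ᶜ : Set X) 3 (w - s y) := by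
  have hbd : bd 2 X (a - b) = (z - bd 2 X b) - (z - bd 2 X a) := by
    rw [map_sub]
    abel
  obtain ⟨f, hf⟩ := hAB.2 (a - b)
    (by
      change bd 2 X (a - b) ∈ chainsIn 2 (A ∩ B)ᶜ
      rw [hbd, Set.compl_inter]
      exact sub_mem (chainsIn_mono Set.subset_union_right _ hb)
        (chainsIn_mono Set.subset_union_left _ ha))
    (fun y hy => by
      have := (has y hy.1).sub (hbs y hy.2)
      rwa [sub_sub_sub_cancel_right] at this)
  have hbd2 : bd 2 X (a - b - bd 3 X f) = (z - bd 2 X b) - (z - bd 2 X a) := by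
    rw [map_sub, bd_bd, sub_zero, hbd]
  rw [Set.compl_inter] at hf
  obtain ⟨h, -, a', ha', b', hb', hab⟩ := exists_split hA.isOpen_compl hB.isOpen_compl hf (by
    change bd 2 X _ ∈ _
    rw [hbd2]
    exact sub_mem (Submodule.mem_sup_right hb) (Submodule.mem_sup_left ha))
  rw [hab, map_add, map_add, bd_bd, zero_add] at hbd2
  have hsub : ∀ {C : Set X} {y}, y ∈ C → Cᶜ ⊆ ({y}ᶜ : Set X) := fun hy =>
    Set.compl_subset_compl.2 (Set.singleton_subset_iff.2 hy)
  refine ⟨a - a', ?_, ?_⟩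
  · rw [Set.compl_union, mem_chainsIn_inter, map_sub]
    constructor
    · convert add_mem ha (bd_mem_chainsIn ha') using 1
      abel
    · convert sub_mem hb (bd_mem_chainsIn hb') using 1
      rw [← sub_eq_zero] at hbd2 ⊢
      rw [← hbd2]
      abel
  · rintro y (hy | hy)
    · convert (has y hy).sub (relBd_of_mem (chainsIn_mono (hsub hy) _ ha')) using 1
      abel
    · convert ((hbs y hy).add (relBd_of_mem (chainsIn_mono (hsub hy) _ hb'))).add
        ((relBd_bd _ f).add (relBd_bd _ h)) using 1
      rw [← sub_eq_zero] at hab ⊢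
      rw [← hab]
      abel

/-- A continuous family of pointwise solutions of `∂w = z` on a closed 3-manifold comes from a
global solution. -/
lemma exists_bd_eq_of_section [T2Space X] [CompactSpace X]
    [ChartedSpace (EuclideanSpace ℝ (Fin 3)) X] {z : Chain 2 X} {s : X → Chain 3 X}
    (h : ∀ x, ∃ N ∈ 𝓝 x, IsCompact N ∧ ∃ w, z - bd 2 X w ∈ chainsIn 2 Nᶜ ∧
      ∀ y ∈ N, RelBd ({y}ᶜ : Set X) 3 (w - s y)) : ∃ w, bd 2 X w = z := by
  obtain ⟨C, -, hC, w, hw, -⟩ := (isCompact_univ (X := X)).induction_on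
    (p := fun t => ∃ C, IsCompact C ∧ t ⊆ C ∧ ∃ w, z - bd 2 X w ∈ chainsIn 2 Cᶜ ∧
      ∀ y ∈ C, RelBd ({y}ᶜ : Set X) 3 (w - s y))
    ⟨∅, isCompact_empty, subset_rfl, 0, by
      rw [Set.compl_empty, chainsIn_univ]
      exact Submodule.mem_top, fun y hy => hy.elim⟩
    (fun t u htu ⟨C, hC, h1, h2⟩ => ⟨C, hC, htu.trans h1, h2⟩)
    (by
      rintro t u ⟨A, hA, h1, a, ha, has⟩ ⟨B, hB, h2, b, hb, hbs⟩
      exact ⟨A ∪ B, hA.union hB, Set.union_subset_union h1 h2, exists_glue hA.isClosed hB.isClosed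
        (good_of_isCompact (hA.inter hB)) ha hb has hbs⟩)
    (by
      intro x _
      obtain ⟨N, hN, hc, hw⟩ := h x
      exact ⟨N, mem_nhdsWithin_of_mem_nhds hN, N, hc, subset_rfl, hw⟩)
  rw [Set.univ_subset_iff.1 hC, Set.compl_univ, mem_chainsIn_empty, sub_eq_zero] at hw
  exact ⟨w, hw.symm⟩

end Gluing

/-! ### Local degrees -/

section Degree

variable {X : Type*} [TopologicalSpace X]

/-- The singular `0`-simplex at a point. -/
abbrev pointSimplex (y : X) : SingSimplex 0 X := ContinuousMap.const _ y

lemma coboundary_zero_apply (h : Cochain 0 X) (γ : SingSimplex 1 X) :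
    coboundary 0 X h γ = h (pointSimplex (γ seg0)) + h (pointSimplex (γ seg1)) := by
  have hf : ∀ i : Fin 2, γ.face i = pointSimplex (γ (stdSimplex.vertex (i.succAbove 0))) := by
    intro i
    ext t
    rw [Subsingleton.elim t (stdSimplex.vertex 0)]
    exact congrArg γ (stdSimplex.map_vertex _ _)
  change ∑ i : Fin 2, h (γ.face i) = _
  rw [Fin.sum_univ_two, hf, hf, add_comm]
  rfl

open Classical in
/-- The class of a relative `3`-cycle of `(X, X \ y)`, in the two-element group
`H_3(X, X \ y; ℤ/2)`. -/
def degAt (y : X) (w : Chain 3 X) : ZMod 2 := if RelBd ({y}ᶜ : Set X) 3 w then 0 else 1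

lemma degAt_eq_zero_iff {y : X} {w : Chain 3 X} : degAt y w = 0 ↔ RelBd ({y}ᶜ : Set X) 3 w := by
  rw [degAt]
  split_ifs with h <;> simp [h]

lemma degAt_of_not {y : X} {w : Chain 3 X} (h : ¬ RelBd ({y}ᶜ : Set X) 3 w) : degAt y w = 1 := by
  rw [degAt, if_neg h]

variable [T2Space X] [ChartedSpace (EuclideanSpace ℝ (Fin 3)) X]

lemma twoEl_point (y : X) : TwoEl ({y}ᶜ : Set X) 3 := by
  obtain ⟨φ, rfl⟩ := exists_ballChart y
  have h := twoEl_box_compl (a := fun i => (0 : E3) i) (b := fun i => (0 : E3) i) fun _ => le_rfl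
  rw [box_self] at h
  have := φ.twoEl isCompact_singleton h
  rwa [Set.image_singleton] at this

lemma degAt_add {y : X} {w w' : Chain 3 X} (hw : RelCyc ({y}ᶜ : Set X) 3 w)
    (hw' : RelCyc ({y}ᶜ : Set X) 3 w') : degAt y (w + w') = degAt y w + degAt y w' := by
  by_cases h : RelBd ({y}ᶜ : Set X) 3 w
  · rw [degAt_eq_zero_iff.2 h, zero_add]
    by_cases h' : RelBd ({y}ᶜ : Set X) 3 w'
    · rw [degAt_eq_zero_iff.2 h', degAt_eq_zero_iff.2 (h.add h')]
    · rw [degAt_of_not h', degAt_of_not fun hb => h' (by simpa using hb.sub h)]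
  · rw [degAt_of_not h]
    by_cases h' : RelBd ({y}ᶜ : Set X) 3 w'
    · rw [degAt_eq_zero_iff.2 h', add_zero, degAt_of_not fun hb => h (by simpa using hb.sub h')]
    · rw [degAt_of_not h', degAt_eq_zero_iff.2 ((twoEl_point y).2 w w' hw hw' h h')]
      rfl

lemma degAt_sub {y : X} {w w' : Chain 3 X} (hw : RelCyc ({y}ᶜ : Set X) 3 w)
    (hw' : RelCyc ({y}ᶜ : Set X) 3 w') : degAt y (w - w') = degAt y w + degAt y w' := by
  rw [ZModModule.sub_eq_add, degAt_add hw hw']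

omit [ChartedSpace (EuclideanSpace ℝ (Fin 3)) X] in
/-- The degree of a relative cycle is constant on boxes in a chart. -/
lemma BallChart.degAt_eq (φ : BallChart X) {a b : Fin 3 → ℝ} (hc : IsCompact (box a b))
    {w : Chain 3 X} (hw : RelCyc (φ.toFun '' box a b)ᶜ 3 w) {y y' : X}
    (hy : y ∈ φ.toFun '' box a b) (hy' : y' ∈ φ.toFun '' box a b) : degAt y w = degAt y' w := by
  have key : ∀ y ∈ φ.toFun '' box a b, degAt y w = 0 ↔ RelBd (φ.toFun '' box a b)ᶜ 3 w := by
    rintro _ ⟨u, hu, rfl⟩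
    rw [degAt_eq_zero_iff]
    have h := φ.injRel hc isCompact_singleton (Set.singleton_subset_iff.2 hu)
      (injRel_box_compl_singleton hu)
    rw [Set.image_singleton] at h
    exact ⟨h w hw, RelBd.mono (Set.compl_subset_compl.2
      (Set.singleton_subset_iff.2 (Set.mem_image_of_mem φ.toFun hu)))⟩
  have h := (key y hy).trans (key y' hy').symm
  generalize degAt y w = d at *
  generalize degAt y' w = d' at *
  revert d d'
  decide +revert

lemma exists_nhds_degAt_eq {V : Set X} (hV : IsOpen V) {w : Chain 3 X} (hw : RelCyc Vᶜ 3 w)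
    {y : X} (hy : y ∈ V) : ∀ᶠ y' in 𝓝 y, degAt y' w = degAt y w := by
  obtain ⟨φ, rfl⟩ := exists_ballChart y
  obtain ⟨ε, hε, hsub⟩ := (hasBasis_nhds_box 0).mem_iff.1
    ((hV.preimage φ.isOpenEmbedding.continuous).mem_nhds hy)
  have hN := (hasBasis_nhds_box 0).mem_of_mem hε
  filter_upwards [φ.image_mem_nhds hN] with y' hy'
  exact φ.degAt_eq (isCompact_box 0 ε)
    (hw.mono (Set.compl_subset_compl.2 (Set.image_subset_iff.2 hsub))) hy'
    ⟨0, mem_of_mem_nhds hN, rfl⟩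

omit [T2Space X] [ChartedSpace (EuclideanSpace ℝ (Fin 3)) X] in
/-- A locally constant function takes the same value at the end points of a path. -/
lemma eq_endpoints_of_locally_const {α : Type*} {V : Set X} {m : X → α}
    (hm : ∀ y ∈ V, ∀ᶠ y' in 𝓝 y, m y' = m y) {γ : SingSimplex 1 X} (hγ : γ ∈ simplicesIn 1 V) :
    m (γ seg0) = m (γ seg1) := by
  have hloc : IsLocallyConstant fun t => m (γ t) := by
    rw [IsLocallyConstant.iff_eventually_eq]
    intro t
    exact γ.continuous.continuousAt.eventually (hm (γ t) (hγ t))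
  exact hloc.apply_eq_of_isPreconnected isPreconnected_univ (Set.mem_univ _) (Set.mem_univ _)

end Degree

/-! ### The duality map from 2-cycles to 1-cochains -/

section Duality

variable {X : Type*} [TopologicalSpace X]

/-- The singular `2`-cycles. -/
abbrev cycles2 (X : Type*) [TopologicalSpace X] : Submodule (ZMod 2) (Chain 2 X) :=
  LinearMap.ker (bd 1 X)

/-- If the relative homology of `(X, Kᶜ)` vanishes in degree `2`, then the equation `∂w = z` can be
solved over `K`, linearly in the `2`-cycle `z`. -/
lemma exists_linear_solution {K : Set X} (h : Acyc Kᶜ 2) :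
    ∃ W : cycles2 X →ₗ[ZMod 2] Chain 3 X,
      ∀ z : cycles2 X, z.1 - bd 2 X (W z) ∈ chainsIn 2 Kᶜ := by
  have key : ∀ z : cycles2 X, ∃ y, z.1 - bd 2 X y ∈ chainsIn 2 Kᶜ := by
    intro z
    refine h z.1 ?_
    change bd 1 X z.1 ∈ chainsIn 1 Kᶜ
    rw [LinearMap.mem_ker.1 z.2]
    exact zero_mem _
  choose y hy using key
  let b := Module.Basis.ofVectorSpace (ZMod 2) (cycles2 X)
  let W : cycles2 X →ₗ[ZMod 2] Chain 3 X := b.constr (ZMod 2) fun i => y (b i)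
  refine ⟨W, fun z => ?_⟩
  have hz : z ∈ Submodule.span (ZMod 2) (Set.range b) := b.span_eq ▸ Submodule.mem_top
  induction hz using Submodule.span_induction with
  | mem z hz =>
    obtain ⟨i, rfl⟩ := hz
    rw [Module.Basis.constr_basis]
    exact hy _
  | zero => rw [map_zero, map_zero, Submodule.coe_zero, sub_zero]; exact zero_mem _
  | add z z' _ _ hz hz' =>
    rw [map_add, map_add, Submodule.coe_add, add_sub_add_comm]
    exact add_mem hz hz'
  | smul a z _ hz =>
    rw [map_smul, map_smul, Submodule.coe_smul, ← smul_sub]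
    exact Submodule.smul_mem _ _ hz

variable (U : X → Set X) (W : X → (cycles2 X →ₗ[ZMod 2] Chain 3 X))

/-- The difference at `y` between the solution of `∂w = z` chosen over `U x` and the one chosen
over `U y`. -/
def transition (x y : X) (z : cycles2 X) : ZMod 2 := degAt y (W x z - W y z)

open Classical in
/-- The cochain that measures the monodromy of solutions of `∂w = z` along short paths: the solution
over a set `U x` that contains the path is compared at both ends with the solutions chosen there.
By `dualCochain_apply` the choice of `x` does not matter. -/
def dualCochain (z : cycles2 X) : Cochain 1 X := fun γ =>
  if h : ∃ x, γ ∈ simplicesIn 1 (U x) then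
    transition W h.choose (γ seg0) z + transition W h.choose (γ seg1) z
  else 0

variable [T2Space X] [ChartedSpace (EuclideanSpace ℝ (Fin 3)) X]
  {U : X → Set X} (hU : ∀ x, IsOpen (U x)) (hmem : ∀ x, x ∈ U x)
  {W : X → (cycles2 X →ₗ[ZMod 2] Chain 3 X)}
  (hW : ∀ (x : X) (z : cycles2 X), z.1 - bd 2 X (W x z) ∈ chainsIn 2 (U x)ᶜ)

include hW in
omit [T2Space X] [ChartedSpace (EuclideanSpace ℝ (Fin 3)) X] in
lemma relCyc_sub (x x' : X) (z : cycles2 X) : RelCyc (U x ∩ U x')ᶜ 3 (W x z - W x' z) := by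
  change bd 2 X _ ∈ chainsIn 2 _
  rw [Set.compl_inter]
  convert sub_mem (chainsIn_mono (Set.subset_union_right (s := (U x)ᶜ)) 2 (hW x' z))
    (chainsIn_mono (Set.subset_union_left (t := (U x')ᶜ)) 2 (hW x z)) using 1
  rw [map_sub]
  abel

include hmem hW in
omit [T2Space X] [ChartedSpace (EuclideanSpace ℝ (Fin 3)) X] in
lemma relCyc_transition {x y : X} (hy : y ∈ U x) (z : cycles2 X) :
    RelCyc ({y}ᶜ : Set X) 3 (W x z - W y z) :=
  (relCyc_sub hW x y z).mono (Set.compl_subset_compl.2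
    (Set.singleton_subset_iff.2 (Set.mem_inter hy (hmem y))))

include hmem hW in
lemma transition_add_transition {x x' y : X} (hy : y ∈ U x) (hy' : y ∈ U x') (z : cycles2 X) :
    transition W x y z + transition W x' y z = degAt y (W x z - W x' z) := by
  rw [transition, transition, ← degAt_sub (relCyc_transition hmem hW hy z)
    (relCyc_transition hmem hW hy' z), sub_sub_sub_cancel_right]

include hmem hW in
lemma transition_add {x y : X} (hy : y ∈ U x) (z z' : cycles2 X) :
    transition W x y (z + z') = transition W x y z + transition W x y z' := by
  rw [transition, transition, transition, ← degAt_add (relCyc_transition hmem hW hy z)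
    (relCyc_transition hmem hW hy z'), map_add, map_add]
  congr 1
  abel

include hU hmem hW in
lemma dualCochain_apply {x : X} {γ : SingSimplex 1 X} (hγ : γ ∈ simplicesIn 1 (U x))
    (z : cycles2 X) :
    dualCochain U W z γ = transition W x (γ seg0) z + transition W x (γ seg1) z := by
  have h : ∃ x, γ ∈ simplicesIn 1 (U x) := ⟨x, hγ⟩
  rw [dualCochain, dif_pos h]
  have hγ' := h.choose_spec
  generalize h.choose = x' at *
  have hloc := eq_endpoints_of_locally_const (V := U x ∩ U x')
    (m := fun y => degAt y (W x z - W x' z))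
    (fun y hy => exists_nhds_degAt_eq ((hU x).inter (hU x')) (relCyc_sub hW x x' z) hy)
    (γ := γ) fun t => ⟨hγ t, hγ' t⟩
  rw [← transition_add_transition hmem hW (hγ _) (hγ' _),
    ← transition_add_transition hmem hW (hγ _) (hγ' _)] at hloc
  generalize transition W x (γ seg0) z = a at *
  generalize transition W x (γ seg1) z = b at *
  generalize transition W x' (γ seg0) z = c at *
  generalize transition W x' (γ seg1) z = d at *
  clear hγ' h
  revert a b c d
  decide

include hU hmem hW in
lemma dualCochain_add (z z' : cycles2 X) :
    dualCochain U W (z + z') = dualCochain U W z + dualCochain U W z' := by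
  funext γ
  by_cases h : ∃ x, γ ∈ simplicesIn 1 (U x)
  · obtain ⟨x, hγ⟩ := h
    rw [Pi.add_apply, dualCochain_apply hU hmem hW hγ, dualCochain_apply hU hmem hW hγ,
      dualCochain_apply hU hmem hW hγ, transition_add hmem hW (hγ _),
      transition_add hmem hW (hγ _)]
    abel
  · simp only [dualCochain, dif_neg h, Pi.add_apply, add_zero]

include hU hmem hW in
lemma coboundary_dualCochain {σ : SingSimplex 2 X} (hσ : σ ∈ smallSimplices (Set.range U) 2)
    (z : cycles2 X) : coboundary 1 X (dualCochain U W z) σ = 0 := by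
  obtain ⟨_, ⟨x, rfl⟩, hσ⟩ := hσ
  have hin : ∀ θ : Fin 2 → Fin 3, σ.reindex θ ∈ simplicesIn 1 (U x) := fun θ t => hσ _
  have hv : ∀ (θ : Fin 2 → Fin 3) (i : Fin 2),
      σ.reindex θ (stdSimplex.vertex i) = σ (stdSimplex.vertex (θ i)) := fun θ i =>
    congrArg σ (stdSimplex.map_vertex _ _)
  rw [coboundary_one_apply, dualCochain_apply hU hmem hW (hin _),
    dualCochain_apply hU hmem hW (hin _), dualCochain_apply hU hmem hW (hin _)]
  simp only [seg0, seg1, hv]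
  simp only [Matrix.cons_val_zero, Matrix.cons_val_one]
  generalize transition W x (σ (stdSimplex.vertex 0)) z = a
  generalize transition W x (σ (stdSimplex.vertex 1)) z = b
  generalize transition W x (σ (stdSimplex.vertex 2)) z = c
  revert a b c
  decide

/-- The straight path between two points in the coordinates of a chart. -/
def BallChart.path {X : Type*} [TopologicalSpace X] (φ : BallChart X) (u u' : E3) :
    SingSimplex 1 X :=
  φ.map.comp ⟨fun t => t 0 • u + t 1 • u', by
    have h : ∀ i : Fin 2, Continuous fun t : stdSimplex ℝ (Fin 2) => t i := fun i =>
      (continuous_apply i).comp continuous_subtype_val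
    exact ((h 0).smul continuous_const).add ((h 1).smul continuous_const)⟩

lemma BallChart.path_zero {X : Type*} [TopologicalSpace X] (φ : BallChart X) (u u' : E3) :
    φ.path u u' seg0 = φ.toFun u := by
  change φ.toFun ((Pi.single 0 1 : Fin 2 → ℝ) 0 • u + (Pi.single 0 1 : Fin 2 → ℝ) 1 • u') = _
  simp

lemma BallChart.path_one {X : Type*} [TopologicalSpace X] (φ : BallChart X) (u u' : E3) :
    φ.path u u' seg1 = φ.toFun u' := by
  change φ.toFun ((Pi.single 1 1 : Fin 2 → ℝ) 0 • u + (Pi.single 1 1 : Fin 2 → ℝ) 1 • u') = _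
  simp

lemma BallChart.path_mem {X : Type*} [TopologicalSpace X] (φ : BallChart X) {C : Set E3}
    (hC : Convex ℝ C) {u u' : E3} (hu : u ∈ C) (hu' : u' ∈ C) :
    φ.path u u' ∈ simplicesIn 1 (φ.toFun '' C) := fun t =>
  ⟨_, hC hu hu' (stdSimplex.zero_le t 0) (stdSimplex.zero_le t 1) (stdSimplex.add_eq_one t), rfl⟩

include hU hmem hW in
/-- If the monodromy of solutions of `∂w = z` is trivial, then `z` is a boundary: a primitive of the
monodromy cochain tells how to correct the local solutions by local generators of
`H_3(X, X \ y; ℤ/2)`, such that they agree. -/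
lemma exists_bd_eq_of_dualCochain [CompactSpace X] {φ : X → BallChart X}
    (hφ : ∀ x, (φ x).toFun 0 = x) (hUφ : ∀ x, U x = (φ x).toFun '' Metric.ball 0 1)
    {z : cycles2 X} {h : Cochain 0 X}
    (hz : ∀ γ ∈ smallSimplices (Set.range U) 1, dualCochain U W z γ = coboundary 0 X h γ) :
    ∃ w, bd 2 X w = z := by
  choose ε hεcyc hεbd using fun y : X => (twoEl_point y).1
  set q : X → ZMod 2 := fun y => h (pointSimplex y) with hq
  refine exists_bd_eq_of_section (s := fun y => W y z + q y • ε y) fun x => ?_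
  obtain ⟨r, hr, hsub⟩ := (hasBasis_nhds_box 0).mem_iff.1 (Metric.ball_mem_nhds (0 : E3) one_pos)
  have hN := (hasBasis_nhds_box 0).mem_of_mem hr
  have hcomp := isCompact_box 0 r
  set B : Set E3 := box (fun i => (0 : E3) i - r) (fun i => (0 : E3) i + r) with hB
  have hBU : (φ x).toFun '' B ⊆ U x := by
    rw [hUφ]
    exact Set.image_mono hsub
  have hab : ∀ i, (0 : E3) i - r ≤ (0 : E3) i + r := fun i => by linarith
  obtain ⟨η, hηcyc, hηbd⟩ := ((φ x).twoEl hcomp (twoEl_box_compl hab)).1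
  have h0B : (0 : E3) ∈ B := mem_of_mem_nhds hN
  have hη : ∀ y ∈ (φ x).toFun '' B, ¬ RelBd ({y}ᶜ : Set X) 3 η := by
    rintro _ ⟨u, hu, rfl⟩ hb
    have hinj := (φ x).injRel hcomp isCompact_singleton (Set.singleton_subset_iff.2 hu)
      (injRel_box_compl_singleton hu)
    rw [Set.image_singleton] at hinj
    exact hηbd (hinj η hηcyc hb)
  have hpt : ∀ {y} {S : Set X}, y ∈ S → Sᶜ ⊆ ({y}ᶜ : Set X) := fun hy =>
    Set.compl_subset_compl.2 (Set.singleton_subset_iff.2 hy)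
  -- The transition function corrected by `q` is constant on the chart.
  have hconst : ∀ y ∈ (φ x).toFun '' B, transition W x y z + q y = q x := by
    rintro _ ⟨u, hu, rfl⟩
    have hpath : (φ x).path 0 u ∈ simplicesIn 1 (U x) := by
      rw [hUφ]
      exact (φ x).path_mem (convex_ball 0 1) (hsub h0B) (hsub hu)
    have h1 := hz _ ⟨U x, ⟨x, rfl⟩, hpath⟩
    rw [dualCochain_apply hU hmem hW hpath, coboundary_zero_apply, (φ x).path_zero,
      (φ x).path_one, hφ] at h1
    have h2 : transition W x x z = 0 := by
      rw [transition, sub_self]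
      exact degAt_eq_zero_iff.2 (relBd_of_mem (zero_mem _))
    rw [h2, zero_add] at h1
    change transition W x _ z = q x + q _ at h1
    rw [h1, add_assoc, CharTwo.add_self_eq_zero, add_zero]
  refine ⟨(φ x).toFun '' B, ?_, hcomp.image (φ x).isOpenEmbedding.continuous,
    W x z + q x • η, ?_, fun y hy => ?_⟩
  · have := (φ x).image_mem_nhds hN
    rwa [hφ] at this
  · rw [map_add, map_smul, ← sub_sub]
    exact sub_mem (chainsIn_mono (Set.compl_subset_compl.2 hBU) _ (hW x z))
      (Submodule.smul_mem _ _ hηcyc)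
  · have hηy : RelCyc ({y}ᶜ : Set X) 3 η := hηcyc.mono (hpt hy)
    have hs : ∀ (c : ZMod 2) {e : Chain 3 X}, RelCyc ({y}ᶜ : Set X) 3 e →
        ¬ RelBd ({y}ᶜ : Set X) 3 e →
        RelCyc ({y}ᶜ : Set X) 3 (c • e) ∧ degAt y (c • e) = c := by
      intro c e he hne
      constructor
      · change bd 2 X _ ∈ chainsIn 2 _
        rw [map_smul]
        exact Submodule.smul_mem _ _ he
      · obtain rfl | rfl : c = 0 ∨ c = 1 := by
          revert c
          decide
        · rw [zero_smul]
          exact degAt_eq_zero_iff.2 (relBd_of_mem (zero_mem _))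
        · rw [one_smul, degAt_of_not hne]
    have e1 := hs (q x) hηy (hη y hy)
    have e2 := hs (q y) (hεcyc y) (hεbd y)
    rw [← degAt_eq_zero_iff, add_sub_add_comm,
      degAt_add (relCyc_transition hmem hW (hBU hy) z) (IsRelCycle.sub e1.1 e2.1),
      degAt_sub e1.1 e2.1, e1.2, e2.2]
    change transition W x y z + (q x + q y) = 0
    rw [add_comm (q x), ← add_assoc, hconst y hy, CharTwo.add_self_eq_zero]

end Duality

/-! ### Finiteness of first cohomology -/

section Charts

variable {X : Type*} [TopologicalSpace X]

lemma mk_eq_zero_iff {n : ℕ} {f : cocycles n X} :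
    (Submodule.Quotient.mk f : Cohomology n X) = 0 ↔ f.1 ∈ coboundaries n X :=
  Submodule.Quotient.mk_eq_zero _

/-- The cohomology of Euclidean space vanishes in positive degrees. -/
lemma mem_coboundaries_E3 {p : ℕ} {f : Cochain (p + 1) E3} (hf : f ∈ cocycles (p + 1) E3) :
    f ∈ coboundaries (p + 1) E3 := by
  refine mem_coboundaries_of_ev_cycles fun c hc => ?_
  obtain ⟨d, rfl⟩ := exists_bd_eq_of_contraction contractE3_zero contractE3_one hc
  exact ev_bd_of_mem_cocycles hf d

/-- On a chart every cocycle of positive degree is the coboundary of a cochain. -/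
lemma BallChart.exists_primitive (φ : BallChart X) {p : ℕ} {f : Cochain (p + 1) X}
    (hf : f ∈ cocycles (p + 1) X) : ∃ h : Cochain p E3, ∀ τ : SingSimplex (p + 1) E3,
      f (φ.map.comp τ) = coboundary p E3 h τ := by
  obtain ⟨h, hh⟩ := mem_coboundaries_E3 (cochainPullback_mem_cocycles _ φ.map f hf)
  exact ⟨h, fun τ => (congrFun hh τ).symm⟩

/-- The function on a chart obtained by integrating a `1`-cochain along straight paths from the
center. -/
def BallChart.prim (φ : BallChart X) (f : Cochain 1 X) (y : X) : ZMod 2 :=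
  f (φ.path 0 (Function.invFun φ.toFun y))

lemma BallChart.prim_spec (φ : BallChart X) {f : Cochain 1 X} (hf : f ∈ cocycles 1 X)
    {γ : SingSimplex 1 X} (hγ : γ ∈ simplicesIn 1 (Set.range φ.toFun)) :
    f γ = φ.prim f (γ seg0) + φ.prim f (γ seg1) := by
  obtain ⟨h, hh⟩ := φ.exists_primitive hf
  obtain ⟨τ, rfl⟩ := exists_comp_eq (f := φ.map) φ.isOpenEmbedding.isEmbedding hγ
  have hp : ∀ u, φ.prim f (φ.toFun u) = h (pointSimplex 0) + h (pointSimplex u) := by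
    intro u
    rw [BallChart.prim, Function.leftInverse_invFun φ.isOpenEmbedding.injective u, BallChart.path,
      hh, coboundary_zero_apply]
    congr 3
    · change (Pi.single 0 1 : Fin 2 → ℝ) 0 • (0 : E3) + (Pi.single 0 1 : Fin 2 → ℝ) 1 • u = 0
      simp
    · change (Pi.single 1 1 : Fin 2 → ℝ) 0 • (0 : E3) + (Pi.single 1 1 : Fin 2 → ℝ) 1 • u = u
      simp
  rw [hh, coboundary_zero_apply]
  change _ = φ.prim f (φ.toFun _) + φ.prim f (φ.toFun _)
  rw [hp, hp, add_add_add_comm, CharTwo.add_self_eq_zero (h _)]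
  exact (zero_add _).symm

end Charts

section Finiteness

variable {X : Type*} [TopologicalSpace X] [T2Space X] [CompactSpace X]
  [ChartedSpace (EuclideanSpace ℝ (Fin 3)) X]

omit [T2Space X] [CompactSpace X] in
/-- The difference of the primitives of a cocycle on two charts is locally constant on the
intersection, uniformly in the cocycle. -/
lemma exists_nhds_prim_add_prim (φ ψ : BallChart X) {y : X} (hy : y ∈ Set.range φ.toFun)
    (hy' : y ∈ Set.range ψ.toFun) : ∃ N ∈ 𝓝 y, ∀ y' ∈ N, ∀ f ∈ cocycles 1 X,
      φ.prim f y' + ψ.prim f y' = φ.prim f y + ψ.prim f y := by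
  obtain ⟨χ, rfl⟩ := exists_ballChart y
  obtain ⟨r, hr, hsub⟩ := Metric.isOpen_iff.1
    ((φ.isOpenEmbedding.isOpen_range.inter ψ.isOpenEmbedding.isOpen_range).preimage
      χ.isOpenEmbedding.continuous) 0 ⟨hy, hy'⟩
  refine ⟨_, χ.image_mem_nhds (Metric.ball_mem_nhds 0 hr), ?_⟩
  rintro _ ⟨u, hu, rfl⟩ f hf
  have hpath := χ.path_mem (convex_ball 0 r) (Metric.mem_ball_self hr) hu
  have hpath' : χ.path 0 u ∈ simplicesIn 1 (Set.range φ.toFun ∩ Set.range ψ.toFun) := fun t =>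
    Set.image_subset_iff.2 hsub (hpath t)
  have h1 := φ.prim_spec hf fun t => (hpath' t).1
  rw [ψ.prim_spec hf fun t => (hpath' t).2, χ.path_zero, χ.path_one] at h1
  generalize φ.prim f (χ.toFun u) = a at *
  generalize φ.prim f (χ.toFun 0) = b at *
  generalize ψ.prim f (χ.toFun u) = c at *
  generalize ψ.prim f (χ.toFun 0) = d at *
  clear hpath hpath'
  revert a b c d
  decide

omit [CompactSpace X] in
/-- The difference of the primitives on two charts takes all its values on two compact balls already
on a finite set of points, which does not depend on the cocycle. -/
lemma exists_finset_prim (φ ψ : BallChart X) : ∃ P : Finset X,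
    ∀ y ∈ φ.toFun '' Metric.closedBall 0 1, y ∈ ψ.toFun '' Metric.closedBall 0 1 →
      ∃ p ∈ P, ∀ f ∈ cocycles 1 X, φ.prim f y + ψ.prim f y = φ.prim f p + ψ.prim f p := by
  have hK : IsCompact (φ.toFun '' Metric.closedBall 0 1 ∩ ψ.toFun '' Metric.closedBall 0 1) :=
    ((isCompact_closedBall _ _).image φ.isOpenEmbedding.continuous).inter
      ((isCompact_closedBall _ _).image ψ.isOpenEmbedding.continuous)
  have h := fun (y : X) (hy : y ∈ φ.toFun '' Metric.closedBall 0 1 ∩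
    ψ.toFun '' Metric.closedBall 0 1) => exists_nhds_prim_add_prim φ ψ
      (Set.image_subset_range _ _ hy.1) (Set.image_subset_range _ _ hy.2)
  choose! N hN hN' using h
  obtain ⟨P, hP, hcov⟩ := hK.elim_nhds_subcover N hN
  refine ⟨P, fun y hy hy' => ?_⟩
  obtain ⟨p, hp, hyp⟩ := Set.mem_iUnion₂.1 (hcov ⟨hy, hy'⟩)
  exact ⟨p, hp, hN' p (hP p hp) y hyp⟩

omit [T2Space X] [CompactSpace X] [ChartedSpace (EuclideanSpace ℝ (Fin 3)) X] in
/-- A linear map with finite-dimensional target the kernel of which consists of coboundaries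
exhibits the finiteness of `H¹`. -/
lemma finite_cohomology_one_of_ker_le {ι : Type*} [Finite ι]
    (Φ : cocycles 1 X →ₗ[ZMod 2] (ι → ZMod 2)) (h : ∀ f, Φ f = 0 → f.1 ∈ coboundaries 1 X) :
    Finite (Cohomology 1 X) := by
  have hfin : Finite (LinearMap.range Φ) := inferInstance
  have : ∀ r : LinearMap.range Φ, ∃ f, Φ f = r.1 := fun r => r.2
  choose g hg using this
  refine Finite.of_surjective (fun r => (Submodule.Quotient.mk (g r) : Cohomology 1 X)) fun a => ?_
  induction a using Submodule.Quotient.induction_on with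
  | _ f =>
    exact ⟨⟨Φ f, f, rfl⟩, (Submodule.Quotient.eq _).2
      (h (g ⟨Φ f, f, rfl⟩ - f) (by rw [map_sub, hg, sub_self]))⟩

/-- The first cohomology of a closed 3-manifold is finite: a cocycle the local primitives of which
agree on the charts of a finite atlas is a coboundary, and this amounts to finitely many linear
equations. -/
theorem finite_cohomology_one : Finite (Cohomology 1 X) := by
  choose φ hφ using fun x : X => exists_ballChart x
  let U : X → Set X := fun x => (φ x).toFun '' Metric.ball 0 1
  have hUo : ∀ x, IsOpen (U x) := fun x => (φ x).isOpenEmbedding.isOpenMap _ Metric.isOpen_ball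
  have hxU : ∀ x, x ∈ U x := fun x => ⟨0, Metric.mem_ball_self one_pos, hφ x⟩
  obtain ⟨T, -, hT⟩ := (isCompact_univ (X := X)).elim_nhds_subcover U
    fun x _ => (hUo x).mem_nhds (hxU x)
  choose P hP using fun x x' : X => exists_finset_prim (φ x) (φ x')
  let ι := Σ q : T × T, P q.1.1 q.2.1
  let Φ : cocycles 1 X →ₗ[ZMod 2] (ι → ZMod 2) :=
    { toFun := fun f i => (φ i.1.1).prim f.1 i.2.1 + (φ i.1.2).prim f.1 i.2.1
      map_add' := fun f g => by
        funext i
        exact add_add_add_comm _ _ _ _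
      map_smul' := fun c f => by
        funext i
        exact (mul_add c _ _).symm }
  refine finite_cohomology_one_of_ker_le Φ fun f hf => ?_
  have hcov : ∀ y : X, ∃ x : T, y ∈ U x := fun y => by
    obtain ⟨x, hx, hy⟩ := Set.mem_iUnion₂.1 (hT (Set.mem_univ y))
    exact ⟨⟨x, hx⟩, hy⟩
  choose i hi using hcov
  have hUK : ∀ x, U x ⊆ (φ x).toFun '' Metric.closedBall 0 1 := fun x =>
    Set.image_mono Metric.ball_subset_closedBall
  have hagree : ∀ (x : T) (y : X), y ∈ U x → (φ x).prim f.1 y = (φ (i y)).prim f.1 y := by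
    intro x y hy
    obtain ⟨p, hp, h⟩ := hP x (i y) y (hUK _ hy) (hUK _ (hi y))
    have h1 : (φ x).prim f.1 p + (φ (i y)).prim f.1 p = 0 :=
      congrFun hf (⟨(x, i y), ⟨p, hp⟩⟩ : ι)
    rw [← h f.1 f.2] at h1
    exact CharTwo.add_eq_zero.1 h1
  let h : Cochain 0 X := fun σ => (φ (i (σ default))).prim f.1 (σ default)
  have hδ : coboundary 0 X h ∈ cocycles 1 X := coboundaries_le_cocycles 1 X ⟨h, rfl⟩
  have hmem := mem_coboundaries_of_small (𝒰 := Set.range fun x : T => U x)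
    (by
      rintro _ ⟨x, rfl⟩
      exact hUo x)
    (by
      rw [Set.eq_univ_iff_forall]
      exact fun y => ⟨_, ⟨i y, rfl⟩, hi y⟩)
    (sub_mem f.2 hδ) (by
      rintro γ ⟨_, ⟨x, rfl⟩, hγ⟩
      rw [Pi.sub_apply, coboundary_zero_apply,
        (φ x).prim_spec f.2 fun t => Set.image_subset_range _ _ (hγ t), hagree x _ (hγ _),
        hagree x _ (hγ _)]
      exact sub_self _)
  simpa using add_mem hmem (show coboundary 0 X h ∈ coboundaries 1 X from ⟨h, rfl⟩)

/-! ### Poincaré duality -/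

/-- The part of Poincaré duality that is needed: a linear map from `2`-cycles to `H¹` the kernel of
which consists of boundaries. -/
theorem exists_duality_map : ∃ D : cycles2 X →ₗ[ZMod 2] Cohomology 1 X,
    ∀ z, D z = 0 → ∃ w, bd 2 X w = z.1 := by
  choose φ hφ using fun x : X => exists_ballChart x
  let U : X → Set X := fun x => (φ x).toFun '' Metric.ball 0 1
  have hUo : ∀ x, IsOpen (U x) := fun x => (φ x).isOpenEmbedding.isOpenMap _ Metric.isOpen_ball
  have hxU : ∀ x, x ∈ U x := fun x => ⟨0, Metric.mem_ball_self one_pos, hφ x⟩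
  have hsol : ∀ x, ∃ W : cycles2 X →ₗ[ZMod 2] Chain 3 X,
      ∀ z : cycles2 X, z.1 - bd 2 X (W z) ∈ chainsIn 2 (U x)ᶜ := by
    intro x
    obtain ⟨W, hW⟩ := exists_linear_solution ((φ x).acyc (isCompact_box 0 1)
      (acyc_box_compl_two fun i => by linarith))
    refine ⟨W, fun z => chainsIn_mono (Set.compl_subset_compl.2 (Set.image_mono ?_)) 2 (hW z)⟩
    intro u hu i _
    have h1 : |u i| ≤ 1 := (PiLp.norm_apply_le u i).trans (mem_ball_zero_iff.1 hu).le
    have h2 := abs_le.1 h1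
    change (0 : ℝ) - 1 ≤ u i ∧ u i ≤ 0 + 1
    constructor <;> linarith
  choose W hW using hsol
  let Θ : cycles2 X →ₗ[ZMod 2] Cochain 1 X :=
    (AddMonoidHom.mk' (dualCochain U W) (dualCochain_add hUo hxU hW)).toZModLinearMap 2
  have hΘ : ∀ z, Θ z = dualCochain U W z := fun z => rfl
  have hopen : ∀ V ∈ Set.range U, IsOpen V := by
    rintro _ ⟨x, rfl⟩
    exact hUo x
  have hcov : ⋃₀ Set.range U = Set.univ :=
    Set.eq_univ_iff_forall.2 fun y => ⟨_, ⟨y, rfl⟩, hxU y⟩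
  have hlift : ∀ z, ∃ f : cocycles 1 X, ∀ γ ∈ smallSimplices (Set.range U) 1, f.1 γ = Θ z γ := by
    intro z
    obtain ⟨f, hf, h⟩ := exists_cocycle_of_small hopen hcov (Θ z) fun σ hσ =>
      coboundary_dualCochain hUo hxU hW hσ z
    exact ⟨⟨f, hf⟩, h⟩
  choose g hg using hlift
  let b := Module.Basis.ofVectorSpace (ZMod 2) (cycles2 X)
  let L : cycles2 X →ₗ[ZMod 2] cocycles 1 X := b.constr (ZMod 2) fun i => g (b i)
  have hL : ∀ z, ∀ γ ∈ smallSimplices (Set.range U) 1, (L z).1 γ = Θ z γ := by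
    intro z γ hγ
    have : LinearMap.proj γ ∘ₗ (cocycles 1 X).subtype ∘ₗ L = LinearMap.proj γ ∘ₗ Θ :=
      b.ext fun i => by
        change (L (b i)).1 γ = Θ (b i) γ
        rw [Module.Basis.constr_basis]
        exact hg _ γ hγ
    exact LinearMap.congr_fun this z
  refine ⟨Submodule.mkQ _ ∘ₗ L, fun z hz => ?_⟩
  obtain ⟨h, hh⟩ := mk_eq_zero_iff.1 hz
  refine exists_bd_eq_of_dualCochain hUo hxU hW hφ (fun _ => rfl) (h := h) fun γ hγ => ?_
  rw [← hΘ, ← hL z γ hγ]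
  exact (congrFun hh γ).symm

/-- `H²` of a closed 3-manifold has at most as many elements as `H¹`: by `exists_duality_map` every
class in `H²`, viewed as a functional on `2`-cycles, factors through `H¹`. -/
theorem card_cohomology_two_le : Finite (Cohomology 2 X) ∧
    Nat.card (Cohomology 2 X) ≤ Nat.card (Cohomology 1 X) := by
  have hfin : Finite (Cohomology 1 X) := finite_cohomology_one
  obtain ⟨D, hD⟩ := exists_duality_map (X := X)
  have hex : ∀ a : Cohomology 2 X, ∃ (g : Cohomology 1 X →ₗ[ZMod 2] ZMod 2) (f : cocycles 2 X),
      Submodule.Quotient.mk f = a ∧ ∀ z : cycles2 X, g (D z) = ev f.1 z.1 := by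
    intro a
    induction a using Submodule.Quotient.induction_on with
    | _ f =>
      have h : ev f.1 ∘ₗ (cycles2 X).subtype ∈ LinearMap.range D.dualMap := by
        rw [LinearMap.range_dualMap_eq_dualAnnihilator_ker, Submodule.mem_dualAnnihilator]
        intro z hz
        obtain ⟨w, hw⟩ := hD z hz
        change ev f.1 z.1 = 0
        rw [← hw, ev_bd_of_mem_cocycles f.2]
      obtain ⟨g, hg⟩ := h
      exact ⟨g, f, rfl, fun z => LinearMap.congr_fun hg z⟩
  choose G F hF hG using hex
  have hinj : Function.Injective G := by
    intro a a' h
    rw [← hF a, ← hF a']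
    refine (Submodule.Quotient.eq _).2 ?_
    refine mem_coboundaries_of_ev_cycles fun c hc => ?_
    have h1 := hG a ⟨c, hc⟩
    rw [h, hG a' ⟨c, hc⟩] at h1
    change ev ((F a).1 - (F a').1) c = 0
    have h2 : ev ((F a).1 - (F a').1) c = ev (F a).1 c - ev (F a').1 c := by
      simp [ev, Finsupp.linearCombination_apply, Finsupp.sum, mul_sub, Finset.sum_sub_distrib]
    rw [h2, h1]
    exact sub_self _
  have hdual : Nat.card (Cohomology 1 X →ₗ[ZMod 2] ZMod 2) = Nat.card (Cohomology 1 X) :=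
    Nat.card_congr (LinearEquiv.ofFinrankEq _ _ Subspace.dual_finrank_eq).toEquiv
  have hfd : Finite (Cohomology 1 X →ₗ[ZMod 2] ZMod 2) :=
    Finite.of_equiv _ (LinearEquiv.ofFinrankEq (Cohomology 1 X) (Module.Dual (ZMod 2) _)
      Subspace.dual_finrank_eq.symm).toEquiv
  exact ⟨Finite.of_injective G hinj, hdual ▸ Nat.card_le_card_of_injective G hinj⟩

end Finiteness

/-! ### Cochains on open subsets -/

section Subsets

variable {X Z : Type*} [TopologicalSpace X] [TopologicalSpace Z]

/-- The cochain `f` is exact on `S`: on the simplices that lie in `S` it is the coboundary of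
some cochain. -/
def ExactOn (S : Set X) {p : ℕ} (f : Cochain (p + 1) X) : Prop :=
  ∃ h : Cochain p X, ∀ σ ∈ simplicesIn (p + 1) S, f σ = coboundary p X h σ

/-- Every `p`-cochain that satisfies the cocycle condition on the simplices that lie in `S` agrees
on `S` with a cocycle of the ambient space. -/
def CocycleExtends (p : ℕ) (S : Set X) : Prop :=
  ∀ e : Cochain p X, (∀ σ ∈ simplicesIn (p + 1) S, coboundary p X e σ = 0) →
    ∃ e' ∈ cocycles p X, ∀ σ ∈ simplicesIn p S, e σ = e' σ

lemma coboundary_congr {p : ℕ} {S : Set X} {f g : Cochain p X}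
    (h : ∀ σ ∈ simplicesIn p S, f σ = g σ) {σ : SingSimplex (p + 1) X}
    (hσ : σ ∈ simplicesIn (p + 1) S) : coboundary p X f σ = coboundary p X g σ := by
  change ∑ i, f (σ.face i) = ∑ i, g (σ.face i)
  exact Finset.sum_congr rfl fun i _ => h _ (face_mem_simplicesIn hσ i)

lemma exists_cochainPullback_eq {j : C(Z, X)} (hj : Function.Injective j) {p : ℕ}
    (h : Cochain p Z) : ∃ h' : Cochain p X, cochainPullback p j h' = h := by
  have hinj : Function.Injective fun τ : SingSimplex p Z => j.comp τ := fun σ τ hστ => by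
    ext t
    exact hj (DFunLike.congr_fun hστ t)
  exact ⟨Function.extend (fun τ : SingSimplex p Z => j.comp τ) h 0,
    funext fun τ => hinj.extend_apply _ _ τ⟩

lemma exactOn_range {j : C(Z, X)} (hj : IsEmbedding j) {p : ℕ} {f : Cochain (p + 1) X}
    (hf : cochainPullback (p + 1) j f ∈ coboundaries (p + 1) Z) : ExactOn (Set.range j) f := by
  obtain ⟨h, hh⟩ := hf
  obtain ⟨h', rfl⟩ := exists_cochainPullback_eq hj.injective h
  refine ⟨h', fun σ hσ => ?_⟩
  obtain ⟨τ, rfl⟩ := exists_comp_eq hj hσ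
  exact (congrFun hh τ).symm

lemma BallChart.exactOn (φ : BallChart X) {p : ℕ} {f : Cochain (p + 1) X}
    (hf : f ∈ cocycles (p + 1) X) : ExactOn (Set.range φ.toFun) f :=
  exactOn_range (j := φ.map) φ.isOpenEmbedding.isEmbedding
    (mem_coboundaries_E3 (cochainPullback_mem_cocycles _ φ.map f hf))

lemma exists_piecewise {U V : Set X} {p : ℕ} {f g : Cochain p X}
    (h : ∀ σ ∈ simplicesIn p (U ∩ V), f σ = g σ) :
    ∃ w : Cochain p X, (∀ σ ∈ simplicesIn p U, w σ = f σ) ∧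
      ∀ σ ∈ simplicesIn p V, w σ = g σ := by
  classical
  refine ⟨fun σ => if σ ∈ simplicesIn p U then f σ else g σ, fun σ hσ => if_pos hσ,
    fun σ hσ => ?_⟩
  by_cases hU : σ ∈ simplicesIn p U
  · exact (if_pos hU).trans (h σ fun t => ⟨hU t, hσ t⟩)
  · exact if_neg hU

section Cover

variable {U V : Set X} (hU : IsOpen U) (hV : IsOpen V) (hUV : U ∪ V = Set.univ)

include hU hV hUV

lemma mem_coboundaries_of_pair {p : ℕ} {f : Cochain (p + 1) X} (hf : f ∈ cocycles (p + 1) X)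
    (h1 : ∀ σ ∈ simplicesIn (p + 1) U, f σ = 0) (h2 : ∀ σ ∈ simplicesIn (p + 1) V, f σ = 0) :
    f ∈ coboundaries (p + 1) X := by
  refine mem_coboundaries_of_small (𝒰 := {U, V}) ?_ ?_ hf ?_
  · rintro _ (rfl | rfl)
    exacts [hU, hV]
  · rw [Set.sUnion_pair, hUV]
  · rintro σ ⟨_, (rfl | rfl), hσ⟩
    exacts [h1 σ hσ, h2 σ hσ]

/-- The part `H^p(U ∩ V) → H^(p+1)(X) → H^(p+1)(U) ⊕ H^(p+1)(V)` of the Mayer–Vietoris sequence,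
for `U ∩ V` the cocycles of which extend. -/
lemma mem_coboundaries_of_exactOn {p : ℕ} (hE : CocycleExtends p (U ∩ V))
    {f : Cochain (p + 1) X} (hf : f ∈ cocycles (p + 1) X) (h1 : ExactOn U f) (h2 : ExactOn V f) :
    f ∈ coboundaries (p + 1) X := by
  obtain ⟨g, hg⟩ := h1
  obtain ⟨h, hh⟩ := h2
  obtain ⟨e, he, hge⟩ := hE (g - h) fun σ hσ => by
    rw [map_sub, Pi.sub_apply, ← hg σ fun t => (hσ t).1, ← hh σ fun t => (hσ t).2, sub_self]
  obtain ⟨w, hwU, hwV⟩ := exists_piecewise (U := U) (V := V) (f := g) (g := h + e) fun σ hσ => by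
    rw [Pi.add_apply, ← hge σ hσ, Pi.sub_apply, add_sub_cancel]
  have hmem : f - coboundary p X w ∈ coboundaries (p + 1) X := by
    refine mem_coboundaries_of_pair hU hV hUV
      (sub_mem hf (coboundaries_le_cocycles (p + 1) X ⟨w, rfl⟩)) (fun σ hσ => ?_) fun σ hσ => ?_
    · rw [Pi.sub_apply, coboundary_congr hwU hσ, hg σ hσ, sub_self]
    · rw [Pi.sub_apply, coboundary_congr hwV hσ, map_add, show coboundary p X e = 0 from he,
        add_zero, hh σ hσ, sub_self]
  have := add_mem hmem (show coboundary p X w ∈ coboundaries (p + 1) X from ⟨w, rfl⟩)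
  rwa [sub_add_cancel] at this

/-- A cocycle on `U` extends to `X` if the cocycles on `U ∩ V` do. -/
lemma cocycleExtends_of_inter {p : ℕ} (hE : CocycleExtends p (U ∩ V)) : CocycleExtends p U := by
  intro g hg
  obtain ⟨e, he, hge⟩ := hE g fun σ hσ => hg σ fun t => (hσ t).1
  obtain ⟨w, hwU, hwV⟩ := exists_piecewise hge
  obtain ⟨f, hf, hfw⟩ := exists_cocycle_of_small (𝒰 := {U, V}) (by
      rintro _ (rfl | rfl)
      exacts [hU, hV]) (by rw [Set.sUnion_pair, hUV]) w (by
      rintro σ ⟨_, (rfl | rfl), hσ⟩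
      · rw [coboundary_congr hwU hσ, hg σ hσ]
      · rw [coboundary_congr hwV hσ, show coboundary p X e = 0 from he]
        rfl)
  exact ⟨f, hf, fun σ hσ => by rw [hfw σ ⟨U, Set.mem_insert _ _, hσ⟩, hwU σ hσ]⟩

end Cover

end Subsets

/-! ### Punctured charts -/

section PuncturedChart

variable {X : Type*} [TopologicalSpace X]

lemma pointSimplex_surjective (σ : SingSimplex 0 X) : ∃ x, pointSimplex x = σ := by
  refine ⟨σ default, ?_⟩
  ext t
  rw [Subsingleton.elim t default]
  rfl

lemma cocycleExtends_zero {S : Set X} (hS : IsPathConnected S) : CocycleExtends 0 S := by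
  intro e he
  obtain ⟨x, hx, hxS⟩ := hS
  refine ⟨fun _ => e (pointSimplex x), ?_, fun σ hσ => ?_⟩
  · change coboundary 0 X _ = 0
    funext γ
    rw [coboundary_zero_apply]
    exact CharTwo.add_self_eq_zero _
  · obtain ⟨y, rfl⟩ := pointSimplex_surjective σ
    obtain ⟨γ, hγ⟩ := hxS (hσ default)
    have h := he ⟨fun t => γ.extend (t.1 1), γ.continuous_extend.comp
      ((continuous_apply 1).comp continuous_subtype_val)⟩ fun t => hγ _
    rw [coboundary_zero_apply] at h
    change e (pointSimplex (γ.extend ((Pi.single 0 1 : Fin 2 → ℝ) 1))) +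
      e (pointSimplex (γ.extend ((Pi.single 1 1 : Fin 2 → ℝ) 1))) = 0 at h
    rw [Pi.single_eq_same, Pi.single_eq_of_ne (by decide), γ.extend_zero, γ.extend_one] at h
    exact (CharTwo.add_eq_zero.1 h).symm

lemma isPathConnected_E3_compl : IsPathConnected ({0}ᶜ : Set E3) :=
  isPathConnected_compl_singleton_of_one_lt_rank (by
    rw [← Module.finrank_eq_rank, finrank_euclideanSpace]
    norm_num) 0

/-- The first cohomology of punctured Euclidean space vanishes. -/
lemma mem_coboundaries_E3_compl {f : Cochain 1 ({0}ᶜ : Set E3)} (hf : f ∈ cocycles 1 _) :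
    f ∈ coboundaries 1 ({0}ᶜ : Set E3) := by
  refine mem_coboundaries_of_ev_cycles fun c hc => ?_
  let j : C(({0}ᶜ : Set E3), E3) := ⟨Subtype.val, continuous_subtype_val⟩
  have hj : IsEmbedding j := IsEmbedding.subtypeVal
  have hr : Set.range j = {0}ᶜ := Subtype.range_coe
  obtain ⟨d, hd⟩ := exists_bd_eq_of_contraction contractE3_zero contractE3_one
    (c := chainMap 1 j c) (by rw [bd_chainMap, hc, map_zero])
  have hA : Acyc ({0}ᶜ : Set E3) 2 := by
    have := acyc_box_compl_two (a := fun i => (0 : E3) i) (b := fun i => (0 : E3) i)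
      fun i => le_rfl
    rwa [box_self] at this
  obtain ⟨w, hw⟩ := hA d (by
    change bd 1 E3 d ∈ chainsIn 1 _
    rw [hd]
    exact (chainMap_mem_iff hj.injective).2 (by
      rw [show j ⁻¹' {0}ᶜ = Set.univ from Set.eq_univ_of_forall fun u => u.2, chainsIn_univ]
      exact Submodule.mem_top))
  rw [← hr] at hw
  obtain ⟨d', hd'⟩ := exists_chainMap_eq hj hw
  have h1 : bd 1 _ d' = c := by
    have h2 : chainMap 1 j (bd 1 _ d' - c) ∈ chainsIn 1 (∅ : Set E3) := by
      rw [mem_chainsIn_empty, map_sub, ← bd_chainMap, hd', map_sub, bd_bd, sub_zero, hd, sub_self]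
    rw [chainMap_mem_iff hj.injective, Set.preimage_empty, mem_chainsIn_empty] at h2
    exact sub_eq_zero.1 h2
  rw [← h1]
  exact ev_bd_of_mem_cocycles hf d'

variable (φ : BallChart X)

/-- The inclusion of the punctured chart. -/
def BallChart.puncturedMap : C(({0}ᶜ : Set E3), X) :=
  φ.map.comp ⟨Subtype.val, continuous_subtype_val⟩

lemma BallChart.isEmbedding_puncturedMap : IsEmbedding φ.puncturedMap :=
  φ.isOpenEmbedding.isEmbedding.comp IsEmbedding.subtypeVal

lemma BallChart.range_puncturedMap :
    Set.range φ.puncturedMap = {φ.toFun 0}ᶜ ∩ Set.range φ.toFun := by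
  ext y
  constructor
  · rintro ⟨u, rfl⟩
    exact ⟨fun h => u.2 (φ.isOpenEmbedding.injective h), u.1, rfl⟩
  · rintro ⟨h, u, rfl⟩
    exact ⟨⟨u, fun hu => h (congrArg φ.toFun hu)⟩, rfl⟩

lemma BallChart.cocycleExtends_zero :
    CocycleExtends 0 ({φ.toFun 0}ᶜ ∩ Set.range φ.toFun) := by
  rw [← φ.range_puncturedMap]
  have : PathConnectedSpace ({0}ᶜ : Set E3) :=
    isPathConnected_iff_pathConnectedSpace.1 isPathConnected_E3_compl
  exact KleinFour.cocycleExtends_zero (isPathConnected_range φ.puncturedMap.continuous)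

lemma BallChart.cocycleExtends_one :
    CocycleExtends 1 ({φ.toFun 0}ᶜ ∩ Set.range φ.toFun) := by
  rw [← φ.range_puncturedMap]
  intro e he
  obtain ⟨h, hh⟩ := exactOn_range φ.isEmbedding_puncturedMap (f := e)
    (mem_coboundaries_E3_compl (funext fun τ => he (φ.puncturedMap.comp τ) fun t => ⟨_, rfl⟩))
  exact ⟨coboundary 0 X h, coboundaries_le_cocycles 1 X ⟨h, rfl⟩, hh⟩

lemma BallChart.compl_union_range : {φ.toFun 0}ᶜ ∪ Set.range φ.toFun = Set.univ := by
  refine Set.eq_univ_of_forall fun y => ?_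
  by_cases h : y = φ.toFun 0
  · exact Or.inr ⟨0, h.symm⟩
  · exact Or.inl h

end PuncturedChart

/-! ### Collapses of a space that is split in two -/

section Splitting

variable {S Y₁ Y₂ : Type*} [TopologicalSpace S] [TopologicalSpace Y₁] [TopologicalSpace Y₂]

/-- The properties of the collapse `r : S → Y₁` of a connected sum: over the complement of the
center of the ball in `Y₁` it is a homeomorphism, and the other collapse `r' : S → Y₂` maps the part
of `S` over this complement into the chart of `Y₂`. -/
structure IsCollapse (φ₁ : BallChart Y₁) (φ₂ : BallChart Y₂) (r : C(S, Y₁)) (r' : C(S, Y₂)) :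
    Prop where
  isClosedMap : IsClosedMap r
  injective : ∀ s t, r s ≠ φ₁.toFun 0 → r s = r t → s = t
  surjective : ∀ y, y ≠ φ₁.toFun 0 → ∃ s, r s = y
  mem_range : ∀ s, r s ≠ φ₁.toFun 0 → r' s ∈ Set.range φ₂.toFun

namespace IsCollapse

variable {φ₁ : BallChart Y₁} {φ₂ : BallChart Y₂} {r : C(S, Y₁)} {r' : C(S, Y₂)}

/-- The restriction of a collapse to the part over the complement of the center of the ball. -/
def restr (φ₁ : BallChart Y₁) (r : C(S, Y₁)) : C((r ⁻¹' {φ₁.toFun 0}ᶜ : Set S), Y₁) :=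
  r.comp ⟨Subtype.val, continuous_subtype_val⟩

lemma isEmbedding (h : IsCollapse φ₁ φ₂ r r') : IsEmbedding (restr φ₁ r) := by
  have h1 : IsClosedMap (Set.restrictPreimage {φ₁.toFun 0}ᶜ r) :=
    h.isClosedMap.restrictPreimage _
  have h2 : IsClosedEmbedding (Set.restrictPreimage {φ₁.toFun 0}ᶜ r) :=
    .of_continuous_injective_isClosedMap r.continuous.restrictPreimage
      (fun s t hst => Subtype.ext (h.injective _ _ s.2 (congrArg Subtype.val hst))) h1
  exact IsEmbedding.subtypeVal.comp h2.isEmbedding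

lemma range_restr (h : IsCollapse φ₁ φ₂ r r') :
    Set.range (restr φ₁ r) = {φ₁.toFun 0}ᶜ := by
  ext y
  constructor
  · rintro ⟨s, rfl⟩
    exact s.2
  · intro hy
    obtain ⟨s, rfl⟩ := h.surjective y hy
    exact ⟨⟨s, hy⟩, rfl⟩

/-- The pullback along the other collapse is exact over the complement of the center. -/
lemma exactOn (h : IsCollapse φ₁ φ₂ r r') {p : ℕ} {f : Cochain (p + 1) Y₂}
    (hf : f ∈ cocycles (p + 1) Y₂) :
    ExactOn (r ⁻¹' {φ₁.toFun 0}ᶜ) (cochainPullback (p + 1) r' f) := by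
  obtain ⟨g, hg⟩ := φ₂.exactOn hf
  exact ⟨cochainPullback p r' g, fun σ hσ => hg _ fun t => h.mem_range _ (hσ t)⟩

variable [T1Space Y₁]

/-- A cocycle on `Y₁` the pullback of which to `S` is exact over the complement of the center is
a coboundary. -/
lemma mem_coboundaries (h : IsCollapse φ₁ φ₂ r r') {p : ℕ}
    (hE : CocycleExtends p ({φ₁.toFun 0}ᶜ ∩ Set.range φ₁.toFun)) {f : Cochain (p + 1) Y₁}
    (hf : f ∈ cocycles (p + 1) Y₁)
    (hr : ExactOn (r ⁻¹' {φ₁.toFun 0}ᶜ) (cochainPullback (p + 1) r f)) :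
    f ∈ coboundaries (p + 1) Y₁ := by
  refine mem_coboundaries_of_exactOn isOpen_compl_singleton φ₁.isOpenEmbedding.isOpen_range
    φ₁.compl_union_range hE hf ?_ (φ₁.exactOn hf)
  rw [← h.range_restr]
  refine exactOn_range h.isEmbedding ?_
  obtain ⟨g, hg⟩ := hr
  exact ⟨cochainPullback p ⟨Subtype.val, continuous_subtype_val⟩ g,
    funext fun τ => (hg (ContinuousMap.comp ⟨Subtype.val, continuous_subtype_val⟩ τ)
      fun t => (τ t).2).symm⟩

/-- If a class of `Y₁` and a class of `Y₂` cancel on `S`, then the former vanishes. -/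
lemma eq_zero_of_add_eq_zero (h : IsCollapse φ₁ φ₂ r r') {p : ℕ}
    (hE : CocycleExtends p ({φ₁.toFun 0}ᶜ ∩ Set.range φ₁.toFun)) {x₁ : Cohomology (p + 1) Y₁}
    {x₂ : Cohomology (p + 1) Y₂} (hx : pullback (p + 1) r x₁ + pullback (p + 1) r' x₂ = 0) :
    x₁ = 0 := by
  induction x₁ using Submodule.Quotient.induction_on with
  | _ f₁ =>
  induction x₂ using Submodule.Quotient.induction_on with
  | _ f₂ =>
  obtain ⟨g, hg⟩ := (Submodule.Quotient.mk_eq_zero _).1 hx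
  obtain ⟨g', hg'⟩ := h.exactOn f₂.2
  refine mk_eq_zero_iff.2 (h.mem_coboundaries hE f₁.2 ⟨g - g', fun σ hσ => ?_⟩)
  rw [map_sub, Pi.sub_apply, ← hg' σ hσ, hg]
  exact (add_sub_cancel_right _ _).symm

/-- A `1`-cocycle of `S` is, over the complement of the center, the pullback of a `1`-cocycle
of `Y₁`. -/
lemma exists_cocycle (h : IsCollapse φ₁ φ₂ r r') {f : Cochain 1 S} (hf : f ∈ cocycles 1 S) :
    ∃ f₁ ∈ cocycles 1 Y₁, ∀ σ ∈ simplicesIn 1 (r ⁻¹' {φ₁.toFun 0}ᶜ),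
      f σ = cochainPullback 1 r f₁ σ := by
  let i : C((r ⁻¹' {φ₁.toFun 0}ᶜ : Set S), S) := ⟨Subtype.val, continuous_subtype_val⟩
  obtain ⟨g, hg⟩ := exists_cochainPullback_eq h.isEmbedding.injective (cochainPullback 1 i f)
  obtain ⟨f₁, hf₁, hgf⟩ := cocycleExtends_of_inter isOpen_compl_singleton
    φ₁.isOpenEmbedding.isOpen_range φ₁.compl_union_range φ₁.cocycleExtends_one g (by
      intro σ hσ
      rw [← h.range_restr] at hσ
      obtain ⟨τ, rfl⟩ := exists_comp_eq h.isEmbedding hσ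
      change coboundary 1 _ (cochainPullback 1 (restr φ₁ r) g) τ = 0
      rw [hg, coboundary_cochainPullback, show coboundary 1 S f = 0 from hf]
      rfl)
  refine ⟨f₁, hf₁, fun σ hσ => ?_⟩
  obtain ⟨τ, rfl⟩ := exists_comp_eq (f := i) IsEmbedding.subtypeVal (by
    rw [show Set.range i = r ⁻¹' {φ₁.toFun 0}ᶜ from Subtype.range_coe]
    exact hσ)
  exact (congrFun hg τ).symm.trans (hgf _ fun t => (τ t).2)

end IsCollapse

variable {φ₁ : BallChart Y₁} {φ₂ : BallChart Y₂} {r₁ : C(S, Y₁)} {r₂ : C(S, Y₂)}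
  [T1Space Y₁] [T1Space Y₂] (h₁ : IsCollapse φ₁ φ₂ r₁ r₂) (h₂ : IsCollapse φ₂ φ₁ r₂ r₁)
  (hcov : r₁ ⁻¹' {φ₁.toFun 0}ᶜ ∪ r₂ ⁻¹' {φ₂.toFun 0}ᶜ = Set.univ)

include h₁ h₂ hcov

/-- Every `1`-class of `S` is the sum of a class of `Y₁` and a class of `Y₂`. -/
lemma exists_add_pullback_eq
    (hconn : IsPathConnected (r₁ ⁻¹' {φ₁.toFun 0}ᶜ ∩ r₂ ⁻¹' {φ₂.toFun 0}ᶜ))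
    (a : Cohomology 1 S) : ∃ a₁ a₂, pullback 1 r₁ a₁ + pullback 1 r₂ a₂ = a := by
  induction a using Submodule.Quotient.induction_on with
  | _ f =>
  obtain ⟨f₁, hf₁, h1⟩ := h₁.exists_cocycle f.2
  obtain ⟨f₂, hf₂, h2⟩ := h₂.exists_cocycle f.2
  refine ⟨Submodule.Quotient.mk ⟨f₁, hf₁⟩, Submodule.Quotient.mk ⟨f₂, hf₂⟩,
    (Submodule.Quotient.eq _).2 ?_⟩
  refine mem_coboundaries_of_exactOn (p := 0)
    (isOpen_compl_singleton.preimage r₁.continuous)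
    (isOpen_compl_singleton.preimage r₂.continuous) hcov (cocycleExtends_zero hconn)
    (f := cochainPullback 1 r₁ f₁ + cochainPullback 1 r₂ f₂ - f.1)
    (sub_mem (add_mem (cochainPullback_mem_cocycles _ _ _ hf₁)
      (cochainPullback_mem_cocycles _ _ _ hf₂)) f.2) ?_ ?_
  · obtain ⟨g, hg⟩ := h₁.exactOn hf₂
    refine ⟨g, fun σ hσ => ?_⟩
    rw [← hg σ hσ, Pi.sub_apply, Pi.add_apply, h1 σ hσ, add_sub_cancel_left]
  · obtain ⟨g, hg⟩ := h₂.exactOn hf₁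
    refine ⟨g, fun σ hσ => ?_⟩
    rw [← hg σ hσ, Pi.sub_apply, Pi.add_apply, h2 σ hσ, add_sub_cancel_right]

omit hcov h₁ h₂ in
omit [T1Space Y₁] in
/-- Every `1`-class has a representative that vanishes on the chart. -/
lemma BallChart.exists_rep (φ : BallChart Y₁) (a : Cohomology 1 Y₁) : ∃ f : cocycles 1 Y₁,
    Submodule.Quotient.mk f = a ∧ ∀ σ ∈ simplicesIn 1 (Set.range φ.toFun), f.1 σ = 0 := by
  induction a using Submodule.Quotient.induction_on with
  | _ f =>
  obtain ⟨h, hh⟩ := φ.exactOn f.2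
  have hd : coboundary 0 Y₁ h ∈ coboundaries 1 Y₁ := ⟨h, rfl⟩
  refine ⟨f - ⟨_, coboundaries_le_cocycles 1 Y₁ hd⟩, ?_, fun σ hσ => ?_⟩
  · rw [Submodule.Quotient.mk_sub, sub_eq_self]
    exact mk_eq_zero_iff.2 hd
  · change f.1 σ - _ = 0
    rw [hh σ hσ, sub_self]

/-- The product of a class of `Y₁` and a class of `Y₂` vanishes on `S`: for representatives that vanish
on the charts, each of the two open parts of `S` kills one of the factors. -/
lemma cup_pullback_pullback (a₁ : Cohomology 1 Y₁) (a₂ : Cohomology 1 Y₂) :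
    cup S (pullback 1 r₁ a₁) (pullback 1 r₂ a₂) = 0 := by
  obtain ⟨f₁, rfl, hf₁⟩ := φ₁.exists_rep a₁
  obtain ⟨f₂, rfl, hf₂⟩ := φ₂.exists_rep a₂
  refine (Submodule.Quotient.mk_eq_zero _).2 (mem_coboundaries_of_pair (p := 1)
    (isOpen_compl_singleton.preimage r₁.continuous)
    (isOpen_compl_singleton.preimage r₂.continuous) hcov
    (cochainCup_mem_cocycles (cochainPullback_mem_cocycles _ _ _ f₁.2)
      (cochainPullback_mem_cocycles _ _ _ f₂.2)) (fun σ hσ => ?_) fun σ hσ => ?_)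
  · change _ * f₂.1 (r₂.comp (σ.reindex ![1, 2])) = 0
    rw [hf₂ _ fun t => h₁.mem_range _ (hσ _), mul_zero]
  · change f₁.1 (r₁.comp (σ.reindex ![0, 1])) * _ = 0
    rw [hf₁ _ fun t => h₂.mem_range _ (hσ _), zero_mul]

end Splitting

lemma pullback_cup {X Y : Type*} [TopologicalSpace X] [TopologicalSpace Y] (F : C(X, Y))
    (a b : Cohomology 1 Y) :
    pullback 2 F (cup Y a b) = cup X (pullback 1 F a) (pullback 1 F b) := by
  induction a using Submodule.Quotient.induction_on with
  | _ f =>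
  induction b using Submodule.Quotient.induction_on with
  | _ g => rfl

/-! ### The collapses of a connected sum -/

section ConnectedSum

lemma norm_radial (u : E3) : ‖radial u‖ = max 0 (2 - ‖u‖) * ‖u‖ := by
  rw [radial, norm_smul, Real.norm_of_nonneg (le_max_left _ _)]

lemma norm_radial_le (u : E3) : ‖radial u‖ ≤ 1 := by
  rw [norm_radial]
  rcases le_total 0 (2 - ‖u‖) with h | h
  · rw [max_eq_right h]
    nlinarith [sq_nonneg (‖u‖ - 1)]
  · rw [max_eq_left h, zero_mul]
    exact zero_le_one

lemma norm_eq_one_of_norm_radial {u : E3} (h : ‖radial u‖ = 1) : ‖u‖ = 1 := by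
  rw [norm_radial] at h
  rcases le_total 0 (2 - ‖u‖) with h' | h'
  · rw [max_eq_right h'] at h
    nlinarith [sq_nonneg (‖u‖ - 1)]
  · rw [max_eq_left h', zero_mul] at h
    exact absurd h zero_ne_one

lemma norm_lt_two_of_radial_ne_zero {u : E3} (h : radial u ≠ 0) : ‖u‖ < 2 :=
  not_le.1 fun h' => h (radial_of_two_le h')

lemma radial_ne_zero {u : E3} (h0 : u ≠ 0) (h : ‖u‖ < 2) : radial u ≠ 0 := by
  rw [radial, max_eq_right (by linarith)]
  exact smul_ne_zero (by linarith) h0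

/-- The radial map is injective on the shell `1 ≤ ‖u‖ < 2`. -/
lemma radial_injective {u w : E3} (hu : 1 ≤ ‖u‖) (hw : 1 ≤ ‖w‖) (h0 : radial u ≠ 0)
    (h : radial u = radial w) : u = w := by
  have hu2 := norm_lt_two_of_radial_ne_zero h0
  have hw2 := norm_lt_two_of_radial_ne_zero (h ▸ h0)
  have hn := congrArg norm h
  rw [norm_radial, norm_radial, max_eq_right (by linarith), max_eq_right (by linarith)] at hn
  have hn' : ‖u‖ = ‖w‖ := by
    have h1 : (‖u‖ - ‖w‖) * (‖u‖ + ‖w‖ - 2) = 0 := by linear_combination -hn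
    rcases mul_eq_zero.1 h1 with h2 | h2 <;> linarith
  rw [radial, radial, hn', max_eq_right (by linarith)] at h
  exact smul_right_injective E3 (by linarith : (2 - ‖w‖) ≠ 0) h

/-- The radial map sends the shell `1 ≤ ‖u‖ < 2` onto the punctured closed unit ball. -/
lemma exists_radial_eq {u : E3} (h0 : u ≠ 0) (h1 : ‖u‖ ≤ 1) : ∃ w, 1 ≤ ‖w‖ ∧ radial w = u := by
  have hn : 0 < ‖u‖ := norm_pos_iff.2 h0
  -- The norm `t` of `w` has to solve `(2 - t) * t = ‖u‖`.
  set q := √(1 - ‖u‖) with hq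
  have hq0 : 0 ≤ q := Real.sqrt_nonneg _
  have hq2 : q ^ 2 = 1 - ‖u‖ := Real.sq_sqrt (by linarith)
  have hq1 : q < 1 := by nlinarith
  have hw : ‖((1 + q) / ‖u‖) • u‖ = 1 + q := by
    rw [norm_smul, Real.norm_of_nonneg (by positivity), div_mul_cancel₀ _ hn.ne']
  refine ⟨((1 + q) / ‖u‖) • u, by rw [hw]; linarith, ?_⟩
  rw [radial, hw, max_eq_right (by linarith), smul_smul]
  have : (2 - (1 + q)) * ((1 + q) / ‖u‖) = 1 := by
    field_simp
    linear_combination -hq2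
  rw [this, one_smul]

variable {Y₁ Y₂ : Type*} [TopologicalSpace Y₁] [TopologicalSpace Y₂] [T2Space Y₁] [T2Space Y₂]
  (φ₁ : BallChart Y₁) (φ₂ : BallChart Y₂)

omit [TopologicalSpace Y₂] [T2Space Y₁] [T2Space Y₂] in
lemma BallChart.one_le_norm {u : E3} (h : φ₁.toFun u ∉ φ₁.toFun '' Metric.ball 0 1) :
    1 ≤ ‖u‖ :=
  not_lt.1 fun h' => h ⟨u, mem_ball_zero_iff.2 h', rfl⟩

omit [T2Space Y₁] in
lemma BallChart.mem_punctured {u : E3} (h : 1 ≤ ‖u‖) :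
    φ₁.toFun u ∉ φ₁.toFun '' Metric.ball 0 1 := by
  rintro ⟨w, hw, hwu⟩
  rw [φ₁.isOpenEmbedding.injective hwu, mem_ball_zero_iff] at hw
  exact absurd hw h.not_gt

lemma BallChart.norm_squash_le (y : Y₁) : ‖φ₁.squash y‖ ≤ 1 := by
  by_cases hy : y ∈ Set.range φ₁.toFun
  · obtain ⟨u, rfl⟩ := hy
    rw [φ₁.squash_apply]
    exact norm_radial_le u
  · change ‖Function.extend φ₁.toFun radial 0 y‖ ≤ 1
    rw [Function.extend_apply' _ _ _ hy, Pi.zero_apply, norm_zero]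
    exact zero_le_one

lemma BallChart.exists_of_squash_ne_zero {y : Y₁} (hy : φ₁.squash y ≠ 0) :
    ∃ u, φ₁.toFun u = y := by
  by_contra h
  exact hy (Function.extend_apply' _ _ _ h)

/-- The canonical homeomorphism `Y₁ # Y₂ → Y₂ # Y₁`. -/
def ConnSum.swap : C(ConnSum φ₁ φ₂, ConnSum φ₂ φ₁) where
  toFun := Quot.lift (fun p => Quot.mk _ p.swap) (by
    rintro _ _ ⟨p, q, u, hu, hp, hq⟩
    exact (Quot.sound (.glue q p u hu hq hp)).symm)
  continuous_toFun := continuous_quot_lift _ (continuous_quot_mk.comp continuous_sum_swap)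

omit [T2Space Y₁] [T2Space Y₂] in
lemma ConnSum.swap_swap (s : ConnSum φ₁ φ₂) :
    ConnSum.swap φ₂ φ₁ (ConnSum.swap φ₁ φ₂ s) = s := by
  obtain ⟨p | p⟩ := s <;> rfl

omit [T2Space Y₂] in
lemma collapseLeft_swap (s : ConnSum φ₁ φ₂) :
    collapseLeft φ₂ φ₁ (ConnSum.swap φ₁ φ₂ s) = collapseRight φ₁ φ₂ s := by
  obtain ⟨p | p⟩ := s <;> rfl

omit [T2Space Y₁] in
lemma collapseRight_swap (s : ConnSum φ₁ φ₂) :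
    collapseRight φ₂ φ₁ (ConnSum.swap φ₁ φ₂ s) = collapseLeft φ₁ φ₂ s := by
  obtain ⟨p | p⟩ := s <;> rfl

omit [T2Space Y₁] in
lemma BallChart.compactSpace_punctured [CompactSpace Y₁] : CompactSpace φ₁.Punctured :=
  isCompact_iff_compactSpace.1
    (φ₁.isOpenEmbedding.isOpenMap _ Metric.isOpen_ball).isClosed_compl.isCompact

instance [CompactSpace Y₁] [CompactSpace Y₂] : CompactSpace (ConnSum φ₁ φ₂) := by
  have := φ₁.compactSpace_punctured
  have := φ₂.compactSpace_punctured
  exact inferInstanceAs (CompactSpace (Quot (GlueRel φ₁ φ₂)))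

omit [T2Space Y₁] in
/-- The collapse is injective outside the fiber of the center of the ball. -/
lemma collapseLeft_injective {s t : ConnSum φ₁ φ₂} (hs : collapseLeft φ₁ φ₂ s ≠ φ₁.toFun 0)
    (h : collapseLeft φ₁ φ₂ s = collapseLeft φ₁ φ₂ t) : s = t := by
  have hmix : ∀ (p : φ₁.Punctured) (q : φ₂.Punctured), p.1 = φ₁.toFun (φ₂.squash q.1) →
      (Quot.mk _ (.inl p) : ConnSum φ₁ φ₂) = Quot.mk _ (.inr q) := by
    rintro ⟨p, hp⟩ ⟨q, hq⟩ h
    dsimp only at h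
    subst h
    have h1 := le_antisymm (φ₂.norm_squash_le q) (φ₁.one_le_norm hp)
    obtain ⟨u, rfl⟩ := φ₂.exists_of_squash_ne_zero (y := q) (by
      rw [← norm_ne_zero_iff, h1]
      exact one_ne_zero)
    have hu : ‖u‖ = 1 := by
      rw [φ₂.squash_apply] at h1
      exact norm_eq_one_of_norm_radial h1
    exact Quot.sound (.glue _ _ u (mem_sphere_zero_iff_norm.2 hu)
      (congrArg φ₁.toFun (φ₂.squash_apply_of_norm_eq_one hu)) rfl)
  obtain ⟨p | p⟩ := s <;> obtain ⟨q | q⟩ := t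
  · exact congrArg (fun p => Quot.mk _ (Sum.inl p)) (Subtype.ext h)
  · exact hmix p q h
  · exact (hmix q p h.symm).symm
  · have h' : φ₂.squash p.1 = φ₂.squash q.1 := φ₁.isOpenEmbedding.injective h
    have hp0 : φ₂.squash p.1 ≠ 0 := fun h0 => hs (congrArg φ₁.toFun h0)
    obtain ⟨⟨u, hu⟩, w, hw⟩ := And.intro (φ₂.exists_of_squash_ne_zero hp0)
      (φ₂.exists_of_squash_ne_zero (h' ▸ hp0))
    have hpu := p.2
    have hqw := q.2
    rw [← hu] at hp0 h' hpu
    rw [← hw] at h' hqw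
    rw [φ₂.squash_apply] at hp0 h'
    rw [φ₂.squash_apply] at h'
    have := radial_injective (φ₂.one_le_norm hpu) (φ₂.one_le_norm hqw) hp0 h'
    exact congrArg (fun p => Quot.mk _ (Sum.inr p)) (Subtype.ext (by rw [← hu, ← hw, this]))

omit [T2Space Y₁] in
lemma collapseLeft_surjective {y : Y₁} (hy : y ≠ φ₁.toFun 0) :
    ∃ s, collapseLeft φ₁ φ₂ s = y := by
  by_cases h : y ∈ φ₁.toFun '' Metric.ball 0 1
  · obtain ⟨u, hu, rfl⟩ := h
    obtain ⟨w, hw, rfl⟩ := exists_radial_eq (fun h => hy (congrArg φ₁.toFun h))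
      (mem_ball_zero_iff.1 hu).le
    exact ⟨Quot.mk _ (.inr ⟨φ₂.toFun w, φ₂.mem_punctured hw⟩),
      congrArg φ₁.toFun (φ₂.squash_apply w)⟩
  · exact ⟨Quot.mk _ (.inl ⟨y, h⟩), rfl⟩

lemma collapseRight_mem_range {s : ConnSum φ₁ φ₂} (hs : collapseLeft φ₁ φ₂ s ≠ φ₁.toFun 0) :
    collapseRight φ₁ φ₂ s ∈ Set.range φ₂.toFun := by
  obtain ⟨p | p⟩ := s
  · exact ⟨_, rfl⟩
  · obtain ⟨u, hu⟩ := φ₂.exists_of_squash_ne_zero (y := p.1)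
      fun h0 => hs (congrArg φ₁.toFun h0)
    exact ⟨u, hu⟩

lemma collapse_cover : collapseLeft φ₁ φ₂ ⁻¹' {φ₁.toFun 0}ᶜ ∪
    collapseRight φ₁ φ₂ ⁻¹' {φ₂.toFun 0}ᶜ = Set.univ := by
  refine Set.eq_univ_of_forall ?_
  rintro ⟨p | p⟩
  · exact Or.inl fun h => p.2 ⟨0, Metric.mem_ball_self one_pos, h.symm⟩
  · exact Or.inr fun h => p.2 ⟨0, Metric.mem_ball_self one_pos, h.symm⟩

variable [CompactSpace Y₁] [CompactSpace Y₂]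

lemma isCollapse_left : IsCollapse φ₁ φ₂ (collapseLeft φ₁ φ₂) (collapseRight φ₁ φ₂) where
  isClosedMap := (collapseLeft φ₁ φ₂).continuous.isClosedMap
  injective _ _ := collapseLeft_injective φ₁ φ₂
  surjective _ := collapseLeft_surjective φ₁ φ₂
  mem_range _ := collapseRight_mem_range φ₁ φ₂

lemma isCollapse_right : IsCollapse φ₂ φ₁ (collapseRight φ₁ φ₂) (collapseLeft φ₁ φ₂) where
  isClosedMap := (collapseRight φ₁ φ₂).continuous.isClosedMap
  injective s t hs hst := by
    rw [← collapseLeft_swap] at hs hst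
    rw [← collapseLeft_swap] at hst
    have := congrArg (ConnSum.swap φ₂ φ₁) (collapseLeft_injective φ₂ φ₁ hs hst)
    rwa [ConnSum.swap_swap, ConnSum.swap_swap] at this
  surjective y hy := by
    obtain ⟨s, rfl⟩ := collapseLeft_surjective φ₂ φ₁ hy
    exact ⟨_, (collapseRight_swap φ₂ φ₁ s)⟩
  mem_range s hs := by
    rw [← collapseLeft_swap] at hs
    rw [← collapseRight_swap]
    exact collapseRight_mem_range φ₂ φ₁ hs

/-- The two parts of a connected sum meet in an open shell, which is connected. -/
lemma isPathConnected_shell : IsPathConnected (collapseLeft φ₁ φ₂ ⁻¹' {φ₁.toFun 0}ᶜ ∩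
    collapseRight φ₁ φ₂ ⁻¹' {φ₂.toFun 0}ᶜ) := by
  -- The shell corresponds to `0 < ‖u‖ < 2` in the coordinates of `φ₁`; this is the image of the
  -- complement of the origin under the following radial contraction.
  let c : E3 → E3 := fun u => (2 / (1 + ‖u‖)) • u
  have hc : Continuous c := by
    have h1 : Continuous fun u : E3 => 1 + ‖u‖ := continuous_const.add continuous_norm
    exact (continuous_const.div h1 fun u => by positivity).smul continuous_id
  have hcn : ∀ u, ‖c u‖ < 2 := by
    intro u
    rw [norm_smul, Real.norm_of_nonneg (by positivity), div_mul_eq_mul_div,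
      div_lt_iff₀ (by positivity)]
    linarith
  have hc0 : ∀ u, u ≠ 0 → c u ≠ 0 := fun u hu => smul_ne_zero (by positivity) hu
  have hcs : ∀ v, v ≠ 0 → ‖v‖ < 2 → ∃ u, u ≠ 0 ∧ c u = v := by
    intro v hv0 hv
    have hpos : 0 < 2 - ‖v‖ := by linarith
    refine ⟨(2 - ‖v‖)⁻¹ • v, smul_ne_zero (by positivity) hv0, ?_⟩
    change (2 / (1 + ‖(2 - ‖v‖)⁻¹ • v‖)) • (2 - ‖v‖)⁻¹ • v = v
    rw [norm_smul, Real.norm_of_nonneg (by positivity), smul_smul]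
    have : 2 / (1 + (2 - ‖v‖)⁻¹ * ‖v‖) * (2 - ‖v‖)⁻¹ = 1 := by
      field_simp
      ring
    rw [this, one_smul]
  have h1 := isPathConnected_E3_compl.image (φ₁.map.continuous.comp hc)
  have hl := isCollapse_left φ₁ φ₂
  have h2 : (φ₁.map ∘ c) '' {0}ᶜ = IsCollapse.restr φ₁ (collapseLeft φ₁ φ₂) ''
      (Subtype.val ⁻¹' (collapseRight φ₁ φ₂ ⁻¹' {φ₂.toFun 0}ᶜ)) := by
    ext y
    constructor
    · rintro ⟨u, hu, rfl⟩
      have hne : φ₁.toFun (c u) ≠ φ₁.toFun 0 := fun h =>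
        hc0 u hu (φ₁.isOpenEmbedding.injective h)
      obtain ⟨s, hs⟩ := collapseLeft_surjective φ₁ φ₂ hne
      refine ⟨⟨s, fun h => hne (hs.symm.trans h)⟩, ?_, hs⟩
      obtain ⟨p | p⟩ := s
      · intro h
        have h3 : φ₁.squash p.1 = 0 := φ₂.isOpenEmbedding.injective h
        rw [show p.1 = φ₁.toFun (c u) from hs, φ₁.squash_apply] at h3
        exact radial_ne_zero (hc0 u hu) (hcn u) h3
      · exact fun h => p.2 ⟨0, Metric.mem_ball_self one_pos, Eq.symm h⟩
    · rintro ⟨⟨s, hs⟩, hs2, rfl⟩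
      suffices h : ∃ v, v ≠ 0 ∧ ‖v‖ < 2 ∧ φ₁.toFun v = collapseLeft φ₁ φ₂ s by
        obtain ⟨v, hv0, hv2, hv⟩ := h
        obtain ⟨u, hu, rfl⟩ := hcs v hv0 hv2
        exact ⟨u, hu, hv⟩
      obtain ⟨p | p⟩ := s
      · have h3 : φ₁.squash p.1 ≠ 0 := fun h0 => hs2 (congrArg φ₂.toFun h0)
        obtain ⟨u, hu⟩ := φ₁.exists_of_squash_ne_zero h3
        refine ⟨u, ?_, ?_, hu⟩
        · rintro rfl
          exact hs hu.symm
        · rw [← hu, φ₁.squash_apply] at h3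
          exact norm_lt_two_of_radial_ne_zero h3
      · exact ⟨φ₂.squash p.1, fun h0 => hs (congrArg φ₁.toFun h0),
          (φ₂.norm_squash_le _).trans_lt one_lt_two, rfl⟩
  rw [h2, ← hl.isEmbedding.isInducing.isPathConnected_iff] at h1
  have h4 := h1.image continuous_subtype_val
  rwa [Subtype.image_preimage_coe] at h4

end ConnectedSum

/-! ### Counting pairs instead of triples -/

section Counting

variable {X : Type*} [TopologicalSpace X]

/-- The quadratic expression `a² + ab + b²`, which is the value of `ab + bc + ac` for
`c = a + b`. -/
def form (a b : Cohomology 1 X) : Cohomology 2 X := cup X a a + cup X a b + cup X b b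

lemma form_eq {a b c : Cohomology 1 X} (h : a + b + c = 0) :
    cup X a b + cup X b c + cup X a c = form a b := by
  have hc : c = a + b := by
    rw [← sub_eq_zero, ← h, ZModModule.sub_eq_add, add_comm]
  rw [hc, map_add, map_add, cup_comm b a, form, ← add_assoc (cup X a b), ZModModule.add_self, zero_add]
  abel

lemma form_self (a : Cohomology 1 X) : form a a = cup X a a := by
  rw [form, ZModModule.add_self, zero_add]

lemma form_comm (a b : Cohomology 1 X) : form a b = form b a := by
  rw [form, form, cup_comm a b]
  abel

lemma form_add_right (a b : Cohomology 1 X) : form a (a + b) = form a b := by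
  rw [← form_eq (c := a + b) (ZModModule.add_self _), ← form_eq (c := b)]
  · rw [cup_comm (a + b) b]
    abel
  · rw [add_right_comm, ZModModule.add_self]

/-- The pairs `(a, b)` with `a² + ab + b² = x`. -/
def pairs (x : Cohomology 2 X) : Type _ :=
  {p : Cohomology 1 X × Cohomology 1 X // form p.1 p.2 = x}

variable [Finite (Cohomology 1 X)]

instance (x : Cohomology 2 X) : Finite (pairs x) := Subtype.finite

/-- If `x` is not a square, then each set counted by `v x` has three distinct elements, and so
arises from six pairs. -/
lemma card_pairs {x : Cohomology 2 X} (hx : ¬ ∃ a, cup X a a = x) :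
    Nat.card (pairs x) = 6 * v x := by
  classical
  have := Fintype.ofFinite (Cohomology 1 X)
  set P : Finset (Cohomology 1 X × Cohomology 1 X) :=
    Finset.univ.filter fun p => form p.1 p.2 = x with hP
  have hmem : ∀ p, p ∈ P ↔ form p.1 p.2 = x := fun p => by simp [hP]
  let F : Cohomology 1 X × Cohomology 1 X → Finset (Cohomology 1 X) := fun p =>
    {p.1, p.2, p.1 + p.2}
  have hdist : ∀ p ∈ P, p.1 ≠ p.2 ∧ p.1 ≠ p.1 + p.2 ∧ p.2 ≠ p.1 + p.2 := by
    rintro ⟨a, b⟩ hp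
    rw [hmem] at hp
    refine ⟨fun h => ?_, fun h => ?_, fun h => ?_⟩
    · change a = b at h
      subst h
      exact hx ⟨_, (form_self _).symm.trans hp⟩
    · have hb : b = 0 := left_eq_add.1 h
      exact hx ⟨a, by rw [← hp, hb, form]; simp⟩
    · have ha : a = 0 := right_eq_add.1 h
      exact hx ⟨b, by rw [← hp, ha, form]; simp⟩
  have hfib : ∀ T ∈ P.image F, (P.filter fun p => F p = T).card = 6 := by
    intro T hT
    obtain ⟨⟨a, b⟩, hp, rfl⟩ := Finset.mem_image.1 hT
    obtain ⟨h1, h2, h3⟩ := hdist _ hp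
    have hT3 : (F (a, b)).card = 3 := Finset.card_eq_three.2 ⟨a, b, a + b, h1, h2, h3, rfl⟩
    rw [show P.filter (fun p => F p = F (a, b)) = (F (a, b)).offDiag from ?_,
      Finset.offDiag_card, hT3]
    rw [hmem] at hp
    have e1 : a + (a + b) = b := by rw [← add_assoc, ZModModule.add_self, zero_add]
    have e2 : b + (a + b) = a := by rw [add_left_comm, ZModModule.add_self, add_zero]
    have e3 : a + b + a = b := (add_comm _ _).trans e1
    have e4 : a + b + b = a := (add_comm _ _).trans e2
    have f1 := form_add_right a b
    have f2 : form b (a + b) = form a b := by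
      rw [add_comm, form_add_right, form_comm]
    ext ⟨c, d⟩
    rw [Finset.mem_filter, Finset.mem_offDiag]
    constructor
    · rintro ⟨hcd, hF⟩
      refine ⟨?_, ?_, (hdist _ hcd).1⟩ <;> rw [← hF] <;> simp [F]
    · rintro ⟨hc, hd, hne⟩
      rw [hmem]
      simp only [F, Finset.mem_insert, Finset.mem_singleton] at hc hd ⊢
      rcases hc with rfl | rfl | rfl <;> rcases hd with rfl | rfl | rfl <;>
        first
        | exact absurd rfl hne
        | skip
      · exact ⟨hp, rfl⟩
      · exact ⟨f1.trans hp, by rw [e1]; ext; simp; tauto⟩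
      · exact ⟨(form_comm _ _).trans hp, by rw [add_comm]; ext; simp; tauto⟩
      · exact ⟨f2.trans hp, by rw [e2]; ext; simp; tauto⟩
      · exact ⟨(form_comm _ _).trans (f1.trans hp), by rw [e3]; ext; simp; tauto⟩
      · exact ⟨(form_comm _ _).trans (f2.trans hp), by rw [e4]; ext; simp; tauto⟩
  have hv : v x = (P.image F).card := by
    rw [v, show kleinTriples x = (fun T : Finset (Cohomology 1 X) => (T : Set _)) ''
      (P.image F : Set (Finset (Cohomology 1 X))) from ?_,
      Set.ncard_image_of_injective _ Finset.coe_injective, Set.ncard_coe_finset]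
    ext T
    constructor
    · rintro ⟨a, b, c, rfl, hs, h⟩
      have hc : c = a + b := by
        rw [← sub_eq_zero, ← hs, ZModModule.sub_eq_add, add_comm]
      refine ⟨F (a, b), Finset.mem_coe.2 (Finset.mem_image_of_mem F ((hmem _).2 ?_)), ?_⟩
      · rw [← form_eq hs, h]
      · rw [hc]
        simp [F]
    · rintro ⟨_, hT, rfl⟩
      obtain ⟨⟨a, b⟩, hp, rfl⟩ := Finset.mem_image.1 (Finset.mem_coe.1 hT)
      refine ⟨a, b, a + b, by simp [F], ZModModule.add_self _, ?_⟩
      rw [form_eq (ZModModule.add_self _), (hmem _).1 hp]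
  have hcard : Nat.card (pairs x) = P.card := by
    rw [pairs, Nat.card_eq_fintype_card, Fintype.card_subtype]
  rw [hcard, hv, Finset.card_eq_sum_card_image F P, Finset.sum_congr rfl hfib,
    Finset.sum_const, smul_eq_mul, mul_comm]

lemma card_modEq_card_fixedPoints {α : Type*} [Finite α] {f : α → α}
    (hf : Function.Involutive f) : Nat.card α ≡ Nat.card (Function.fixedPoints f) [MOD 2] := by
  classical
  have := Fintype.ofFinite α
  have h := Equiv.Perm.card_fixedPoints_modEq (p := 2) (n := 1) (f := f) (by
    rw [pow_one]
    exact (sq (M := Function.End α) f).trans (funext hf))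
  rw [Nat.card_eq_fintype_card, Nat.card_eq_fintype_card]
  exact h

/-- Modulo `2` the pairs are counted by those on the diagonal, that is, by the square roots
of `x`. -/
lemma card_pairs_modEq (x : Cohomology 2 X) :
    Nat.card (pairs x) ≡ Nat.card {a : Cohomology 1 X // cupSquare X a = x} [MOD 2] := by
  let f : pairs x → pairs x := fun p => ⟨p.1.swap, (form_comm _ _).trans p.2⟩
  have h := card_modEq_card_fixedPoints (f := f) fun p => Subtype.ext (Prod.swap_swap p.1)
  have e : Nat.card {a : Cohomology 1 X // cupSquare X a = x} = Nat.card (Function.fixedPoints f) :=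
    Nat.card_eq_of_bijective
      (fun a => ⟨⟨(a.1, a.1), (form_self _).trans a.2⟩, rfl⟩)
      ⟨fun a b hab => Subtype.ext (congrArg (fun q => q.1.1.1) hab), fun ⟨⟨⟨a, b⟩, hp⟩, hf⟩ => by
        obtain rfl : b = a := congrArg (fun q => q.1.1) hf
        exact ⟨⟨b, (form_self b).symm.trans hp⟩, rfl⟩⟩
  rwa [e]

/-- If `k X ≠ 0`, translation by a nonzero `κ` with `κ² = 0` pairs off the square roots of `x`. -/
lemma card_roots_modEq_zero (hk : k X ≠ 0) (x : Cohomology 2 X) :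
    Nat.card {a : Cohomology 1 X // cupSquare X a = x} ≡ 0 [MOD 2] := by
  have hne : LinearMap.ker (cupSquare X) ≠ ⊥ := by
    intro h
    rw [k, h] at hk
    exact hk (finrank_bot _ _)
  obtain ⟨κ, hκ, hκ0⟩ := Submodule.exists_mem_ne_zero_of_ne_bot hne
  let f : {a : Cohomology 1 X // cupSquare X a = x} → {a : Cohomology 1 X // cupSquare X a = x} :=
    fun a => ⟨a.1 + κ, by rw [map_add, LinearMap.mem_ker.1 hκ, add_zero, a.2]⟩
  have h := card_modEq_card_fixedPoints (f := f) fun a => Subtype.ext (by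
    change a.1 + κ + κ = a.1
    rw [add_assoc, ZModModule.add_self, add_zero])
  have : IsEmpty (Function.fixedPoints f) :=
    ⟨fun a => hκ0 (add_eq_left.1 (congrArg Subtype.val a.2))⟩
  rwa [Nat.card_of_isEmpty (α := Function.fixedPoints f)] at h

/-- If `k X = 0`, squaring is injective, hence bijective if `H²` is not larger than `H¹`. -/
lemma card_roots_eq_one (hk : k X = 0) (hfin : Finite (Cohomology 2 X))
    (hle : Nat.card (Cohomology 2 X) ≤ Nat.card (Cohomology 1 X)) (x : Cohomology 2 X) :
    Nat.card {a : Cohomology 1 X // cupSquare X a = x} = 1 := by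
  have hker : LinearMap.ker (cupSquare X) = ⊥ := Submodule.finrank_eq_zero.1 hk
  have hbij := (LinearMap.ker_eq_bot.1 hker).bijective_of_nat_card_le hle
  obtain ⟨a, ha, huniq⟩ := hbij.existsUnique x
  rw [Nat.card_eq_one_iff_exists]
  exact ⟨⟨a, ha⟩, fun b => Subtype.ext (huniq b.1 b.2)⟩

end Counting

/-! ### The invariants of a connected sum -/

section Sum

variable {Y₁ Y₂ : Type*} [TopologicalSpace Y₁] [TopologicalSpace Y₂] [T2Space Y₁] [T2Space Y₂]
  [CompactSpace Y₁] [CompactSpace Y₂] (φ₁ : BallChart Y₁) (φ₂ : BallChart Y₂)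

lemma sumClass_injective {p : ℕ}
    (h₁ : CocycleExtends p ({φ₁.toFun 0}ᶜ ∩ Set.range φ₁.toFun))
    (h₂ : CocycleExtends p ({φ₂.toFun 0}ᶜ ∩ Set.range φ₂.toFun))
    {x₁ x₁' : Cohomology (p + 1) Y₁} {x₂ x₂' : Cohomology (p + 1) Y₂}
    (h : sumClass (p + 1) φ₁ φ₂ x₁ x₂ = sumClass (p + 1) φ₁ φ₂ x₁' x₂') :
    x₁ = x₁' ∧ x₂ = x₂' := by
  have h' : pullback (p + 1) (collapseLeft φ₁ φ₂) (x₁ - x₁') +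
      pullback (p + 1) (collapseRight φ₁ φ₂) (x₂ - x₂') = 0 := by
    rw [map_sub, map_sub, ← sub_eq_zero.2 h, sumClass, sumClass]
    abel
  exact ⟨sub_eq_zero.1 ((isCollapse_left φ₁ φ₂).eq_zero_of_add_eq_zero h₁ h'),
    sub_eq_zero.1 ((isCollapse_right φ₁ φ₂).eq_zero_of_add_eq_zero h₂ ((add_comm _ _).trans h'))⟩

lemma exists_sumClass_one_eq (a : Cohomology 1 (ConnSum φ₁ φ₂)) :
    ∃ a₁ a₂, sumClass 1 φ₁ φ₂ a₁ a₂ = a :=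
  exists_add_pullback_eq (isCollapse_left φ₁ φ₂) (isCollapse_right φ₁ φ₂)
    (collapse_cover φ₁ φ₂) (isPathConnected_shell φ₁ φ₂) a

lemma cup_sumClass (a₁ b₁ : Cohomology 1 Y₁) (a₂ b₂ : Cohomology 1 Y₂) :
    cup _ (sumClass 1 φ₁ φ₂ a₁ a₂) (sumClass 1 φ₁ φ₂ b₁ b₂) =
      sumClass 2 φ₁ φ₂ (cup Y₁ a₁ b₁) (cup Y₂ a₂ b₂) := by
  have h := cup_pullback_pullback (isCollapse_left φ₁ φ₂) (isCollapse_right φ₁ φ₂)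
    (collapse_cover φ₁ φ₂)
  rw [sumClass, sumClass, sumClass, LinearMap.map_add₂, map_add, map_add, h,
    cup_comm (pullback 1 (collapseRight φ₁ φ₂) a₂), h, pullback_cup, pullback_cup, add_zero,
    zero_add]

omit [CompactSpace Y₁] [CompactSpace Y₂] in
lemma sumClass_add (n : ℕ) (x₁ x₁' : Cohomology n Y₁) (x₂ x₂' : Cohomology n Y₂) :
    sumClass n φ₁ φ₂ (x₁ + x₁') (x₂ + x₂') =
      sumClass n φ₁ φ₂ x₁ x₂ + sumClass n φ₁ φ₂ x₁' x₂' := by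
  rw [sumClass, sumClass, sumClass, map_add, map_add]
  abel

lemma form_sumClass (a₁ b₁ : Cohomology 1 Y₁) (a₂ b₂ : Cohomology 1 Y₂) :
    form (sumClass 1 φ₁ φ₂ a₁ a₂) (sumClass 1 φ₁ φ₂ b₁ b₂) =
      sumClass 2 φ₁ φ₂ (form a₁ b₁) (form a₂ b₂) := by
  rw [form, cup_sumClass, cup_sumClass, cup_sumClass, ← sumClass_add, ← sumClass_add]
  rfl

lemma not_square_sumClass {x₁ : Cohomology 2 Y₁} (hx₁ : ¬ ∃ a, cup Y₁ a a = x₁)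
    (x₂ : Cohomology 2 Y₂) : ¬ ∃ a, cup _ a a = sumClass 2 φ₁ φ₂ x₁ x₂ := by
  rintro ⟨a, ha⟩
  obtain ⟨a₁, a₂, rfl⟩ := exists_sumClass_one_eq φ₁ φ₂ a
  rw [cup_sumClass] at ha
  exact hx₁ ⟨a₁, (sumClass_injective φ₁ φ₂ φ₁.cocycleExtends_one φ₂.cocycleExtends_one ha).1⟩

lemma card_pairs_sumClass (x₁ : Cohomology 2 Y₁) (x₂ : Cohomology 2 Y₂) :
    Nat.card (pairs (sumClass 2 φ₁ φ₂ x₁ x₂)) = Nat.card (pairs x₁) * Nat.card (pairs x₂) := by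
  rw [← Nat.card_prod]
  let f : pairs x₁ × pairs x₂ → pairs (sumClass 2 φ₁ φ₂ x₁ x₂) := fun q =>
    ⟨(sumClass 1 φ₁ φ₂ q.1.1.1 q.2.1.1, sumClass 1 φ₁ φ₂ q.1.1.2 q.2.1.2), by
      rw [form_sumClass, q.1.2, q.2.2]⟩
  refine (Nat.card_eq_of_bijective f ⟨?_, ?_⟩).symm
  · rintro ⟨p, q⟩ ⟨p', q'⟩ h
    have h' := congrArg Subtype.val h
    have hi := fun {x₁ x₁' x₂ x₂'} => sumClass_injective φ₁ φ₂ φ₁.cocycleExtends_zero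
      φ₂.cocycleExtends_zero (x₁ := x₁) (x₁' := x₁') (x₂ := x₂) (x₂' := x₂')
    obtain ⟨h1, h2⟩ := hi (congrArg Prod.fst h')
    obtain ⟨h3, h4⟩ := hi (congrArg Prod.snd h')
    exact Prod.ext (Subtype.ext (Prod.ext h1 h3)) (Subtype.ext (Prod.ext h2 h4))
  · rintro ⟨⟨a, b⟩, hab⟩
    obtain ⟨a₁, a₂, rfl⟩ := exists_sumClass_one_eq φ₁ φ₂ a
    obtain ⟨b₁, b₂, rfl⟩ := exists_sumClass_one_eq φ₁ φ₂ b
    obtain ⟨h1, h2⟩ := sumClass_injective φ₁ φ₂ φ₁.cocycleExtends_one φ₂.cocycleExtends_one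
      ((form_sumClass φ₁ φ₂ a₁ b₁ a₂ b₂).symm.trans hab)
    exact ⟨(⟨(a₁, b₁), h1⟩, ⟨(a₂, b₂), h2⟩), rfl⟩

lemma v_sumClass [Finite (Cohomology 1 Y₁)] [Finite (Cohomology 1 Y₂)] {x₁ : Cohomology 2 Y₁}
    (hx₁ : ¬ ∃ a, cup Y₁ a a = x₁) (x₂ : Cohomology 2 Y₂) :
    v (sumClass 2 φ₁ φ₂ x₁ x₂) = v x₁ * Nat.card (pairs x₂) := by
  have : Finite (Cohomology 1 (ConnSum φ₁ φ₂)) :=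
    Finite.of_surjective (fun q : Cohomology 1 Y₁ × Cohomology 1 Y₂ => sumClass 1 φ₁ φ₂ q.1 q.2)
      fun a => by
        obtain ⟨a₁, a₂, h⟩ := exists_sumClass_one_eq φ₁ φ₂ a
        exact ⟨(a₁, a₂), h⟩
  have h := card_pairs_sumClass φ₁ φ₂ x₁ x₂
  rw [card_pairs (not_square_sumClass φ₁ φ₂ hx₁ x₂), card_pairs hx₁, mul_assoc] at h
  exact Nat.eq_of_mul_eq_mul_left (by norm_num) h

end Sum

end
end KleinFour

theorem mainTheorem5 {Y₁ Y₂ : Type*}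
    [TopologicalSpace Y₁] [T2Space Y₁] [CompactSpace Y₁] [ConnectedSpace Y₁]
    [ChartedSpace (EuclideanSpace ℝ (Fin 3)) Y₁]
    [TopologicalSpace Y₂] [T2Space Y₂] [CompactSpace Y₂] [ConnectedSpace Y₂]
    [ChartedSpace (EuclideanSpace ℝ (Fin 3)) Y₂]
    (φ₁ : KleinFour.BallChart Y₁) (φ₂ : KleinFour.BallChart Y₂)
    (x₁ : KleinFour.Cohomology 2 Y₁) (x₂ : KleinFour.Cohomology 2 Y₂)
    (hx₁ : ¬ ∃ a : KleinFour.Cohomology 1 Y₁, KleinFour.cup Y₁ a a = x₁) :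
    (KleinFour.k Y₂ = 0 →
      KleinFour.v (KleinFour.sumClass 2 φ₁ φ₂ x₁ x₂) ≡ KleinFour.v x₁ [MOD 2]) ∧
    (KleinFour.k Y₂ ≠ 0 →
      KleinFour.v (KleinFour.sumClass 2 φ₁ φ₂ x₁ x₂) ≡ 0 [MOD 2]) := by
  have := KleinFour.finite_cohomology_one (X := Y₁)
  have := KleinFour.finite_cohomology_one (X := Y₂)
  rw [KleinFour.v_sumClass φ₁ φ₂ hx₁]
  have h := (KleinFour.card_pairs_modEq x₂).mul_left (KleinFour.v x₁)
  refine ⟨fun hk => ?_, fun hk => ?_⟩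
  · obtain ⟨hfin, hle⟩ := KleinFour.card_cohomology_two_le (X := Y₂)
    rwa [KleinFour.card_roots_eq_one hk hfin hle, mul_one] at h
  · exact h.trans ((KleinFour.card_roots_modEq_zero hk x₂).mul_left _)
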